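/- **Model.** A *planar subdivision* is a finite straight-line plane graph (distinct vertices; edges are segments whose relative interiors are pairwise disjoint and contain no vertex) together with its faces, the connected components of the complement of the union of vertices and edges. Its *size* $r$ is the total number of vertices, edges and faces. It is given combinatorially: for each edge the names of its two endpoints and of the faces on its left and on its right, and the name of the unbounded face. Coordinates are accessible only through two Boolean primitives on named points, the comparison of two $x$-coordinates and the orientation test of three points. The primitives are *noisy*: every evaluation returns the wrong answer independently of all others with probability at most $p$, where $p<1/2$ is a known constant. Algorithms run on a synchronous CREW PRAM whose words have $O(\log n)$ bits; *span* is the number of parallel steps, *work* the total number of operations of all processors, *space* the number of shared memory cells used. All evaluations of primitives are grouped into *noisy operations*: a noisy operation is a noise-tolerant search by one processor in a sequence of primitive tests, fixed when the operation starts, whose correct answers are sorted (first all true, then all false); that is, a noisy binary search, or, for a sequence of length one, the repeated evaluation of a single test. **Lemma.** Let $p<1/2$ and $c\in\mathbb N$ be constants. There are a construction algorithm and a query algorithm, not depending on $n$ or on the subdivision, such that for every planar subdivision of size $r\le n$ the following holds, where the constants in the $O$-bounds depend only on $p$ and $c$. With probability at least $1-n^{-c}$, the construction algorithm halts with $O(\log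 n)$ span, $O(r^3\log n)$ work, $O(r^2)$ space and $O(r^3)$ noisy operations, and leaves in memory a data structure with this property: for every query point $q\in\mathbb R^2$, with probability at least $1-n^{-c}$ over the noise of the query, the query algorithm reports a face whose closure contains $q$ (so the unique face containing $q$, if $q$ lies on no vertex or edge) in $O(\log n)$ sequential time, using at most two noisy operations (noisy binary searches). Queries use $O(1)$ scratch cells and do not alter the data structure. -/

import Mathlib

open MeasureTheory ProbabilityTheory Set Filter Topology
open scoped ENNReal

/-! ### Planar subdivisions -/

/-- The sign of `orient a b c` is positive iff `c` lies strictly to the left of the directed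
line from `a` to `b`. -/
def orient (a b c : ℝ × ℝ) : ℝ :=
  (b.1 - a.1) * (c.2 - a.2) - (b.2 - a.2) * (c.1 - a.1)

/-- A finite straight-line plane graph: distinct vertices, edges drawn as segments, the
relative interiors of the edges being pairwise disjoint and free of vertices. -/
structure PlaneGraph where
  nv : ℕ
  ne : ℕ
  vtx : Fin nv → ℝ × ℝ
  src : Fin ne → Fin nv
  dst : Fin ne → Fin nv
  vtx_injective : Function.Injective vtx
  src_ne_dst : ∀ e, src e ≠ dst e
  disjoint_edges : ∀ e e', e ≠ e' →
    Disjoint (openSegment ℝ (vtx (src e)) (vtx (dst e)))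
      (openSegment ℝ (vtx (src e')) (vtx (dst e')))
  vtx_notMem_edge : ∀ v e, vtx v ∉ openSegment ℝ (vtx (src e)) (vtx (dst e))

/-- The union of all vertices and all (closed) edges. -/
def PlaneGraph.skeleton (G : PlaneGraph) : Set (ℝ × ℝ) :=
  range G.vtx ∪ ⋃ e, segment ℝ (G.vtx (G.src e)) (G.vtx (G.dst e))

/-- The left normal of the directed edge `e`. -/
def PlaneGraph.normal (G : PlaneGraph) (e : Fin G.ne) : ℝ × ℝ :=
  (-((G.vtx (G.dst e)).2 - (G.vtx (G.src e)).2), (G.vtx (G.dst e)).1 - (G.vtx (G.src e)).1)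

/-- A planar subdivision: a straight-line plane graph with its faces (the connected components
of the complement of the skeleton), and the usual incidence records: for each directed edge the
face to its left and the face to its right, and the name of the unbounded face. -/
structure PlanarSubdivision extends PlaneGraph where
  nf : ℕ
  face : Fin nf → Set (ℝ × ℝ)
  face_component : ∀ f, ∃ z ∈ toPlaneGraph.skeletonᶜ,
    face f = connectedComponentIn toPlaneGraph.skeletonᶜ z
  face_cover : toPlaneGraph.skeletonᶜ ⊆ ⋃ f, face f
  face_injective : Function.Injective face
  leftFace : Fin ne → Fin nf
  rightFace : Fin ne → Fin nf
  leftFace_spec : ∀ e, ∀ z ∈ openSegment ℝ (vtx (src e)) (vtx (dst e)),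
    ∀ᶠ t : ℝ in 𝓝[>] 0, z + t • toPlaneGraph.normal e ∈ face (leftFace e)
  rightFace_spec : ∀ e, ∀ z ∈ openSegment ℝ (vtx (src e)) (vtx (dst e)),
    ∀ᶠ t : ℝ in 𝓝[<] 0, z + t • toPlaneGraph.normal e ∈ face (rightFace e)
  outer : Fin nf
  outer_spec : face outer ∈ Bornology.cobounded (ℝ × ℝ)

namespace PlanarSubdivision

/-- The size of a subdivision: the number of its vertices, edges and faces. -/
def size (S : PlanarSubdivision) : ℕ := S.nv + S.ne + S.nf

/-- `a` is the name of a face whose closure contains `q`. Faces are open and disjoint, so for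
`q` off the skeleton this says that `a` names the unique face containing `q`; a point on the
skeleton may be reported in any of the faces that it bounds. -/
def Locates (S : PlanarSubdivision) (q : ℝ × ℝ) (a : ℕ) : Prop :=
  ∃ f : Fin S.nf, a = f ∧ q ∈ closure (S.face f)

/-- The points that an algorithm can name while it builds the structure: the vertices. -/
def sites (S : PlanarSubdivision) (i : ℕ) : Option (ℝ × ℝ) :=
  if h : i < S.nv then some (S.vtx ⟨i, h⟩) else none

/-- The points that an algorithm can name during a query: the vertices, and the query point
under the name `nv`. -/
def sitesWith (S : PlanarSubdivision) (q : ℝ × ℝ) (i : ℕ) : Option (ℝ × ℝ) :=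
  if i = S.nv then some q else S.sites i

/-- The combinatorial input in memory: `n`, the numbers of vertices, edges and faces, the name
of the unbounded face, and then four words for each edge (its two endpoints, its left and its
right face). No coordinate is stored. -/
def input (S : PlanarSubdivision) (n : ℕ) : ℕ → ℕ
  | 0 => n
  | 1 => S.nv
  | 2 => S.ne
  | 3 => S.nf
  | 4 => S.outer
  | b + 5 =>
    if h : b / 4 < S.ne then
      match b % 4 with
      | 0 => S.src ⟨b / 4, h⟩
      | 1 => S.dst ⟨b / 4, h⟩
      | 2 => S.leftFace ⟨b / 4, h⟩
      | _ => S.rightFace ⟨b / 4, h⟩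
    else 0

end PlanarSubdivision

/-! ### Geometric primitives and noise -/

/-- A Boolean geometric primitive applied to named points. -/
inductive Query
  | xLess (a b : ℕ)
  | ccw (a b c : ℕ)

/-- The correct answer: `xLess a b` compares `x`-coordinates, `ccw a b c` is the orientation
test (a test on a name that denotes no point is answered negatively). -/
def Query.Holds (pts : ℕ → Option (ℝ × ℝ)) : Query → Prop
  | .xLess a b => ∃ x y, pts a = some x ∧ pts b = some y ∧ x.1 < y.1
  | .ccw a b c => ∃ x y z, pts a = some x ∧ pts b = some y ∧ pts c = some z ∧ 0 < orient x y z

/-- For each parallel step `t` and processor `i`, whether a primitive evaluated by processor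
`i` in step `t` is answered wrongly. -/
abbrev Noise := ℕ × ℕ → Bool

/-- Evaluations of primitives err independently, each with probability at most `p`. -/
structure IsNoiseLaw (p : ℝ) (μ : Measure Noise) : Prop where
  prob : IsProbabilityMeasure μ
  indep : iIndepFun (fun (k : ℕ × ℕ) (ω : Noise) => ω k) μ
  err_le : ∀ k, μ.real {ω | ω k = true} ≤ p

/-! ### A CREW PRAM with noisy primitives -/

inductive Arith
  | add | sub | mul | div | mod | lt | eq

def Arith.apply : Arith → ℕ → ℕ → ℕ
  | .add, a, b => a + b
  | .sub, a, b => a - b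
  | .mul, a, b => a * b
  | .div, a, b => a / b
  | .mod, a, b => a % b
  | .lt, a, b => if a < b then 1 else 0
  | .eq, a, b => if a = b then 1 else 0

/-- Local computations of a processor. `pid` is the number of the processor; `idx` is used only
to describe the sequence of tests of a noisy operation (see `Prog.noisy`). -/
inductive Expr
  | const (k : ℕ)
  | pid
  | idx
  | load (a : Expr)
  | arith (o : Arith) (a b : Expr)
  | ite (c a b : Expr)

/-- The value of an expression for processor `i`, with words in `{0, …, W - 1}`. -/
def Expr.eval (W : ℕ) (mem : ℕ → ℕ) (i j : ℕ) : Expr → ℕ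
  | .const k => k % W
  | .pid => i
  | .idx => j
  | .load a => mem (a.eval W mem i j)
  | .arith o a b => o.apply (a.eval W mem i j) (b.eval W mem i j) % W
  | .ite c a b => if c.eval W mem i j ≠ 0 then a.eval W mem i j else b.eval W mem i j

/-- A primitive with computed arguments. -/
inductive Test
  | xLess (a b : Expr)
  | ccw (a b c : Expr)

def Test.eval (W : ℕ) (mem : ℕ → ℕ) (i j : ℕ) : Test → Query
  | .xLess a b => .xLess (a.eval W mem i j) (b.eval W mem i j)
  | .ccw a b c => .ccw (a.eval W mem i j) (b.eval W mem i j) (c.eval W mem i j)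

/-- Parallel programs.
* `write procs guard addr val`: one parallel step; every processor `i < procs` whose `guard` is
  nonzero writes `val` to the cell `addr`.
* `call procs guard addr test`: one parallel step; every processor `i < procs` whose `guard` is
  nonzero evaluates the noisy primitive `test` once and writes the answer to the cell `addr`.
* `noisy procs len test body`: every processor `i < procs` opens one noisy operation and `body`
  is then executed. The noisy operation of processor `i` is a search in the sequence
  `test` with `idx = 0, …, len - 1` of primitives, and in `body` the processor may evaluate
  members of this sequence only, any of them any number of times. A noisy binary search is the
  general case, the repetition of one primitive is the case `len = 1`. -/
inductive Prog
  | write (procs guard addr val : Expr)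
  | call (procs guard addr : Expr) (test : Test)
  | seq (P Q : Prog)
  | loop (cond : Expr) (body : Prog)
  | noisy (procs len : Expr) (test : Test) (body : Prog)

/-- The environment of a run: words are in `{0, …, W - 1}`, only the cells in `cells` may be
written, names of points are resolved by `pts`, and `err` says which primitives err. -/
structure Machine where
  W : ℕ
  cells : Set ℕ
  pts : ℕ → Option (ℝ × ℝ)
  err : Noise

/-- The shared memory, and the span (number of parallel steps), the work and the number of noisy
operations so far. In a step every participating processor evaluates a fixed number of
expressions of the program, that is, performs boundedly many operations on words, and
contributes `1` to the work; the common control contributes another `1`. -/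
structure State where
  mem : ℕ → ℕ
  span : ℕ
  work : ℕ
  ops : ℕ

namespace Machine

/-- The value of an expression for processor `i`. -/
def val (M : Machine) (s : State) (e : Expr) (i : ℕ) : ℕ := e.eval M.W s.mem i 0

/-- The processors that act in a step. -/
def Active (M : Machine) (s : State) (procs guard : Expr) (i : ℕ) : Prop :=
  i < M.val s procs 0 ∧ M.val s guard i ≠ 0

open Classical in
/-- The answer to a primitive evaluated by processor `i` in step `t`. -/
noncomputable def answer (M : Machine) (t i : ℕ) (x : Query) : ℕ :=
  if (x.Holds M.pts ∧ M.err (t, i) = false) ∨ (¬ x.Holds M.pts ∧ M.err (t, i) = true)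
  then 1 else 0

/-- Simultaneous exclusive writes: the processors in `act` write to distinct admissible cells
`addr i` the values `v i`, and `mem'` is the memory that results. -/
def Commit (M : Machine) (act : ℕ → Prop) (addr v : ℕ → ℕ) (mem mem' : ℕ → ℕ) : Prop :=
  (∀ i, act i → addr i ∈ M.cells) ∧
  (∀ i k, act i → act k → addr i = addr k → i = k) ∧
  (∀ i, act i → mem' (addr i) = v i) ∧
  ∀ a, (∀ i, act i → addr i ≠ a) → mem' a = mem a

/-- The tests that processor `i` may evaluate in a noisy operation opened in the state `s`. -/
def opened (M : Machine) (s : State) (procs len : Expr) (test : Test) (i : ℕ) : Set Query :=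
  {x | i < M.val s procs 0 ∧ ∃ j < M.val s len i, x = test.eval M.W s.mem i j}

/-- `M.Exec ctx P s s'`: the program `P`, started in the state `s`, halts in the state `s'`,
where processor `i` may evaluate the primitives in `ctx i`. A program that writes to an
inadmissible cell or twice to a cell in one step, that evaluates a primitive outside of the
current noisy operation, or that opens a search in an unsorted sequence has no halting run. -/
inductive Exec (M : Machine) : (ℕ → Set Query) → Prog → State → State → Prop
  | write (ctx : ℕ → Set Query) (procs guard addr v : Expr) (s : State) (mem' : ℕ → ℕ)
      (h : M.Commit (M.Active s procs guard) (M.val s addr) (M.val s v) s.mem mem') :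
      Exec M ctx (.write procs guard addr v) s
        ⟨mem', s.span + 1, s.work + M.val s procs 0 + 1, s.ops⟩
  | call (ctx : ℕ → Set Query) (procs guard addr : Expr) (test : Test) (s : State)
      (mem' : ℕ → ℕ)
      (hctx : ∀ i, M.Active s procs guard i → test.eval M.W s.mem i 0 ∈ ctx i)
      (h : M.Commit (M.Active s procs guard) (M.val s addr)
        (fun i => M.answer s.span i (test.eval M.W s.mem i 0)) s.mem mem') :
      Exec M ctx (.call procs guard addr test) s
        ⟨mem', s.span + 1, s.work + M.val s procs 0 + 1, s.ops⟩
  | seq (ctx : ℕ → Set Query) (P Q : Prog) (s s' s'' : State)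
      (hP : Exec M ctx P s s') (hQ : Exec M ctx Q s' s'') :
      Exec M ctx (.seq P Q) s s''
  | loop_done (ctx : ℕ → Set Query) (cond : Expr) (body : Prog) (s : State)
      (h : M.val s cond 0 = 0) :
      Exec M ctx (.loop cond body) s ⟨s.mem, s.span + 1, s.work + 1, s.ops⟩
  | loop_step (ctx : ℕ → Set Query) (cond : Expr) (body : Prog) (s s' s'' : State)
      (h : M.val s cond 0 ≠ 0)
      (hbody : Exec M ctx body ⟨s.mem, s.span + 1, s.work + 1, s.ops⟩ s')
      (hloop : Exec M ctx (.loop cond body) s' s'') :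
      Exec M ctx (.loop cond body) s s''
  | noisy (ctx : ℕ → Set Query) (procs len : Expr) (test : Test) (body : Prog) (s s' : State)
      (hsorted : ∀ i < M.val s procs 0, ∀ j j', j ≤ j' → j' < M.val s len i →
        (test.eval M.W s.mem i j').Holds M.pts → (test.eval M.W s.mem i j).Holds M.pts)
      (hbody : Exec M (M.opened s procs len test) body
        ⟨s.mem, s.span + 1, s.work + M.val s procs 0 + 1, s.ops + M.val s procs 0⟩ s') :
      Exec M ctx (.noisy procs len test body) s s'

/-- A complete run from the memory `mem`. No primitive may be evaluated outside of a noisy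
operation. -/
def Run (M : Machine) (P : Prog) (mem : ℕ → ℕ) (s' : State) : Prop :=
  M.Exec (fun _ => ∅) P ⟨mem, 0, 0, 0⟩ s'

end Machine

/-- The number of distinct words of `κ (⌊log₂ n⌋ + 1)` bits. -/
def wordCount (κ n : ℕ) : ℕ := 2 ^ (κ * (Nat.log 2 n + 1))

namespace PlanarSubdivision

/-- The memory `D` is a point-location structure for `S` under the program `query`: for every
query point and all independent noise of rate at most `p`, with probability at least
`1 - n⁻ᶜ` the query reports (in cell `0`) a face containing the query point, after at most
`K log n` work, with at most two noisy operations (noisy binary searches). A query writes only to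
the `k` scratch cells `0, …, k - 1`, on whose contents it does not rely, so that `D` can be queried
again and again. -/
def Supports (S : PlanarSubdivision) (p : ℝ) (c κ k K n : ℕ) (query : Prog) (D : ℕ → ℕ) : Prop :=
  ∀ (q : ℝ × ℝ) (mem : ℕ → ℕ), (∀ a, k ≤ a → mem a = D a) →
    ∀ μ : Measure Noise, IsNoiseLaw p μ →
      μ {err | ¬ ∃ s' : State,
        (Machine.mk (wordCount κ n) {a | a < k} (S.sitesWith q) err).Run query mem s' ∧
        (s'.work : ℝ) ≤ K * Real.log n ∧
        s'.ops ≤ 2 ∧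
        S.Locates q (s'.mem 0)} ≤ ((n : ℝ≥0∞) ^ c)⁻¹

end PlanarSubdivision

/-! ### Evaluation of expressions without overflow -/

/-! The geometry is the slab method. Vertical lines through the vertices cut the plane into slabs.
Inside a slab the edges that cross it are linearly ordered by height, and the regions between
consecutive edges are trapezoids, each contained in one face. A point is therefore located by two
ranks: its rank among the abscissas of the vertices selects a slab, and its rank among the edges of
that slab selects a trapezoid. The answer is the face above the last edge below the point, or the
unbounded face if there is no such edge (`SortedRow.exists_vertex`, `SortedRow.exists_edge`,
`locates_upper`, `locates_outer`). With `m = r + 20`, the structure is a square array of side `m`: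
the row of a vertex lists the edges crossing the slab to its left, and row `m - 1` lists the
vertices. One orientation test, independent of the slab, orders two edges that cross a common slab
(`below_iff`), so quadratically many primitive tests determine all rows.

In the construction every such test has its own processor, which repeats it a logarithmic number of
times and takes the majority. A Chernoff bound (`exists_rate`) and a union bound make all these
votes correct with high probability, and what remains is deterministic. All rows are merge sorted
simultaneously by `m ^ 3` processors, in logarithmically many rounds of constant span: the rank of
an item in the block with which its own block is merged is visible to exactly one processor, the one
at the last predecessor of the item, so the writes are exclusive.

In a query, a vote of logarithmic size at each step of a binary search would be too slow. Instead
the search is a walk with backtracking in the binary tree of dyadic intervals of `[0, 2 ^ N)`. Votes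
of constant size `R` decide whether the target lies in the current interval, and the walk moves to a
child or to the parent. A correct step brings it closer to the target by at least one, a misled step
takes it away by at most one (`WalkInv`). The sequence is padded so that half of the depth of the
tree already determines the answer, hence `N / 4` misled steps among `N` are harmless
(`WalkInv.result`), and more bad votes than that have probability at most `2 ^ (-N)`
(`measure_badCount_le`).

Noise bits are indexed by time and processor. The program logic built on `Reaches` therefore records
the exact span: the bits used by each vote are then known in advance, whatever the data are, and the
good events speak about the noise alone. Words are long enough for all programs to compute as if
over `ℕ` (`Expr.eval_eq_ideal`). -/

instance (k : ℕ) : OfNat Expr k := ⟨.const k⟩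
instance : Add Expr := ⟨.arith .add⟩
instance : Sub Expr := ⟨.arith .sub⟩
instance : Mul Expr := ⟨.arith .mul⟩
instance : Div Expr := ⟨.arith .div⟩
instance : Mod Expr := ⟨.arith .mod⟩

namespace Expr

/-- The expression that compares two values, with value `1` or `0`. -/
def less (a b : Expr) : Expr := .arith .lt a b

/-- The expression that tests two values for equality, with value `1` or `0`. -/
def same (a b : Expr) : Expr := .arith .eq a b

/-- The value of an expression over unbounded words. -/
def ideal (mem : ℕ → ℕ) (i j : ℕ) : Expr → ℕ
  | .const k => k
  | .pid => i
  | .idx => j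
  | .load a => mem (a.ideal mem i j)
  | .arith o a b => o.apply (a.ideal mem i j) (b.ideal mem i j)
  | .ite c a b => if c.ideal mem i j ≠ 0 then a.ideal mem i j else b.ideal mem i j

/-- An exponent `z` such that the expression has a value of at most `V ^ z` if all words that it
reads are at most `V`. -/
def width : Expr → ℕ
  | .const k => k
  | .pid => 1
  | .idx => 1
  | .load a => a.width + 1
  | .arith _ a b => a.width + b.width + 1
  | .ite c a b => c.width + a.width + b.width

section
variable (mem : ℕ → ℕ) (i j : ℕ) (a b c : Expr)

@[simp] theorem ideal_const (k : ℕ) : (Expr.const k).ideal mem i j = k := rfl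
@[simp] theorem ideal_ofNat (k : ℕ) :
    (no_index (OfNat.ofNat k : Expr)).ideal mem i j = OfNat.ofNat k := rfl
@[simp] theorem ideal_pid : Expr.pid.ideal mem i j = i := rfl
@[simp] theorem ideal_idx : Expr.idx.ideal mem i j = j := rfl
@[simp] theorem ideal_load : (Expr.load a).ideal mem i j = mem (a.ideal mem i j) := rfl
@[simp] theorem ideal_add : (a + b).ideal mem i j = a.ideal mem i j + b.ideal mem i j := rfl
@[simp] theorem ideal_sub : (a - b).ideal mem i j = a.ideal mem i j - b.ideal mem i j := rfl
@[simp] theorem ideal_mul : (a * b).ideal mem i j = a.ideal mem i j * b.ideal mem i j := rfl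
@[simp] theorem ideal_div : (a / b).ideal mem i j = a.ideal mem i j / b.ideal mem i j := rfl
@[simp] theorem ideal_mod : (a % b).ideal mem i j = a.ideal mem i j % b.ideal mem i j := rfl
@[simp] theorem ideal_less : (less a b).ideal mem i j =
    if a.ideal mem i j < b.ideal mem i j then 1 else 0 := rfl
@[simp] theorem ideal_same : (same a b).ideal mem i j =
    if a.ideal mem i j = b.ideal mem i j then 1 else 0 := rfl
@[simp] theorem ideal_ite : (Expr.ite c a b).ideal mem i j =
    if c.ideal mem i j ≠ 0 then a.ideal mem i j else b.ideal mem i j := rfl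

@[simp] theorem width_const (k : ℕ) : (Expr.const k).width = k := rfl
@[simp] theorem width_ofNat (k : ℕ) : (no_index (OfNat.ofNat k : Expr)).width = OfNat.ofNat k := rfl
@[simp] theorem width_pid : Expr.pid.width = 1 := rfl
@[simp] theorem width_idx : Expr.idx.width = 1 := rfl
@[simp] theorem width_load : (Expr.load a).width = a.width + 1 := rfl
@[simp] theorem width_add : (a + b).width = a.width + b.width + 1 := rfl
@[simp] theorem width_sub : (a - b).width = a.width + b.width + 1 := rfl
@[simp] theorem width_mul : (a * b).width = a.width + b.width + 1 := rfl
@[simp] theorem width_div : (a / b).width = a.width + b.width + 1 := rfl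
@[simp] theorem width_mod : (a % b).width = a.width + b.width + 1 := rfl
@[simp] theorem width_less : (less a b).width = a.width + b.width + 1 := rfl
@[simp] theorem width_same : (same a b).width = a.width + b.width + 1 := rfl
@[simp] theorem width_ite : (Expr.ite c a b).width = c.width + a.width + b.width := rfl
end

/-- Exponents add under every operation. The additional `1` absorbs the factor `2` of a sum, because
`2 ≤ V`; a constant `k` is below `2 ^ k ≤ V ^ k`. -/
theorem ideal_le {V : ℕ} (hV : 2 ≤ V) {mem : ℕ → ℕ} (hmem : ∀ a, mem a ≤ V) {i j : ℕ}
    (hi : i ≤ V) (hj : j ≤ V) (e : Expr) : e.ideal mem i j ≤ V ^ e.width := by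
  have hpos : ∀ z, 1 ≤ V ^ z := fun z => Nat.one_le_pow _ _ (by omega)
  have hmono : ∀ {y z}, y ≤ z → V ^ y ≤ V ^ z := fun h => Nat.pow_le_pow_right (by omega) h
  induction e with
  | const k =>
    exact (Nat.lt_two_pow_self (n := k)).le.trans (Nat.pow_le_pow_left hV k)
  | pid => simpa using hi
  | idx => simpa using hj
  | load a =>
    exact (hmem _).trans (by simpa using hmono (show 1 ≤ a.width + 1 by omega))
  | arith o a b iha ihb =>
    have h1 : V ^ a.width ≤ V ^ (a.width + b.width + 1) := hmono (by omega)
    cases o with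
    | add =>
      show a.ideal mem i j + b.ideal mem i j ≤ V ^ (a.width + b.width + 1)
      have h2 : V ^ a.width ≤ V ^ (a.width + b.width) := hmono (by omega)
      have h3 : V ^ b.width ≤ V ^ (a.width + b.width) := hmono (by omega)
      calc _ ≤ V ^ (a.width + b.width) * 2 := by omega
        _ ≤ _ := by rw [pow_succ]; gcongr
    | sub => exact (Nat.sub_le _ _).trans (iha.trans h1)
    | mul =>
      calc a.ideal mem i j * b.ideal mem i j ≤ V ^ a.width * V ^ b.width :=
            Nat.mul_le_mul iha ihb
        _ = V ^ (a.width + b.width) := (pow_add _ _ _).symm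
        _ ≤ V ^ (a.width + b.width + 1) := hmono (by omega)
    | div => exact (Nat.div_le_self _ _).trans (iha.trans h1)
    | mod => exact (Nat.mod_le _ _).trans (iha.trans h1)
    | lt =>
      refine le_trans ?_ (hpos _)
      show (if _ then 1 else 0) ≤ 1
      split_ifs <;> simp
    | eq =>
      refine le_trans ?_ (hpos _)
      show (if _ then 1 else 0) ≤ 1
      split_ifs <;> simp
  | ite c a b ihc iha ihb =>
    rw [ideal_ite, width_ite]
    split_ifs
    · exact iha.trans (hmono (by omega))
    · exact ihb.trans (hmono (by omega))

/-- Subexpressions have no larger width, so every intermediate value is below `W` and no reduction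
modulo `W` has an effect. -/
theorem eval_eq_ideal {V W : ℕ} (hV : 2 ≤ V) {mem : ℕ → ℕ} (hmem : ∀ a, mem a ≤ V) {i j : ℕ}
    (hi : i ≤ V) (hj : j ≤ V) (e : Expr) (hW : V ^ e.width < W) :
    e.eval W mem i j = e.ideal mem i j := by
  have hmono : ∀ {y z}, y ≤ z → V ^ z < W → V ^ y < W :=
    fun h => (Nat.pow_le_pow_right (by omega) h).trans_lt
  have key := ideal_le hV hmem hi hj
  induction e with
  | const k => exact Nat.mod_eq_of_lt ((key (.const k)).trans_lt hW)
  | pid => rfl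
  | idx => rfl
  | load a iha => simp only [eval, ideal]; rw [iha (hmono (by simp) hW)]
  | arith o a b iha ihb =>
    have h := key (.arith o a b)
    rw [width] at hW
    simp only [eval, ideal] at h ⊢
    rw [iha (hmono (by omega) hW), ihb (hmono (by omega) hW)]
    exact Nat.mod_eq_of_lt (h.trans_lt hW)
  | ite c a b ihc iha ihb =>
    rw [width] at hW
    simp only [eval, ideal]
    rw [ihc (hmono (by omega) hW), iha (hmono (by omega) hW), ihb (hmono (by omega) hW)]

end Expr

namespace Test

/-- The primitive denoted by a test over unbounded words. -/
def ideal (mem : ℕ → ℕ) (i j : ℕ) : Test → Query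
  | .xLess a b => .xLess (a.ideal mem i j) (b.ideal mem i j)
  | .ccw a b c => .ccw (a.ideal mem i j) (b.ideal mem i j) (c.ideal mem i j)

def width : Test → ℕ
  | .xLess a b => a.width + b.width
  | .ccw a b c => a.width + b.width + c.width

theorem eval_eq_ideal {V W : ℕ} (hV : 2 ≤ V) {mem : ℕ → ℕ} (hmem : ∀ a, mem a ≤ V) {i j : ℕ}
    (hi : i ≤ V) (hj : j ≤ V) (e : Test) (hW : V ^ e.width < W) :
    e.eval W mem i j = e.ideal mem i j := by
  have hmono : ∀ {y z}, y ≤ z → V ^ z < W → V ^ y < W :=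
    fun h => (Nat.pow_le_pow_right (by omega) h).trans_lt
  cases e with
  | xLess a b =>
    rw [width] at hW
    simp only [eval, ideal]
    rw [Expr.eval_eq_ideal hV hmem hi hj a (hmono (by omega) hW),
      Expr.eval_eq_ideal hV hmem hi hj b (hmono (by omega) hW)]
  | ccw a b c =>
    rw [width] at hW
    simp only [eval, ideal]
    rw [Expr.eval_eq_ideal hV hmem hi hj a (hmono (by omega) hW),
      Expr.eval_eq_ideal hV hmem hi hj b (hmono (by omega) hW),
      Expr.eval_eq_ideal hV hmem hi hj c (hmono (by omega) hW)]

end Test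

/-! ### Total correctness with exact span -/

/-- All words of the memory are at most `V`. -/
def Bdd (V : ℕ) (mem : ℕ → ℕ) : Prop := ∀ a, mem a ≤ V

theorem Bdd.update {V : ℕ} {mem : ℕ → ℕ} (h : Bdd V mem) (a : ℕ) {v : ℕ} (hv : v ≤ V) :
    Bdd V (Function.update mem a v) := by
  intro b
  by_cases hb : b = a
  · subst hb; simpa using hv
  · simpa [hb] using h b

/-- Expressions of width at most `z` over words of at most `V` do not overflow. -/
structure Machine.Roomy (M : Machine) (V z : ℕ) : Prop where
  two_le : 2 ≤ V
  lt : V ^ z < M.W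

namespace Machine

variable {M : Machine} {V z B : ℕ}

theorem Roomy.val_eq (h : M.Roomy V z) {s : State} (hs : Bdd V s.mem) {e : Expr}
    (he : e.width ≤ z) {i : ℕ} (hi : i ≤ V) : M.val s e i = e.ideal s.mem i 0 :=
  Expr.eval_eq_ideal h.two_le hs hi (Nat.zero_le _) e
    ((Nat.pow_le_pow_right (by have := h.two_le; omega) he).trans_lt h.lt)

theorem Roomy.test_eq (h : M.Roomy V z) {mem : ℕ → ℕ} (hs : Bdd V mem) {e : Test}
    (he : e.width ≤ z) {i j : ℕ} (hi : i ≤ V) (hj : j ≤ V) :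
    e.eval M.W mem i j = e.ideal mem i j :=
  Test.eval_eq_ideal h.two_le hs hi hj e
    ((Nat.pow_le_pow_right (by have := h.two_le; omega) he).trans_lt h.lt)

/-- `P` started in `s` halts after exactly `k` steps of at most `B` processors and at most `o`
noisy operations, and leaves a memory that satisfies `Q`. -/
def Reaches (M : Machine) (B : ℕ) (ctx : ℕ → Set Query) (P : Prog) (s : State) (k o : ℕ)
    (Q : (ℕ → ℕ) → Prop) : Prop :=
  ∃ s', M.Exec ctx P s s' ∧ s'.span = s.span + k ∧ s'.work ≤ s.work + k * (B + 1) ∧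
    s'.ops ≤ s.ops + o ∧ Q s'.mem

theorem Reaches.mono {ctx : ℕ → Set Query} {P : Prog} {s : State} {k o : ℕ}
    {Q Q' : (ℕ → ℕ) → Prop} (h : M.Reaches B ctx P s k o Q) (hQ : ∀ mem, Q mem → Q' mem) :
    M.Reaches B ctx P s k o Q' := by
  obtain ⟨s', h1, h2, h3, h4, h5⟩ := h
  exact ⟨s', h1, h2, h3, h4, hQ _ h5⟩

theorem Reaches.seq {ctx : ℕ → Set Query} {P P' : Prog} {s : State} {k k' o o' : ℕ}
    {Q R : (ℕ → ℕ) → Prop} (h : M.Reaches B ctx P s k o Q)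
    (h' : ∀ s', s'.span = s.span + k → Q s'.mem → M.Reaches B ctx P' s' k' o' R) :
    M.Reaches B ctx (.seq P P') s (k + k') (o + o') R := by
  obtain ⟨s', h1, h2, h3, h4, h5⟩ := h
  obtain ⟨s'', g1, g2, g3, g4, g5⟩ := h' s' h2 h5
  refine ⟨s'', .seq _ _ _ _ _ _ h1 g1, by omega, ?_, by omega, g5⟩
  rw [add_mul]; omega

/-- Each written cell takes the value of some chosen writer; exclusiveness makes the choice
immaterial. -/
theorem exists_commit (M : Machine) {act : ℕ → Prop} {addr : ℕ → ℕ} (v mem : ℕ → ℕ)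
    (hc : ∀ i, act i → addr i ∈ M.cells)
    (hinj : ∀ i k, act i → act k → addr i = addr k → i = k) :
    ∃ mem', M.Commit act addr v mem mem' := by
  classical
  refine ⟨fun a => if h : ∃ i, act i ∧ addr i = a then v h.choose else mem a,
    hc, hinj, ?_, ?_⟩
  · intro i hi
    have h : ∃ k, act k ∧ addr k = addr i := ⟨i, hi, rfl⟩
    dsimp only
    rw [dif_pos h, hinj _ _ h.choose_spec.1 hi h.choose_spec.2]
  · intro a ha
    dsimp only
    rw [dif_neg]
    rintro ⟨i, hi, rfl⟩
    exact ha i hi rfl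

theorem Commit.bdd {act : ℕ → Prop} {addr v mem mem' : ℕ → ℕ}
    (h : M.Commit act addr v mem mem') (hm : Bdd V mem) (hv : ∀ i, act i → v i ≤ V) :
    Bdd V mem' := by
  intro a
  by_cases ha : ∃ i, act i ∧ addr i = a
  · obtain ⟨i, hi, rfl⟩ := ha
    rw [h.2.2.1 i hi]; exact hv i hi
  · push Not at ha
    rw [h.2.2.2 a ha]; exact hm a

/-- The rule for a parallel write. -/
theorem Roomy.write (hM : M.Roomy V z) (hB : B ≤ V) {ctx : ℕ → Set Query}
    {procs guard addr v : Expr} {s : State} (hs : Bdd V s.mem)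
    (hw : procs.width ≤ z ∧ guard.width ≤ z ∧ addr.width ≤ z ∧ v.width ≤ z) {n : ℕ}
    (hn : procs.ideal s.mem 0 0 = n) (hnB : n ≤ B) {Q : (ℕ → ℕ) → Prop}
    (hcells : ∀ i < n, guard.ideal s.mem i 0 ≠ 0 → addr.ideal s.mem i 0 ∈ M.cells)
    (hinj : ∀ i < n, ∀ k < n, guard.ideal s.mem i 0 ≠ 0 → guard.ideal s.mem k 0 ≠ 0 →
      addr.ideal s.mem i 0 = addr.ideal s.mem k 0 → i = k)
    (hval : ∀ i < n, guard.ideal s.mem i 0 ≠ 0 → v.ideal s.mem i 0 ≤ V)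
    (hQ : ∀ mem', Bdd V mem' →
      (∀ i < n, guard.ideal s.mem i 0 ≠ 0 → mem' (addr.ideal s.mem i 0) = v.ideal s.mem i 0) →
      (∀ a, (∀ i < n, guard.ideal s.mem i 0 ≠ 0 → addr.ideal s.mem i 0 ≠ a) →
        mem' a = s.mem a) → Q mem') :
    M.Reaches B ctx (.write procs guard addr v) s 1 0 Q := by
  have hp : M.val s procs 0 = n := by rw [hM.val_eq hs hw.1 (Nat.zero_le _), hn]
  have hact : ∀ i, M.Active s procs guard i ↔ i < n ∧ guard.ideal s.mem i 0 ≠ 0 := by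
    intro i
    simp only [Active, hp]
    refine and_congr_right fun hi => ?_
    rw [hM.val_eq hs hw.2.1 (by omega)]
  have hva : ∀ i < n, M.val s addr i = addr.ideal s.mem i 0 :=
    fun i hi => hM.val_eq hs hw.2.2.1 (by omega)
  have hvv : ∀ i < n, M.val s v i = v.ideal s.mem i 0 :=
    fun i hi => hM.val_eq hs hw.2.2.2 (by omega)
  obtain ⟨mem', hmem'⟩ := M.exists_commit (act := M.Active s procs guard) (addr := M.val s addr)
    (M.val s v) s.mem
    (fun i hi => by
      rw [hact] at hi; rw [hva i hi.1]; exact hcells i hi.1 hi.2)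
    (fun i k hi hk h => by
      rw [hact] at hi hk; rw [hva i hi.1, hva k hk.1] at h
      exact hinj i hi.1 k hk.1 hi.2 hk.2 h)
  refine ⟨_, .write ctx procs guard addr v s mem' hmem', rfl, ?_, by simp, hQ mem' ?_ ?_ ?_⟩
  · simp only [hp]; omega
  · refine hmem'.bdd hs fun i hi => ?_
    rw [hact] at hi; rw [hvv i hi.1]; exact hval i hi.1 hi.2
  · intro i hi hg
    have := hmem'.2.2.1 i ((hact i).2 ⟨hi, hg⟩)
    rwa [hva i hi, hvv i hi] at this
  · intro a ha
    refine hmem'.2.2.2 a fun i hi => ?_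
    rw [hact] at hi; rw [hva i hi.1]; exact ha i hi.1 hi.2

/-- The rule for a parallel evaluation of primitives. -/
theorem Roomy.call (hM : M.Roomy V z) (hB : B ≤ V) {ctx : ℕ → Set Query}
    {procs addr : Expr} {test : Test} {s : State} (hs : Bdd V s.mem)
    (hw : procs.width ≤ z ∧ 1 ≤ z ∧ addr.width ≤ z ∧ test.width ≤ z) {n : ℕ}
    (hn : procs.ideal s.mem 0 0 = n) (hnB : n ≤ B) {Q : (ℕ → ℕ) → Prop}
    (hctx : ∀ i < n, test.ideal s.mem i 0 ∈ ctx i)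
    (hcells : ∀ i < n, addr.ideal s.mem i 0 ∈ M.cells)
    (hinj : ∀ i < n, ∀ k < n, addr.ideal s.mem i 0 = addr.ideal s.mem k 0 → i = k)
    (hQ : ∀ mem', Bdd V mem' →
      (∀ i < n, mem' (addr.ideal s.mem i 0) = M.answer s.span i (test.ideal s.mem i 0)) →
      (∀ a, (∀ i < n, addr.ideal s.mem i 0 ≠ a) → mem' a = s.mem a) → Q mem') :
    M.Reaches B ctx (.call procs 1 addr test) s 1 0 Q := by
  have hp : M.val s procs 0 = n := by rw [hM.val_eq hs hw.1 (Nat.zero_le _), hn]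
  have hact : ∀ i, M.Active s procs 1 i ↔ i < n := by
    intro i
    simp only [Active, hp]
    refine and_iff_left_of_imp fun hi => ?_
    rw [hM.val_eq hs (by simpa using hw.2.1) (by omega)]; simp
  have hva : ∀ i < n, M.val s addr i = addr.ideal s.mem i 0 :=
    fun i hi => hM.val_eq hs hw.2.2.1 (by omega)
  have hvv : ∀ i < n, test.eval M.W s.mem i 0 = test.ideal s.mem i 0 :=
    fun i hi => hM.test_eq hs hw.2.2.2 (by omega) (Nat.zero_le _)
  obtain ⟨mem', hmem'⟩ := M.exists_commit (act := M.Active s procs 1) (addr := M.val s addr)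
    (fun i => M.answer s.span i (test.eval M.W s.mem i 0)) s.mem
    (fun i hi => by
      rw [hact] at hi; rw [hva i hi]; exact hcells i hi)
    (fun i k hi hk h => by
      rw [hact] at hi hk; rw [hva i hi, hva k hk] at h
      exact hinj i hi k hk h)
  refine ⟨_, .call ctx procs 1 addr test s mem' ?_ hmem', rfl, ?_, by simp, hQ mem' ?_ ?_ ?_⟩
  · intro i hi
    rw [hact] at hi; rw [hvv i hi]; exact hctx i hi
  · simp only [hp]; omega
  · refine hmem'.bdd hs fun i hi => ?_
    have := hM.two_le
    unfold answer
    split_ifs <;> omega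
  · intro i hi
    have := hmem'.2.2.1 i ((hact i).2 hi)
    dsimp only at this
    rwa [hva i hi, hvv i hi] at this
  · intro a ha
    refine hmem'.2.2.2 a fun i hi => ?_
    rw [hact] at hi; rw [hva i hi]; exact ha i hi

/-- The rule for opening noisy operations. -/
theorem Roomy.noisy (hM : M.Roomy V z) (hB : B ≤ V) {ctx : ℕ → Set Query}
    {procs len : Expr} {test : Test} {body : Prog} {s : State} (hs : Bdd V s.mem)
    (hw : procs.width ≤ z ∧ len.width ≤ z ∧ test.width ≤ z) {n l k : ℕ}
    (hn : procs.ideal s.mem 0 0 = n) (hnB : n ≤ B)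
    (hl : ∀ i < n, len.ideal s.mem i 0 = l) (hlV : l ≤ V) {Q : (ℕ → ℕ) → Prop}
    (hsorted : ∀ i < n, ∀ j j', j ≤ j' → j' < l →
      (test.ideal s.mem i j').Holds M.pts → (test.ideal s.mem i j).Holds M.pts)
    (hbody : ∀ s' ctx', s'.mem = s.mem → s'.span = s.span + 1 →
      (∀ i < n, ∀ j < l, test.ideal s.mem i j ∈ ctx' i) → M.Reaches B ctx' body s' k 0 Q) :
    M.Reaches B ctx (.noisy procs len test body) s (1 + k) n Q := by
  have hp : M.val s procs 0 = n := by rw [hM.val_eq hs hw.1 (Nat.zero_le _), hn]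
  have hlen : ∀ i < n, M.val s len i = l := fun i hi => by
    rw [hM.val_eq hs hw.2.1 (by omega), hl i hi]
  have ht : ∀ i < n, ∀ j < l, test.eval M.W s.mem i j = test.ideal s.mem i j :=
    fun i hi j hj => hM.test_eq hs hw.2.2 (by omega) (by omega)
  obtain ⟨s', h1, h2, h3, h4, h5⟩ := hbody
    ⟨s.mem, s.span + 1, s.work + M.val s procs 0 + 1, s.ops + M.val s procs 0⟩
    (M.opened s procs len test) rfl rfl
    (fun i hi j hj => ⟨by rw [hp]; exact hi, j, by rw [hlen i hi]; exact hj, (ht i hi j hj).symm⟩)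
  refine ⟨s', .noisy ctx procs len test body s s' ?_ h1, ?_, ?_, ?_, h5⟩
  · intro i hi j j' hj hj' h
    rw [hp] at hi; rw [hlen i hi] at hj'
    rw [ht i hi j' hj'] at h
    rw [ht i hi j (by omega)]
    exact hsorted i hi j j' hj hj' h
  · simp only at h2; omega
  · simp only [hp] at h3
    rw [add_mul]; omega
  · simp only [hp] at h4; omega

end Machine

/-- Assignment to the cell `a`. -/
def Prog.set (a : ℕ) (e : Expr) : Prog := .write 1 1 (.const a) e

theorem Machine.Roomy.set {M : Machine} {V z B : ℕ} (hM : M.Roomy V z) (hB : B ≤ V)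
    (hB1 : 1 ≤ B) {ctx : ℕ → Set Query} {a : ℕ} {e : Expr} {s : State} (hs : Bdd V s.mem)
    (hw : a ≤ z ∧ 1 ≤ z ∧ e.width ≤ z) (ha : a ∈ M.cells) (hv : e.ideal s.mem 0 0 ≤ V)
    {Q : (ℕ → ℕ) → Prop}
    (hQ : Bdd V (Function.update s.mem a (e.ideal s.mem 0 0)) →
      Q (Function.update s.mem a (e.ideal s.mem 0 0))) :
    M.Reaches B ctx (Prog.set a e) s 1 0 Q := by
  refine hM.write hB hs (n := 1) (by simpa using ⟨hw.2.1, hw.1, hw.2.2⟩) (by simp) hB1 ?_ ?_ ?_ ?_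
  · intro i _ _; simpa using ha
  · intro i hi k hk _ _ _; omega
  · intro i hi _
    obtain rfl : i = 0 := by omega
    exact hv
  · intro mem' hb h1 h2
    have : mem' = Function.update s.mem a (e.ideal s.mem 0 0) := by
      funext b
      by_cases hba : b = a
      · subst hba; simpa using h1 0 (by omega) (by simp)
      · rw [Function.update_of_ne hba]
        exact h2 b fun i _ _ => by simpa using Ne.symm hba
    rw [this] at hb ⊢
    exact hQ hb

/-! ### Loops of logarithmic length -/

/-- The `C`-th power of the word in cell `20`. -/
def powExpr : ℕ → Expr
  | 0 => 1
  | C + 1 => .load 20 * powExpr C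

theorem powExpr_ideal (mem : ℕ → ℕ) (i j C : ℕ) : (powExpr C).ideal mem i j = mem 20 ^ C := by
  induction C with
  | zero => simp [powExpr]
  | succ C ih => simp [powExpr, ih, pow_succ, mul_comm]

theorem powExpr_width (C : ℕ) : (powExpr C).width = 22 * C + 1 := by
  induction C with
  | zero => simp [powExpr]
  | succ C ih => simp [powExpr, ih]; ring

/-- Repeat `body` as often as the `C`-th power of cell `20` has binary digits. -/
def forLog (C : ℕ) (body : Prog) : Prog :=
  .seq (.set 1 (powExpr C)) (.loop (.load 1) (.seq body (.set 1 (.load 1 / 2))))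

/-- Halving `n ^ C` reaches zero after as many rounds as it has binary digits, so the loop has
logarithmic length without a logarithm being computed. The invariant has to survive changes of the
counter in cell `1`. The body is told the exact time at which its round starts, since votes in it
are tied to fixed noise bits. Control costs two steps per round (test and halving) and two more
outside (initialisation and final test). -/
theorem Machine.Roomy.forLog {M : Machine} {V z B : ℕ} (hM : M.Roomy V z) (hB : B ≤ V)
    (hB1 : 1 ≤ B) {ctx : ℕ → Set Query} {C n k : ℕ} {body : Prog} {s : State}
    (hz : 22 * C + 6 ≤ z) (hn : s.mem 20 = n) (hnV : n ^ C ≤ V) (h1 : 1 ∈ M.cells)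
    (I : ℕ → (ℕ → ℕ) → Prop)
    (hIB : ∀ i mem, I i mem → Bdd V mem)
    (hI : ∀ i mem v, v ≤ V → I i mem → I i (Function.update mem 1 v))
    (hbody : ∀ i < (n ^ C).size, ∀ s', s'.span = s.span + 2 + i * (k + 2) → I i s'.mem →
      M.Reaches B ctx body s' k 0 (fun m => I (i + 1) m ∧ m 1 = s'.mem 1))
    (h0 : I 0 s.mem) :
    M.Reaches B ctx (forLog C body) s ((n ^ C).size * (k + 2) + 2) 0 (I (n ^ C).size) := by
  set N := (n ^ C).size with hN
  have key : ∀ d i, i + d = N → ∀ s', s'.span = s.span + 1 + i * (k + 2) → I i s'.mem →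
      s'.mem 1 = n ^ C / 2 ^ i →
      M.Reaches B ctx (.loop (.load 1) (.seq body (.set 1 (.load 1 / 2)))) s'
        (d * (k + 2) + 1) 0 (I N) := by
    intro d
    induction d with
    | zero =>
      intro i hi s' _ hIi hy
      obtain rfl : i = N := by omega
      have hy0 : s'.mem 1 = 0 := by
        rw [hy]; exact Nat.div_eq_of_lt (Nat.lt_size_self _)
      refine ⟨_, .loop_done ctx _ _ s' ?_, by simp, by simp, by simp, hIi⟩
      rw [hM.val_eq (hIB _ _ hIi) (by simp; omega) (Nat.zero_le _)]
      simpa using hy0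
    | succ d ih =>
      intro i hi s' hspan hIi hy
      have hiN : i < N := by omega
      have hy0 : s'.mem 1 ≠ 0 := by
        rw [hy]
        have := Nat.lt_size.1 hiN
        exact (Nat.div_pos this (by positivity)).ne'
      have hstep : M.Reaches B ctx (.seq body (.set 1 (.load 1 / 2)))
          ⟨s'.mem, s'.span + 1, s'.work + 1, s'.ops⟩ (k + 1) 0
          (fun m => I (i + 1) m ∧ m 1 = n ^ C / 2 ^ (i + 1)) := by
        refine (hbody i hiN ⟨s'.mem, s'.span + 1, s'.work + 1, s'.ops⟩ (by simp; omega)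
          hIi).seq (o' := 0) fun s'' _ h => ?_
        have hb := hIB _ _ h.1
        refine hM.set hB hB1 hb (by simp; omega) h1 ?_ fun hb' => ?_
        · exact (Nat.div_le_self _ _).trans (hb _)
        · refine ⟨hI _ _ _ ?_ h.1, ?_⟩
          · exact (Nat.div_le_self _ _).trans (hb _)
          · simp only [Function.update_self, Expr.ideal_div, Expr.ideal_load, Expr.ideal_ofNat]
            rw [h.2, hy, pow_succ, Nat.div_div_eq_div_mul]
      obtain ⟨s1, e1, e2, e3, e4, e5⟩ := hstep
      simp only at e2 e3 e4
      obtain ⟨s2, f1, f2, f3, f4, f5⟩ := ih (i + 1) (by omega) s1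
        (by rw [e2, hspan, add_mul]; ring) e5.1 e5.2
      refine ⟨s2, .loop_step ctx _ _ s' s1 s2 ?_ e1 f1, ?_, ?_, by omega, f5⟩
      · rw [hM.val_eq (hIB _ _ hIi) (by simp; omega) (Nat.zero_le _)]
        simpa using hy0
      · rw [f2, e2, add_mul]; ring
      · calc s2.work ≤ s'.work + 1 + (k + 1) * (B + 1) + (d * (k + 2) + 1) * (B + 1) := by omega
          _ ≤ _ := by nlinarith
  have hset : M.Reaches B ctx (.set 1 (powExpr C)) s 1 0
      (fun m => I 0 m ∧ m 1 = n ^ C) := by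
    refine hM.set hB hB1 (hIB _ _ h0) ⟨by omega, by omega, by rw [powExpr_width]; omega⟩ h1 ?_
      fun _ => ?_
    · rw [powExpr_ideal, hn]; exact hnV
    · rw [powExpr_ideal, hn]
      exact ⟨hI _ _ _ hnV h0, by simp⟩
  have := hset.seq (P' := .loop (.load 1) (.seq body (.set 1 (.load 1 / 2))))
    (k' := N * (k + 2) + 1) (o' := 0) (R := I N) fun s' hs' h =>
      key N 0 (by omega) s' (by omega) h.1 (by simpa using h.2)
  have e : N * (k + 2) + 2 = 1 + (N * (k + 2) + 1) := by ring
  rw [e]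
  exact this

/-! ### Majorities of independent noisy bits -/

/-- At least half of the evaluations in the block `F` are wrong. -/
def BadBlock (F : Finset (ℕ × ℕ)) (ω : Noise) : Prop :=
  F.card ≤ 2 * (F.filter fun k => ω k = true).card

/-- For the true error rate `a` the expectation is `(1 - a) * m⁻¹ + a * m`, which increases with `a`
because `m⁻¹ < m`. -/
theorem IsNoiseLaw.lintegral_bit_le {p m : ℝ} (hm : 1 < m) {μ : Measure Noise}
    (hμ : IsNoiseLaw p μ) (k : ℕ × ℕ) :
    ∫⁻ ω, ENNReal.ofReal (if ω k = true then m else m⁻¹) ∂μ ≤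
      ENNReal.ofReal ((1 - p) * m⁻¹ + p * m) := by
  have := hμ.prob
  have hk : Measurable fun ω : Noise => ω k := measurable_pi_apply k
  have h1 := lintegral_map (μ := μ) (f := fun b : Bool => ENNReal.ofReal (if b = true then m else m⁻¹))
    (measurable_of_countable _) hk
  rw [← h1, lintegral_fintype]
  have ht : (μ.map fun ω : Noise => ω k) {true} = ENNReal.ofReal (μ.real {ω | ω k = true}) := by
    rw [Measure.map_apply hk (measurableSet_singleton _), ofReal_measureReal]; rfl
  have hf : (μ.map fun ω : Noise => ω k) {false} =
      ENNReal.ofReal (1 - μ.real {ω | ω k = true}) := by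
    rw [Measure.map_apply hk (measurableSet_singleton _)]
    have hc : (fun ω : Noise => ω k) ⁻¹' {false} = {ω : Noise | ω k = true}ᶜ := by
      ext ω; simp
    have hms : MeasurableSet {ω : Noise | ω k = true} := hk (measurableSet_singleton true)
    rw [hc, ← probReal_compl_eq_one_sub hms, ofReal_measureReal]
  have hle := hμ.err_le k
  set a := μ.real {ω | ω k = true} with ha
  have ha0 : 0 ≤ a := measureReal_nonneg
  have ha1 : a ≤ 1 := measureReal_le_one
  have hm0 : 0 < m := by linarith
  have hinv : m⁻¹ < m := (inv_lt_one_of_one_lt₀ hm).trans hm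
  rw [Fintype.sum_bool, ht, hf, ← ENNReal.ofReal_mul (by simp; positivity),
    ← ENNReal.ofReal_mul (by simp; positivity),
    ← ENNReal.ofReal_add (by simp; positivity)
      (mul_nonneg (by simp; positivity) (by linarith))]
  apply ENNReal.ofReal_le_ofReal
  simp only [if_true, Bool.false_eq_true, if_false]
  nlinarith

/-- Chernoff's argument: weigh an error by `m` and a correct evaluation by `m⁻¹`. If at least half
of the evaluations err, the product of the weights is at least `1`; Markov's inequality applies, and
by independence the expected product factorises. -/
theorem IsNoiseLaw.measure_badBlock_le {p m : ℝ} (hm : 1 < m) {μ : Measure Noise}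
    (hμ : IsNoiseLaw p μ) (F : Finset (ℕ × ℕ)) :
    μ {ω | BadBlock F ω} ≤ ENNReal.ofReal ((1 - p) * m⁻¹ + p * m) ^ F.card := by
  have hm0 : 0 < m := by linarith
  have hmeas : Measurable fun b : Bool => ENNReal.ofReal (if b = true then m else m⁻¹) :=
    measurable_of_countable _
  have hsub : {ω | BadBlock F ω} ⊆
      {ω | 1 ≤ ∏ k ∈ F, ENNReal.ofReal (if ω k = true then m else m⁻¹)} := by
    intro ω hω
    simp only [mem_ofPred_eq] at hω ⊢
    rw [← ENNReal.ofReal_prod_of_nonneg (fun i _ => by split_ifs <;> positivity),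
      ENNReal.one_le_ofReal, Finset.prod_ite, Finset.prod_const, Finset.prod_const, inv_pow,
      ← div_eq_mul_inv, one_le_div (by positivity)]
    apply pow_le_pow_right₀ hm.le
    have := Finset.card_filter_add_card_filter_not (s := F) (fun k => ω k = true)
    unfold BadBlock at hω
    omega
  have hind : iIndepFun (fun (k : ℕ × ℕ) (ω : Noise) =>
      ENNReal.ofReal (if ω k = true then m else m⁻¹)) μ :=
    hμ.indep.comp (fun _ b => ENNReal.ofReal (if b = true then m else m⁻¹)) fun _ => hmeas
  have hmk : ∀ k : ℕ × ℕ, Measurable fun ω : Noise =>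
      ENNReal.ofReal (if ω k = true then m else m⁻¹) :=
    fun k => hmeas.comp (measurable_pi_apply k)
  calc μ {ω | BadBlock F ω} ≤ _ := measure_mono hsub
    _ = 1 * μ {ω | 1 ≤ ∏ k ∈ F, ENNReal.ofReal (if ω k = true then m else m⁻¹)} :=
        (one_mul _).symm
    _ ≤ ∫⁻ ω, ∏ k ∈ F, ENNReal.ofReal (if ω k = true then m else m⁻¹) ∂μ :=
        mul_meas_ge_le_lintegral (Finset.measurable_prod _ fun k _ => hmk k) 1
    _ = ∏ k ∈ F, ∫⁻ ω, ENNReal.ofReal (if ω k = true then m else m⁻¹) ∂μ :=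
        lintegral_prod_eq_prod_lintegral_of_indepFun F _ hind hmk
    _ ≤ ∏ _k ∈ F, ENNReal.ofReal ((1 - p) * m⁻¹ + p * m) :=
        Finset.prod_le_prod' fun k _ => hμ.lintegral_bit_le hm k
    _ = _ := by rw [Finset.prod_const]

/-- There is a rate `ρ < 1` at which the probability of a wrong majority decays with the number of
evaluations. -/
theorem exists_rate {p : ℝ} (hp : p < 1 / 2) : ∃ ρ : ℝ≥0∞, ρ < 1 ∧
    ∀ μ : Measure Noise, IsNoiseLaw p μ → ∀ F : Finset (ℕ × ℕ),
      μ {ω | BadBlock F ω} ≤ ρ ^ F.card := by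
  -- The lower bound `1 / 4` keeps `m` below finite. With `m = 1 / (2 * p')` the factor per
  -- evaluation is `2 * p' * (1 - p') + 1 / 2`, which is less than `1` because `p' < 1 / 2`.
  set p' := max p (1 / 4) with hp'
  have h1 : p' < 1 / 2 := max_lt hp (by norm_num)
  have h2 : 1 / 4 ≤ p' := le_max_right _ _
  set m : ℝ := 1 / (2 * p') with hmdef
  have hpm : p' * m = 1 / 2 := by rw [hmdef]; field_simp
  have hm : 1 < m := by rw [hmdef, lt_div_iff₀ (by linarith)]; linarith
  refine ⟨ENNReal.ofReal ((1 - p') * m⁻¹ + p' * m), ?_, fun μ hμ F => ?_⟩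
  · rw [ENNReal.ofReal_lt_one]
    have : m⁻¹ = 2 * p' := by rw [hmdef]; simp
    rw [this, hpm]
    nlinarith
  · exact IsNoiseLaw.measure_badBlock_le hm
      ⟨hμ.prob, hμ.indep, fun k => (hμ.err_le k).trans (le_max_left _ _)⟩ F

/-- Numbers of errors add over disjoint blocks. The simultaneous failure of several votes is thus a
single failed vote on the union, to which the rate `ρ` applies directly. -/
theorem badBlock_biUnion {ι : Type*} [DecidableEq ι] {S : Finset ι} {F : ι → Finset (ℕ × ℕ)}
    (hF : (S : Set ι).PairwiseDisjoint F) {ω : Noise} (h : ∀ b ∈ S, BadBlock (F b) ω) :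
    BadBlock (S.biUnion F) ω := by
  unfold BadBlock at *
  rw [Finset.card_biUnion hF, Finset.filter_biUnion, Finset.card_biUnion, Finset.mul_sum]
  · exact Finset.sum_le_sum h
  · intro a ha b hb hab
    exact (hF ha hb hab).mono (Finset.filter_subset _ _) (Finset.filter_subset _ _)

/-- The number of bad blocks among the first `n`. -/
noncomputable def badCount (F : ℕ → Finset (ℕ × ℕ)) (ω : Noise) (n : ℕ) : ℕ := by
  classical exact ((Finset.range n).filter fun b => BadBlock (F b) ω).card

theorem badCount_succ_of_bad {F : ℕ → Finset (ℕ × ℕ)} {ω : Noise} {n : ℕ}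
    (h : BadBlock (F n) ω) : badCount F ω (n + 1) = badCount F ω n + 1 := by
  classical
  unfold badCount
  rw [Finset.range_add_one, Finset.filter_insert, if_pos h, Finset.card_insert_of_notMem (by simp)]

theorem badCount_succ_of_not {F : ℕ → Finset (ℕ × ℕ)} {ω : Noise} {n : ℕ}
    (h : ¬ BadBlock (F n) ω) : badCount F ω (n + 1) = badCount F ω n := by
  classical
  unfold badCount
  rw [Finset.range_add_one, Finset.filter_insert, if_neg h]

/-- A union bound over the at most `2 ^ (3 * N)` sets of more than `N / 4` blocks. For each of them
the union of its blocks is bad with probability at most `(2⁻¹ ^ 16) ^ (N / 4) = 2⁻¹ ^ (4 * N)`; the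
exponent `16` is chosen to beat the number of sets. -/
theorem measure_badCount_le {μ : Measure Noise} {ρ : ℝ≥0∞}
    (hρ : ∀ F : Finset (ℕ × ℕ), μ {ω | BadBlock F ω} ≤ ρ ^ F.card) {R N : ℕ}
    (hR : ρ ^ R ≤ 2⁻¹ ^ 16) {F : ℕ → Finset (ℕ × ℕ)} (hcard : ∀ b, (F b).card = R)
    (hF : Pairwise fun a b => Disjoint (F a) (F b)) :
    μ {ω | N < 4 * badCount F ω (3 * N)} ≤ 2⁻¹ ^ N := by
  classical
  set 𝒮 := (Finset.range (3 * N)).powerset.filter fun S => N < 4 * S.card with h𝒮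
  have hsub : {ω | N < 4 * badCount F ω (3 * N)} ⊆
      ⋃ S ∈ 𝒮, {ω | BadBlock (S.biUnion F) ω} := by
    intro ω hω
    simp only [mem_ofPred_eq, badCount] at hω
    simp only [mem_iUnion, mem_ofPred_eq]
    refine ⟨(Finset.range (3 * N)).filter fun b => BadBlock (F b) ω, ?_, ?_⟩
    · rw [h𝒮, Finset.mem_filter, Finset.mem_powerset]
      exact ⟨Finset.filter_subset _ _, hω⟩
    · exact badBlock_biUnion (fun a _ b _ hab => hF hab) fun b hb => (Finset.mem_filter.1 hb).2
  have h2 : (2 : ℝ≥0∞)⁻¹ ≤ 1 := by simp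
  calc μ {ω | N < 4 * badCount F ω (3 * N)} ≤ _ := measure_mono hsub
    _ ≤ ∑ S ∈ 𝒮, μ {ω | BadBlock (S.biUnion F) ω} := measure_biUnion_finset_le _ _
    _ ≤ ∑ _S ∈ 𝒮, 2⁻¹ ^ (4 * N) := by
        refine Finset.sum_le_sum fun S hS => (hρ _).trans ?_
        rw [h𝒮, Finset.mem_filter] at hS
        rw [Finset.card_biUnion fun a _ b _ hab => hF hab, Finset.sum_congr rfl fun b _ => hcard b,
          Finset.sum_const, smul_eq_mul, mul_comm, pow_mul]
        calc (ρ ^ R) ^ S.card ≤ (2⁻¹ ^ 16) ^ S.card := by gcongr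
          _ = 2⁻¹ ^ (16 * S.card) := by rw [pow_mul]
          _ ≤ 2⁻¹ ^ (4 * N) := pow_le_pow_right_of_le_one' h2 (by omega)
    _ ≤ 2 ^ (3 * N) * 2⁻¹ ^ (4 * N) := by
        rw [Finset.sum_const, nsmul_eq_mul]
        gcongr
        have : 𝒮.card ≤ 2 ^ (3 * N) := by
          refine (Finset.card_filter_le _ _).trans ?_
          rw [Finset.card_powerset, Finset.card_range]
        exact_mod_cast this
    _ = 2⁻¹ ^ N := by
        have : 4 * N = 3 * N + N := by ring
        rw [this, pow_add, ← mul_assoc, ← mul_pow, ENNReal.mul_inv_cancel (by simp) (by simp),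
          one_pow, one_mul]

/-! ### A walk with backtracking towards a target in a binary tree of intervals -/

/-- The state of the walk after `j` steps, of which at most `bad` were misled: the walk is at the
interval `[lo, lo + w)`, which lies in a dyadic interval of length `2 ^ a` around the target. -/
def WalkInv (N T j bad lo w : ℕ) : Prop :=
  ∃ l a, w = 2 ^ l ∧ l ≤ a ∧ a ≤ N ∧ 2 ^ l ∣ lo ∧ lo / 2 ^ a = T / 2 ^ a ∧
    j + 2 * a ≤ N + l + 2 * bad ∧ N ≤ l + j

/-- The new left end of the interval. -/
def walkLo (top lo w : ℕ) (b₁ b₂ b₃ : Bool) : ℕ :=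
  if b₁ && !b₂ then (if b₃ then lo + w / 2 else lo)
  else if w < top then lo - lo % (2 * w) else lo

/-- The new length of the interval. -/
def walkWidth (top w : ℕ) (b₁ b₂ : Bool) : ℕ :=
  if b₁ && !b₂ then w / 2 else if w < top then 2 * w else w

theorem sub_mod_div_pow (x : ℕ) {b a : ℕ} (h : b ≤ a) :
    (x - x % 2 ^ b) / 2 ^ a = x / 2 ^ a := by
  obtain ⟨c, rfl⟩ := Nat.exists_eq_add_of_le h
  have h1 : x - x % 2 ^ b = 2 ^ b * (x / 2 ^ b) := by
    have := Nat.div_add_mod x (2 ^ b); omega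
  rw [h1, pow_add, ← Nat.div_div_eq_div_mul, ← Nat.div_div_eq_div_mul,
    Nat.mul_div_cancel_left _ (by positivity)]

theorem WalkInv.zero {N T : ℕ} (hT : T < 2 ^ N) : WalkInv N T 0 0 0 (2 ^ N) :=
  ⟨N, N, rfl, le_rfl, le_rfl, dvd_zero _, by rw [Nat.div_eq_of_lt hT]; simp, by omega, by omega⟩

theorem WalkInv.bounds {N T j bad lo w : ℕ} (hT : T < 2 ^ N) (h : WalkInv N T j bad lo w) :
    lo < 2 ^ N ∧ w ≤ 2 ^ N := by
  obtain ⟨l, a, rfl, hla, haN, hdvd, heq, h1, h2⟩ := h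
  constructor
  · have e1 : lo / 2 ^ N = T / 2 ^ N := by
      obtain ⟨c, rfl⟩ := Nat.exists_eq_add_of_le haN
      rw [pow_add, ← Nat.div_div_eq_div_mul, ← Nat.div_div_eq_div_mul, heq]
    rw [Nat.div_eq_of_lt hT] at e1
    exact (Nat.div_eq_zero_iff_lt (by positivity)).1 e1
  · exact Nat.pow_le_pow_right (by omega) (hla.trans haN)

/-- The walk is at level `l` of the tree, and it has a common ancestor with the leaf of the target
at level `a`. Hence `2 * a - l` bounds the distance to that leaf, and the invariant bounds this
number by `N - j + 2 * bad`. A move increases it by at most one. The condition `N ≤ l + j` ensures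
that an interval can still be halved before round `N`. -/
theorem WalkInv.step_any {N T j bad lo w : ℕ} (hj : j < N) (h : WalkInv N T j bad lo w)
    (b₁ b₂ b₃ : Bool) :
    WalkInv N T (j + 1) (bad + 1) (walkLo (2 ^ N) lo w b₁ b₂ b₃) (walkWidth (2 ^ N) w b₁ b₂) := by
  obtain ⟨l, a, rfl, hla, haN, hdvd, heq, h1, h2⟩ := h
  obtain ⟨k, rfl⟩ : ∃ k, l = k + 1 := ⟨l - 1, by omega⟩
  have hhalf : 2 ^ (k + 1) / 2 = 2 ^ k := by rw [pow_succ]; simp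
  have hdvd' : 2 ^ k ∣ lo := (pow_dvd_pow 2 (by omega)).trans hdvd
  unfold walkLo walkWidth
  split_ifs with c1 c2 c3
  · refine ⟨k, a, hhalf, by omega, haN, ?_, ?_, by omega, by omega⟩
    · rw [hhalf]; exact hdvd'.add (dvd_refl _)
    · rw [hhalf, ← heq]
      obtain ⟨d, rfl⟩ := Nat.exists_eq_add_of_le hla
      obtain ⟨e, rfl⟩ := hdvd
      rw [pow_add 2 (k + 1) d, ← Nat.div_div_eq_div_mul, ← Nat.div_div_eq_div_mul, Nat.mul_add_div
        (by positivity), Nat.div_eq_of_lt (a := 2 ^ k) (Nat.pow_lt_pow_right (by omega) (by omega)),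
        Nat.mul_div_cancel_left _ (by positivity), add_zero]
  · exact ⟨k, a, hhalf, by omega, haN, hdvd', heq, by omega, by omega⟩
  · have hlN : k + 1 < N := (Nat.pow_lt_pow_iff_right (by omega)).1 c3
    have hw : 2 * 2 ^ (k + 1) = 2 ^ (k + 2) := by ring
    have hd : 2 ^ (k + 2) ∣ lo - lo % 2 ^ (k + 2) := Nat.dvd_sub_mod _
    rw [hw]
    rcases hla.eq_or_lt with rfl | hlt
    · refine ⟨k + 2, k + 2, rfl, le_rfl, by omega, hd, ?_, by omega, by omega⟩
      rw [sub_mod_div_pow _ le_rfl, pow_succ 2 (k + 1), ← Nat.div_div_eq_div_mul,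
        ← Nat.div_div_eq_div_mul, heq]
    · exact ⟨k + 2, a, rfl, by omega, haN, hd, by rw [sub_mod_div_pow _ (by omega), heq],
        by omega, by omega⟩
  · have hlN : N ≤ k + 1 := by
      by_contra hcon
      exact c3 (Nat.pow_lt_pow_right (by omega) (by omega))
    exact ⟨k + 1, a, rfl, hla, haN, hdvd, heq, by omega, by omega⟩

/-- If the target is in the interval, the correct half is entered and becomes its own common
ancestor with the target. Otherwise `l < a`, and the move to the parent raises `l` alone. In both
cases `2 * a - l` decreases by at least one. -/
theorem WalkInv.step_good {N T j bad lo w : ℕ} (hj : j < N)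
    (h : WalkInv N T j bad lo w) {b₁ b₂ b₃ : Bool} (h₁ : b₁ = true ↔ lo ≤ T)
    (h₂ : b₂ = true ↔ lo + w ≤ T) (h₃ : b₃ = true ↔ lo + w / 2 ≤ T) :
    WalkInv N T (j + 1) bad (walkLo (2 ^ N) lo w b₁ b₂ b₃) (walkWidth (2 ^ N) w b₁ b₂) := by
  obtain ⟨l, a, rfl, hla, haN, hdvd, heq, h1, h2⟩ := h
  obtain ⟨k, rfl⟩ : ∃ k, l = k + 1 := ⟨l - 1, by omega⟩
  have hhalf : 2 ^ (k + 1) / 2 = 2 ^ k := by rw [pow_succ]; simp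
  have hdbl : 2 ^ (k + 1) = 2 ^ k + 2 ^ k := by ring
  have hdvd' : 2 ^ k ∣ lo := (pow_dvd_pow 2 (by omega)).trans hdvd
  have hdiv : ∀ {l x : ℕ}, 2 ^ l ∣ x → x ≤ T → T < x + 2 ^ l → x / 2 ^ l = T / 2 ^ l := by
    rintro l _ ⟨c, rfl⟩ hx hT
    rw [Nat.mul_div_cancel_left _ (by positivity)]
    exact ((Nat.div_eq_iff (by positivity)).2 ⟨by linarith, by
      have := Nat.two_pow_pos l; rw [mul_comm]; omega⟩).symm
  rw [hhalf] at h₃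
  have hcond : (b₁ && !b₂) = true ↔ lo ≤ T ∧ T < lo + 2 ^ (k + 1) := by
    cases b₁ <;> cases b₂ <;> simp_all
  unfold walkLo walkWidth
  rw [hhalf]
  split_ifs with c1 c2 c3
  · have hc := hcond.1 c1
    have hb := h₃.1 c2
    have hd : 2 ^ k ∣ lo + 2 ^ k := hdvd'.add (dvd_refl _)
    exact ⟨k, k, rfl, le_rfl, by omega, hd, hdiv hd hb (by omega), by omega, by omega⟩
  · have hc := hcond.1 c1
    have hb : ¬ lo + 2 ^ k ≤ T := fun h => c2 (h₃.2 h)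
    exact ⟨k, k, rfl, le_rfl, by omega, hdvd', hdiv hdvd' hc.1 (by omega), by omega, by omega⟩
  · have hlN : k + 1 < N := (Nat.pow_lt_pow_iff_right (by omega)).1 c3
    have hw : 2 * 2 ^ (k + 1) = 2 ^ (k + 2) := by ring
    have hd : 2 ^ (k + 2) ∣ lo - lo % 2 ^ (k + 2) := Nat.dvd_sub_mod _
    have hne : k + 1 ≠ a := by
      rintro rfl
      apply c1
      rw [hcond]
      obtain ⟨c, rfl⟩ := hdvd
      rw [Nat.mul_div_cancel_left _ (by positivity)] at heq
      have := Nat.div_add_mod T (2 ^ (k + 1))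
      have h5 := Nat.mod_lt T (Nat.two_pow_pos (k + 1))
      rw [← heq] at this
      omega
    rw [hw]
    exact ⟨k + 2, a, rfl, by omega, haN, hd, by rw [sub_mod_div_pow _ (by omega), heq],
      by omega, by omega⟩
  -- The interval is the whole range and contains the target, so correct answers never ask to leave
  -- it.
  · exfalso
    have hlN : N ≤ k + 1 := by
      by_contra hcon
      exact c3 (Nat.pow_lt_pow_right (by omega) (by omega))
    obtain rfl : a = k + 1 := by omega
    apply c1
    rw [hcond]
    obtain ⟨c, rfl⟩ := hdvd
    rw [Nat.mul_div_cancel_left _ (by positivity)] at heq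
    have := Nat.div_add_mod T (2 ^ (k + 1))
    have h5 := Nat.mod_lt T (Nat.two_pow_pos (k + 1))
    rw [← heq] at this
    omega

/-- At `j = N` the invariant gives `2 * a ≤ l + 2 * bad ≤ a + N / 2`. So `lo` shares with the target
a dyadic interval of length at most `2 ^ (N / 2) ≤ H`, and the target is the midpoint of the `t`-th
interval of length `2 * H`. The walk need not come near a leaf. -/
theorem WalkInv.result {N H t bad lo w : ℕ} (hH : 2 ^ (N / 2) ≤ H)
    (h : WalkInv N (t * (2 * H) + H) N bad lo w) (hbad : 4 * bad ≤ N) : lo / (2 * H) = t := by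
  obtain ⟨l, a, rfl, hla, haN, hdvd, heq, h1, h2⟩ := h
  have ha : 2 ^ a ≤ 2 ^ (N / 2) := Nat.pow_le_pow_right (by omega) (by omega)
  have hpos := Nat.two_pow_pos a
  set T := t * (2 * H) + H with hT
  have e1 := Nat.div_add_mod lo (2 ^ a)
  have e2 := Nat.div_add_mod T (2 ^ a)
  have m1 := Nat.mod_lt lo hpos
  have m2 := Nat.mod_lt T hpos
  rw [heq] at e1
  refine (Nat.div_eq_iff (by omega)).2 ⟨?_, ?_⟩ <;> omega

/-- A comparison with the target is a test of the sequence. -/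
theorem le_target_iff {t H y : ℕ} (hH : 0 < H) :
    y ≤ t * (2 * H) + H ↔ y ≤ H ∨ (y - H - 1) / (2 * H) < t := by
  rw [Nat.div_lt_iff_lt_mul (by omega)]
  omega

/-! ### Merging by ranks -/

/-- `lt` is a strict total order of `{0, …, m - 1}`. -/
structure IsRowOrder (m : ℕ) (lt : ℕ → ℕ → Prop) : Prop where
  irrefl : ∀ x < m, ¬ lt x x
  trans : ∀ x < m, ∀ y < m, ∀ z < m, lt x y → lt y z → lt x z
  total : ∀ x < m, ∀ y < m, x ≠ y → lt x y ∨ lt y x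

open Classical in
/-- The number of predecessors of `e` in the block `b` of length `w`. -/
noncomputable def countIn (lt : ℕ → ℕ → Prop) (m w b e : ℕ) : ℕ :=
  ((Finset.range m).filter fun f => f / w = b ∧ lt f e).card

/-- The rank of `e` in its block of length `w`. -/
noncomputable def blockRank (lt : ℕ → ℕ → Prop) (m w e : ℕ) : ℕ := countIn lt m w (e / w) e

/-- The position of `e` if every block of length `w` is sorted. -/
noncomputable def blockPos (lt : ℕ → ℕ → Prop) (m w e : ℕ) : ℕ :=
  e / w * w + blockRank lt m w e

/-- The block that is merged with the block `b`. -/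
def sibling (b : ℕ) : ℕ := if b % 2 = 0 then b + 1 else b - 1

namespace IsRowOrder

variable {m w : ℕ} {lt : ℕ → ℕ → Prop}

theorem countIn_lt (h : IsRowOrder m lt) {e f b : ℕ} (he : e < m) (hf : f < m) (hb : e / w = b)
    (hlt : lt e f) : countIn lt m w b e < countIn lt m w b f := by
  classical
  apply Finset.card_lt_card
  refine ⟨fun g hg => ?_, fun hcon => ?_⟩
  · simp only [Finset.mem_filter, Finset.mem_range] at hg ⊢
    exact ⟨hg.1, hg.2.1, h.trans g hg.1 e he f hf hg.2.2 hlt⟩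
  · have := hcon (show e ∈ _ by simpa using ⟨he, hb, hlt⟩)
    simp only [Finset.mem_filter, Finset.mem_range] at this
    exact h.irrefl e he this.2.2

theorem countIn_le (h : IsRowOrder m lt) {e f b : ℕ} (he : e < m) (hf : f < m)
    (hlt : lt e f) : countIn lt m w b e ≤ countIn lt m w b f := by
  classical
  apply Finset.card_le_card
  intro g hg
  simp only [Finset.mem_filter, Finset.mem_range] at hg ⊢
  exact ⟨hg.1, hg.2.1, h.trans g hg.1 e he f hf hg.2.2 hlt⟩

theorem countIn_add_le (hw : 0 < w) (b e : ℕ) (hb : b * w ≤ m) :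
    b * w + countIn lt m w b e ≤ m ∧ countIn lt m w b e ≤ w := by
  classical
  have hsub : ((Finset.range m).filter fun f => f / w = b ∧ lt f e) ⊆
      Finset.Ico (b * w) (min m (b * w + w)) := by
    intro g hg
    simp only [Finset.mem_filter, Finset.mem_range, Finset.mem_Ico] at hg ⊢
    obtain ⟨hg, hgb, _⟩ := hg
    rw [Nat.div_eq_iff hw] at hgb
    omega
  have := Finset.card_le_card hsub
  rw [Nat.card_Ico] at this
  unfold countIn
  omega

theorem blockRank_lt (h : IsRowOrder m lt) (hw : 0 < w) {e : ℕ} (he : e < m) :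
    blockPos lt m w e < m ∧ blockRank lt m w e < w := by
  classical
  have hsub : ((Finset.range m).filter fun f => f / w = e / w ∧ lt f e) ⊆
      (Finset.Ico (e / w * w) (min m (e / w * w + w))).erase e := by
    intro g hg
    simp only [Finset.mem_filter, Finset.mem_range, Finset.mem_erase, Finset.mem_Ico] at hg ⊢
    obtain ⟨hg, hgb, hlt⟩ := hg
    refine ⟨fun hge => h.irrefl e he (hge ▸ hlt), ?_⟩
    rw [Nat.div_eq_iff hw] at hgb
    omega
  have hmod := Nat.div_add_mod e w
  have hlt := Nat.mod_lt e hw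
  rw [mul_comm] at hmod
  have := Finset.card_le_card hsub
  rw [Finset.card_erase_of_mem (Finset.mem_Ico.2 ⟨by omega, by omega⟩), Nat.card_Ico] at this
  unfold blockPos blockRank countIn
  omega

theorem blockPos_div (h : IsRowOrder m lt) (hw : 0 < w) {e : ℕ} (he : e < m) :
    blockPos lt m w e / w = e / w := by
  have := (h.blockRank_lt hw he).2
  unfold blockPos
  rw [mul_comm, Nat.mul_add_div hw, Nat.div_eq_of_lt this, add_zero]

theorem blockPos_injective (h : IsRowOrder m lt) (hw : 0 < w) {e f : ℕ} (he : e < m) (hf : f < m)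
    (heq : blockPos lt m w e = blockPos lt m w f) : e = f := by
  have hb : e / w = f / w := by rw [← h.blockPos_div hw he, heq, h.blockPos_div hw hf]
  by_contra hne
  unfold blockPos blockRank at heq
  rw [hb] at heq
  rcases h.total e he f hf hne with hlt | hlt
  · have := h.countIn_lt he hf hb hlt; omega
  · have := h.countIn_lt (w := w) hf he rfl hlt; omega

/-- Positions form an injective self-map of a finite set, so each of them is taken, also in an
incomplete last block. -/
theorem exists_blockPos (h : IsRowOrder m lt) (hw : 0 < w) {j : ℕ} (hj : j < m) :
    ∃ e < m, blockPos lt m w e = j := by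
  have hinj : Function.Injective fun e : Fin m =>
      (⟨blockPos lt m w e, (h.blockRank_lt hw e.2).1⟩ : Fin m) := by
    intro e f hef
    exact Fin.ext (h.blockPos_injective hw e.2 f.2 (congrArg Fin.val hef))
  obtain ⟨e, he⟩ := (Finite.injective_iff_surjective.1 hinj) ⟨j, hj⟩
  exact ⟨e, e.2, congrArg Fin.val he⟩

/-- If `f` precedes `e`, then `f` is counted for `e` and not for itself. Ranks relative to the block
of `f` therefore decide comparisons with any `e`, inside or outside of the block. -/
theorem lt_iff_countIn (h : IsRowOrder m lt) {e f b : ℕ} (he : e < m) (hf : f < m)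
    (hb : f / w = b) (hne : f ≠ e) : lt f e ↔ countIn lt m w b f < countIn lt m w b e := by
  refine ⟨h.countIn_lt hf he hb, fun hc => ?_⟩
  rcases h.total f hf e he hne with hlt | hlt
  · exact hlt
  · have := h.countIn_le (w := w) (b := b) he hf hlt; omega

theorem sibling_ne (b : ℕ) : sibling b ≠ b := by
  unfold sibling; split_ifs <;> omega

/-- A block of length `2 * w` is the disjoint union of a block of length `w` and its sibling. To
merge, an item only has to learn its count in the sibling. -/
theorem blockRank_two_mul (lt : ℕ → ℕ → Prop) (m w e : ℕ) :
    blockRank lt m (2 * w) e = blockRank lt m w e + countIn lt m w (sibling (e / w)) e := by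
  classical
  have hdiv : ∀ x, x / (2 * w) = x / w / 2 := fun x => by
    rw [mul_comm, Nat.div_div_eq_div_mul]
  unfold blockRank countIn
  rw [← Finset.card_union_of_disjoint]
  · congr 1
    ext f
    simp only [Finset.mem_filter, Finset.mem_range, Finset.mem_union, hdiv]
    have : f / w / 2 = e / w / 2 ↔ f / w = e / w ∨ f / w = sibling (e / w) := by
      unfold sibling
      generalize f / w = x
      generalize e / w = y
      split_ifs <;> omega
    rw [this]
    tauto
  · rw [Finset.disjoint_filter]
    rintro f _ ⟨h1, _⟩ ⟨h2, _⟩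
    exact sibling_ne _ (h2.symm.trans h1)

/-- The processor that knows the last predecessor of `e` in the sibling block. -/
def IsWriter (m w : ℕ) (lt : ℕ → ℕ → Prop) (A : ℕ → ℕ) (e j : ℕ) : Prop :=
  j / w = sibling (e / w) ∧ lt (A j) e ∧
    ¬ (j + 1 < m ∧ (j + 1) / w = j / w ∧ lt (A (j + 1)) e)

/-- In the sorted sibling block the predecessors of `e` are an initial segment, and `j` is its last
position. Hence an item has at most one writer, which makes the writes exclusive, and this writer
reads the count off its own position. -/
theorem IsWriter.eq (h : IsRowOrder m lt) (hw : 0 < w) {A : ℕ → ℕ}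
    (hA : ∀ e < m, A (blockPos lt m w e) = e) {e j : ℕ} (he : e < m) (hj : j < m)
    (hW : IsWriter m w lt A e j) :
    j + 1 = sibling (e / w) * w + countIn lt m w (sibling (e / w)) e := by
  obtain ⟨h1, h2, h3⟩ := hW
  obtain ⟨f, hf, rfl⟩ := h.exists_blockPos hw hj
  have hfe : ∀ f, f / w = sibling (e / w) → f ≠ e := fun f hf hfe => by
    subst hfe; exact sibling_ne _ hf.symm
  rw [hA f hf] at h2
  rw [h.blockPos_div hw hf] at h1
  have h4 := (h.lt_iff_countIn he hf h1 (hfe f h1)).1 h2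
  have hbw : sibling (e / w) * w ≤ m := by
    rw [← h1]; exact (Nat.div_mul_le_self _ _).trans hf.le
  have hle := countIn_add_le (lt := lt) hw (sibling (e / w)) e hbw
  have hpos : blockPos lt m w f = sibling (e / w) * w + countIn lt m w (sibling (e / w)) f := by
    unfold blockPos blockRank; rw [h1]
  by_contra hne
  apply h3
  have hlt1 : blockPos lt m w f + 1 < m := by omega
  have hdiv : (blockPos lt m w f + 1) / w = sibling (e / w) := by
    rw [Nat.div_eq_iff hw]; omega
  refine ⟨hlt1, by rw [hdiv, h.blockPos_div hw hf, h1], ?_⟩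
  obtain ⟨g, hg, hgp⟩ := h.exists_blockPos hw hlt1
  rw [← hgp] at hdiv ⊢
  rw [hA g hg]
  rw [h.blockPos_div hw hg] at hdiv
  rw [h.lt_iff_countIn he hg hdiv (hfe g hdiv)]
  have hpos' : blockPos lt m w g = sibling (e / w) * w + countIn lt m w (sibling (e / w)) g := by
    unfold blockPos blockRank; rw [hdiv]
  omega

/-- The writer sits at the last of the predecessors in the sibling. Without predecessors there is no
writer, and none is needed because the rank of `e` does not change. -/
theorem exists_isWriter (h : IsRowOrder m lt) (hw : 0 < w) {A : ℕ → ℕ}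
    (hA : ∀ e < m, A (blockPos lt m w e) = e) {e : ℕ} (he : e < m)
    (hc : countIn lt m w (sibling (e / w)) e ≠ 0) : ∃ j < m, IsWriter m w lt A e j := by
  classical
  have hfe : ∀ f, f / w = sibling (e / w) → f ≠ e := fun f hf hfe => by
    subst hfe; exact sibling_ne _ hf.symm
  obtain ⟨f₀, hf₀⟩ := Finset.card_pos.1 (Nat.pos_of_ne_zero hc)
  simp only [Finset.mem_filter, Finset.mem_range] at hf₀
  have hbw : sibling (e / w) * w ≤ m := by
    rw [← hf₀.2.1]; exact (Nat.div_mul_le_self _ _).trans hf₀.1.le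
  have hle := countIn_add_le (lt := lt) hw (sibling (e / w)) e hbw
  set c := countIn lt m w (sibling (e / w)) e with hcdef
  have hj : sibling (e / w) * w + (c - 1) < m := by omega
  have hdiv : (sibling (e / w) * w + (c - 1)) / w = sibling (e / w) := by
    rw [Nat.div_eq_iff hw]; omega
  refine ⟨_, hj, hdiv, ?_, ?_⟩
  · obtain ⟨f, hf, hfp⟩ := h.exists_blockPos hw hj
    rw [← hfp, hA f hf]
    rw [← hfp, h.blockPos_div hw hf] at hdiv
    rw [h.lt_iff_countIn he hf hdiv (hfe f hdiv)]
    have hpos : blockPos lt m w f = sibling (e / w) * w + countIn lt m w (sibling (e / w)) f := by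
      unfold blockPos blockRank; rw [hdiv]
    omega
  · rintro ⟨hj1, hdiv1, hlt⟩
    obtain ⟨g, hg, hgp⟩ := h.exists_blockPos hw hj1
    rw [hdiv, ← hgp, h.blockPos_div hw hg] at hdiv1
    rw [← hgp, hA g hg, h.lt_iff_countIn he hg hdiv1 (hfe g hdiv1)] at hlt
    have hpos : blockPos lt m w g = sibling (e / w) * w + countIn lt m w (sibling (e / w)) g := by
      unfold blockPos blockRank; rw [hdiv1]
    omega

/-- With a single block the positions enumerate the items in increasing order. -/
theorem sorted_of_le (h : IsRowOrder m lt) (hw : m ≤ w) {A : ℕ → ℕ}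
    (hA : ∀ e < m, A (blockPos lt m w e) = e) :
    (∀ j < m, A j < m) ∧ (∀ e < m, ∃ j < m, A j = e) ∧
      ∀ j < m, ∀ j' < m, lt (A j) (A j') ↔ j < j' := by
  rcases Nat.eq_zero_or_pos m with rfl | hm
  · simp
  have hw0 : 0 < w := by omega
  have hzero : ∀ e < m, e / w = 0 := fun e he => Nat.div_eq_of_lt (by omega)
  have hpos : ∀ e < m, blockPos lt m w e = countIn lt m w 0 e := fun e he => by
    unfold blockPos blockRank; rw [hzero e he]; simp
  refine ⟨fun j hj => ?_, fun e he => ⟨_, (h.blockRank_lt hw0 he).1, hA e he⟩, ?_⟩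
  · obtain ⟨e, he, rfl⟩ := h.exists_blockPos hw0 hj
    rw [hA e he]; exact he
  · intro j hj j' hj'
    obtain ⟨e, he, rfl⟩ := h.exists_blockPos hw0 hj
    obtain ⟨f, hf, rfl⟩ := h.exists_blockPos hw0 hj'
    rw [hA e he, hA f hf]
    by_cases hef : e = f
    · subst hef; simp [h.irrefl e he]
    · rw [h.lt_iff_countIn hf he (hzero e he) hef, hpos e he, hpos f hf]

end IsRowOrder

/-! ### Slabs of a planar subdivision -/

namespace PlanarSubdivision

variable (S : PlanarSubdivision)

/-- The left endpoint of a non-vertical edge. -/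
noncomputable def left (e : Fin S.ne) : Fin S.nv :=
  if (S.vtx (S.src e)).1 < (S.vtx (S.dst e)).1 then S.src e else S.dst e

/-- The right endpoint of a non-vertical edge. -/
noncomputable def right (e : Fin S.ne) : Fin S.nv :=
  if (S.vtx (S.src e)).1 < (S.vtx (S.dst e)).1 then S.dst e else S.src e

/-- The face above a non-vertical edge. -/
noncomputable def upper (e : Fin S.ne) : Fin S.nf :=
  if (S.vtx (S.src e)).1 < (S.vtx (S.dst e)).1 then S.leftFace e else S.rightFace e

noncomputable def slope (e : Fin S.ne) : ℝ :=
  ((S.vtx (S.right e)).2 - (S.vtx (S.left e)).2) / ((S.vtx (S.right e)).1 - (S.vtx (S.left e)).1)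

/-- The `y`-coordinate at `x` of the line that carries the edge `e`. -/
noncomputable def height (e : Fin S.ne) (x : ℝ) : ℝ :=
  (S.vtx (S.left e)).2 + (x - (S.vtx (S.left e)).1) * S.slope e

/-- The edge `e` crosses the slab that ends at the vertical line through `q`. -/
def Spans (q : ℝ × ℝ) (e : Fin S.ne) : Prop :=
  (S.vtx (S.left e)).1 < q.1 ∧ q.1 ≤ (S.vtx (S.right e)).1

/-- The outcome of the orientation test that compares two edges. -/
def Below (e e' : Fin S.ne) : Prop :=
  if S.left e = S.left e' then
    0 < orient (S.vtx (S.left e)) (S.vtx (S.right e)) (S.vtx (S.right e'))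
  else if (S.vtx (S.left e')).1 < (S.vtx (S.left e)).1 then
    0 < orient (S.vtx (S.right e')) (S.vtx (S.left e')) (S.vtx (S.left e))
  else 0 < orient (S.vtx (S.left e)) (S.vtx (S.right e)) (S.vtx (S.left e'))

/-- `x` is the abscissa of a vertical line in the open slab that ends at `q`. -/
def Slab (q : ℝ × ℝ) (x : ℝ) : Prop :=
  (∀ a, (S.vtx a).1 < q.1 → (S.vtx a).1 < x) ∧ ∀ a, q.1 ≤ (S.vtx a).1 → x < (S.vtx a).1

/-! ### Orientation tests and the vertical order of edges. -/

variable {S}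

theorem Spans.lt {q : ℝ × ℝ} {e : Fin S.ne} (h : S.Spans q e) :
    (S.vtx (S.left e)).1 < (S.vtx (S.right e)).1 := h.1.trans_le h.2

theorem Spans.mem {q : ℝ × ℝ} {e : Fin S.ne} (h : S.Spans q e) {x : ℝ} (hx : S.Slab q x) :
    (S.vtx (S.left e)).1 < x ∧ x < (S.vtx (S.right e)).1 :=
  ⟨hx.1 _ h.1, hx.2 _ h.2⟩

theorem orient_eq_height {e : Fin S.ne} (h : (S.vtx (S.left e)).1 < (S.vtx (S.right e)).1)
    (z : ℝ × ℝ) : orient (S.vtx (S.left e)) (S.vtx (S.right e)) z =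
      ((S.vtx (S.right e)).1 - (S.vtx (S.left e)).1) * (z.2 - S.height e z.1) := by
  have : (S.vtx (S.right e)).1 - (S.vtx (S.left e)).1 ≠ 0 := by linarith
  unfold orient height slope
  field_simp
  ring

theorem orient_pos_iff {e : Fin S.ne} (h : (S.vtx (S.left e)).1 < (S.vtx (S.right e)).1)
    (z : ℝ × ℝ) : 0 < orient (S.vtx (S.left e)) (S.vtx (S.right e)) z ↔
      S.height e z.1 < z.2 := by
  rw [orient_eq_height h, mul_pos_iff_of_pos_left (by linarith), sub_pos]

theorem orient_swap_pos_iff {e : Fin S.ne} (h : (S.vtx (S.left e)).1 < (S.vtx (S.right e)).1)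
    (z : ℝ × ℝ) : 0 < orient (S.vtx (S.right e)) (S.vtx (S.left e)) z ↔
      z.2 < S.height e z.1 := by
  have : orient (S.vtx (S.right e)) (S.vtx (S.left e)) z =
      -orient (S.vtx (S.left e)) (S.vtx (S.right e)) z := by unfold orient; ring
  rw [this, orient_eq_height h, ← mul_neg, mul_pos_iff_of_pos_left (by linarith)]
  constructor <;> intro h <;> linarith

theorem height_left (e : Fin S.ne) :
    S.height e (S.vtx (S.left e)).1 = (S.vtx (S.left e)).2 := by simp [height]

theorem height_right {e : Fin S.ne} (h : (S.vtx (S.left e)).1 < (S.vtx (S.right e)).1) :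
    S.height e (S.vtx (S.right e)).1 = (S.vtx (S.right e)).2 := by
  have : (S.vtx (S.right e)).1 - (S.vtx (S.left e)).1 ≠ 0 := by linarith
  unfold height slope
  field_simp
  ring

theorem openSegment_left_right (e : Fin S.ne) :
    openSegment ℝ (S.vtx (S.left e)) (S.vtx (S.right e)) =
      openSegment ℝ (S.vtx (S.src e)) (S.vtx (S.dst e)) := by
  unfold left right
  split_ifs
  · rfl
  · exact openSegment_symm _ _ _

theorem mem_openSegment_of_height {e : Fin S.ne} {x : ℝ} (h₁ : (S.vtx (S.left e)).1 < x)
    (h₂ : x < (S.vtx (S.right e)).1) :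
    (x, S.height e x) ∈ openSegment ℝ (S.vtx (S.src e)) (S.vtx (S.dst e)) := by
  rw [← openSegment_left_right]
  set l := S.vtx (S.left e) with hl
  set r := S.vtx (S.right e) with hr
  have hd : 0 < r.1 - l.1 := by linarith
  refine ⟨(r.1 - x) / (r.1 - l.1), (x - l.1) / (r.1 - l.1), div_pos (by linarith) hd,
    div_pos (by linarith) hd, by field_simp; ring, ?_⟩
  ext
  · simp only [Prod.fst_add, Prod.smul_fst, smul_eq_mul]
    field_simp; ring
  · simp only [Prod.snd_add, Prod.smul_snd, smul_eq_mul, height, slope, ← hl, ← hr]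
    field_simp; ring

theorem height_ne {e e' : Fin S.ne} (hne : e ≠ e') {x : ℝ}
    (h : (S.vtx (S.left e)).1 < x ∧ x < (S.vtx (S.right e)).1)
    (h' : (S.vtx (S.left e')).1 < x ∧ x < (S.vtx (S.right e')).1) :
    S.height e x ≠ S.height e' x := by
  intro heq
  have h1 := mem_openSegment_of_height h.1 h.2
  have h2 := mem_openSegment_of_height h'.1 h'.2
  rw [← heq] at h2
  exact disjoint_left.1 (S.disjoint_edges e e' hne) h1 h2

theorem height_affine (e : Fin S.ne) {a b : ℝ} (hab : a + b = 1) (x y : ℝ) :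
    S.height e (a * x + b * y) = a * S.height e x + b * S.height e y := by
  obtain rfl : a = 1 - b := by linarith
  unfold height; ring

theorem lt_combination {a b c x y : ℝ} (ha : 0 < a) (hb : 0 ≤ b) (hab : a + b = 1) (hx : c < x)
    (hy : c ≤ y) : c < a * x + b * y := by
  have h1 := mul_lt_mul_of_pos_left hx ha
  have h2 := mul_le_mul_of_nonneg_left hy hb
  have h3 : c = a * c + b * c := by rw [← add_mul, hab, one_mul]
  linarith

theorem combination_lt {a b c x y : ℝ} (ha : 0 < a) (hb : 0 ≤ b) (hab : a + b = 1) (hx : x < c)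
    (hy : y ≤ c) : a * x + b * y < c := by
  have h1 := mul_lt_mul_of_pos_left hx ha
  have h2 := mul_le_mul_of_nonneg_left hy hb
  have h3 : c = a * c + b * c := by rw [← add_mul, hab, one_mul]
  linarith

/-- If the order were reversed at `y`, the two affine functions would agree at the convex
combination of `x` and `y` weighted by their differences. This abscissa lies strictly inside both
edges because `x` does, so the relative interiors would meet. Strictness may be lost at `y`, where
the edges can share an endpoint. -/
theorem height_le_of_lt {e e' : Fin S.ne} (hne : e ≠ e') {x y : ℝ}
    (h : (S.vtx (S.left e)).1 < x ∧ x < (S.vtx (S.right e)).1)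
    (h' : (S.vtx (S.left e')).1 < x ∧ x < (S.vtx (S.right e')).1)
    (hy : (S.vtx (S.left e)).1 ≤ y ∧ y ≤ (S.vtx (S.right e)).1)
    (hy' : (S.vtx (S.left e')).1 ≤ y ∧ y ≤ (S.vtx (S.right e')).1)
    (hlt : S.height e x < S.height e' x) : S.height e y ≤ S.height e' y := by
  by_contra! hcon
  set d₁ := S.height e' x - S.height e x with hd₁
  set d₂ := S.height e y - S.height e' y with hd₂
  have p1 : 0 < d₁ := by linarith
  have p2 : 0 < d₂ := by linarith
  have hs : 0 < d₁ + d₂ := by linarith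
  set a := d₂ / (d₁ + d₂) with ha
  set b := d₁ / (d₁ + d₂) with hb
  have hab : a + b = 1 := by rw [ha, hb]; field_simp; ring
  have a0 : 0 < a := div_pos p2 hs
  have b0 : 0 < b := div_pos p1 hs
  have hab2 : a * d₁ = b * d₂ := by rw [ha, hb]; field_simp
  refine height_ne hne (x := a * x + b * y) ⟨?_, ?_⟩ ⟨?_, ?_⟩ ?_
  · exact lt_combination a0 b0.le hab h.1 hy.1
  · exact combination_lt a0 b0.le hab h.2 hy.2
  · exact lt_combination a0 b0.le hab h'.1 hy'.1
  · exact combination_lt a0 b0.le hab h'.2 hy'.2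
  · rw [height_affine _ hab, height_affine _ hab]
    rw [hd₁, hd₂] at hab2
    linarith

/-- Two edges over a common abscissa can be compared at the later of their left endpoints, where
both are present; if the left endpoints coincide, the right endpoint of `e'` is compared with the
line of `e`. Since edges do not cross, the result is valid in every slab that both cross, so a
single table of comparisons serves all rows. -/
theorem below_iff {e e' : Fin S.ne} (hne : e ≠ e') {x : ℝ}
    (h : (S.vtx (S.left e)).1 < x ∧ x < (S.vtx (S.right e)).1)
    (h' : (S.vtx (S.left e')).1 < x ∧ x < (S.vtx (S.right e')).1) :
    S.Below e e' ↔ S.height e x < S.height e' x := by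
  have hlr := h.1.trans h.2
  have hlr' := h'.1.trans h'.2
  unfold Below
  split_ifs with c1 c2
  · rw [orient_pos_iff hlr, ← height_right hlr']
    -- Both lines pass through the common left endpoint, so to its right the sign of the difference
    -- is that of the difference of slopes, even beyond the end of `e`.
    have d : ∀ y, S.height e' y - S.height e y =
        (y - (S.vtx (S.left e)).1) * (S.slope e' - S.slope e) := by
      intro y; unfold height; rw [c1]; ring
    have d1 := d x
    have d2 := d (S.vtx (S.right e')).1
    rw [← c1] at hlr'
    constructor
    · intro hlt
      have : 0 < S.slope e' - S.slope e := by
        by_contra hcon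
        nlinarith
      nlinarith
    · intro hlt
      have : 0 < S.slope e' - S.slope e := by
        by_contra hcon
        nlinarith
      nlinarith
  · rw [orient_swap_pos_iff hlr', ← height_left e]
    have hl' : (S.vtx (S.left e')).1 ≤ (S.vtx (S.left e)).1 ∧
        (S.vtx (S.left e)).1 ≤ (S.vtx (S.right e')).1 := ⟨c2.le, (h.1.trans h'.2).le⟩
    have hl : (S.vtx (S.left e)).1 ≤ (S.vtx (S.left e)).1 ∧
        (S.vtx (S.left e)).1 ≤ (S.vtx (S.right e)).1 := ⟨le_rfl, hlr.le⟩
    constructor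
    · intro hlt
      by_contra hcon
      have := (height_ne hne h h').lt_or_gt.resolve_left hcon
      exact absurd (height_le_of_lt (Ne.symm hne) h' h hl' hl this) (not_le.2 hlt)
    · intro hlt
      refine lt_of_le_of_ne (height_le_of_lt hne h h' hl hl' hlt) fun heq => ?_
      -- Equality would put the left endpoint of `e` into the relative interior of `e'`.
      have := mem_openSegment_of_height c2 (h.1.trans h'.2)
      rw [← heq, height_left] at this
      exact S.vtx_notMem_edge _ _ this
  · rw [orient_pos_iff hlr, ← height_left e']
    have hle := not_lt.1 c2
    have hl : (S.vtx (S.left e)).1 ≤ (S.vtx (S.left e')).1 ∧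
        (S.vtx (S.left e')).1 ≤ (S.vtx (S.right e)).1 := ⟨hle, (h'.1.trans h.2).le⟩
    have hl' : (S.vtx (S.left e')).1 ≤ (S.vtx (S.left e')).1 ∧
        (S.vtx (S.left e')).1 ≤ (S.vtx (S.right e')).1 := ⟨le_rfl, hlr'.le⟩
    constructor
    · intro hlt
      by_contra hcon
      have := (height_ne hne h h').lt_or_gt.resolve_left hcon
      exact absurd (height_le_of_lt (Ne.symm hne) h' h hl' hl this) (not_le.2 hlt)
    · intro hlt
      refine lt_of_le_of_ne (height_le_of_lt hne h h' hl hl' hlt) fun heq => ?_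
      -- With equal abscissas, equal heights would identify the two left endpoints, contrary to
      -- `c1`; otherwise a vertex would lie inside `e`.
      rcases hle.eq_or_lt with h0 | h0
      · apply c1
        apply S.vtx_injective
        ext
        · exact h0
        · rw [← h0, height_left, h0, height_left] at heq
          exact heq
      · have := mem_openSegment_of_height h0 (h'.1.trans h.2)
        rw [heq, height_left] at this
        exact S.vtx_notMem_edge _ _ this

/-! ### Trapezoids and the faces that contain them. -/

theorem eventually_slab (q : ℝ × ℝ) : ∀ᶠ ε : ℝ in 𝓝[>] 0, S.Slab q (q.1 - ε) := by
  have h1 : ∀ a, ∀ᶠ ε : ℝ in 𝓝[>] 0, (S.vtx a).1 < q.1 → (S.vtx a).1 < q.1 - ε := by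
    intro a
    by_cases h : (S.vtx a).1 < q.1
    · filter_upwards [Ioo_mem_nhdsGT (show (0 : ℝ) < q.1 - (S.vtx a).1 by linarith)] with ε hε _
      linarith [hε.2]
    · exact Eventually.of_forall fun ε h' => absurd h' h
  filter_upwards [eventually_all.2 h1, self_mem_nhdsWithin] with ε h2 h3
  exact ⟨h2, fun a ha => by linarith [mem_Ioi.1 h3]⟩

theorem exists_slab (q : ℝ × ℝ) : ∃ x, S.Slab q x :=
  (eventually_slab q).exists.imp' (fun ε => q.1 - ε) fun _ h => h

/-- The cell of the slab decomposition whose closure contains `q`. -/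
def trapezoid (S : PlanarSubdivision) (q : ℝ × ℝ) : Set (ℝ × ℝ) :=
  {z | S.Slab q z.1 ∧ ∀ e, S.Spans q e →
    (S.height e q.1 < q.2 → S.height e z.1 < z.2) ∧
    (¬ S.height e q.1 < q.2 → z.2 < S.height e z.1)}

/-- All defining conditions are strict affine inequalities in `z`. -/
theorem convex_trapezoid (q : ℝ × ℝ) : Convex ℝ (S.trapezoid q) := by
  have comb : ∀ {u v u' v' a b : ℝ}, 0 < a → 0 < b → u < v → u' < v' →
      a * u + b * u' < a * v + b * v' := fun ha hb h h' =>
    add_lt_add (mul_lt_mul_of_pos_left h ha) (mul_lt_mul_of_pos_left h' hb)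
  have one : ∀ {a b : ℝ} (u : ℝ), a + b = 1 → u = a * u + b * u := fun u h => by
    rw [← add_mul, h, one_mul]
  rw [convex_iff_forall_pos]
  intro z hz z' hz' a b ha hb hab
  refine ⟨⟨fun v hv => ?_, fun v hv => ?_⟩, fun e he => ⟨fun h => ?_, fun h => ?_⟩⟩
  · rw [one (S.vtx v).1 hab]
    exact comb ha hb (hz.1.1 v hv) (hz'.1.1 v hv)
  · rw [one (S.vtx v).1 hab]
    exact comb ha hb (hz.1.2 v hv) (hz'.1.2 v hv)
  · have := comb ha hb ((hz.2 e he).1 h) ((hz'.2 e he).1 h)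
    rw [← height_affine e hab] at this
    exact this
  · have := comb ha hb ((hz.2 e he).2 h) ((hz'.2 e he).2 h)
    rw [← height_affine e hab] at this
    exact this

/-- No vertex has its abscissa in the open slab. An edge with a point over the slab must therefore
cross all of it, and the trapezoid keeps strictly to one side of such an edge. -/
theorem trapezoid_subset (q : ℝ × ℝ) : S.trapezoid q ⊆ S.skeletonᶜ := by
  rintro z ⟨hz, hz'⟩ hmem
  have hnv : ∀ v, (S.vtx v).1 ≠ z.1 := by
    intro v hv
    rcases lt_or_ge (S.vtx v).1 q.1 with h | h
    · exact (hz.1 v h).ne hv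
    · exact (hz.2 v h).ne' hv
  rcases hmem with ⟨v, rfl⟩ | hmem
  · exact hnv v rfl
  · simp only [mem_iUnion] at hmem
    obtain ⟨e, he⟩ := hmem
    have hlr : segment ℝ (S.vtx (S.left e)) (S.vtx (S.right e)) =
        segment ℝ (S.vtx (S.src e)) (S.vtx (S.dst e)) := by
      unfold left right
      split_ifs
      · rfl
      · exact segment_symm _ _ _
    have hle : (S.vtx (S.left e)).1 ≤ (S.vtx (S.right e)).1 := by
      unfold left right
      split_ifs with h
      · exact h.le
      · exact not_lt.1 h
    rw [← hlr] at he
    obtain ⟨a, b, ha, hb, hab, hz1⟩ := he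
    have e1 : a * (S.vtx (S.left e)).1 + b * (S.vtx (S.right e)).1 = z.1 := by
      rw [← hz1]; simp
    have e2 : a * (S.vtx (S.left e)).2 + b * (S.vtx (S.right e)).2 = z.2 := by
      rw [← hz1]; simp
    obtain rfl : a = 1 - b := by linarith
    have l1 : (S.vtx (S.left e)).1 < z.1 :=
      lt_of_le_of_ne (by nlinarith [mul_nonneg hb (sub_nonneg.2 hle)]) (hnv _)
    have l2 : z.1 < (S.vtx (S.right e)).1 :=
      lt_of_le_of_ne (by nlinarith [mul_nonneg ha (sub_nonneg.2 hle)]) (hnv _).symm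
    have hsp : S.Spans q e := by
      constructor
      · by_contra h
        exact absurd (hz.2 _ (not_lt.1 h)) (not_lt.2 l1.le)
      · by_contra h
        exact absurd (hz.1 _ (not_le.1 h)) (not_lt.2 l2.le)
    have hh : S.height e z.1 = z.2 := by
      rw [← e1, height_affine e hab, height_left, height_right (l1.trans l2), e2]
    by_cases hq : S.height e q.1 < q.2
    · exact ((hz' e hsp).1 hq).ne hh
    · exact ((hz' e hsp).2 hq).ne' hh

theorem continuous_height (e : Fin S.ne) : Continuous (S.height e) := by
  unfold height; fun_prop

/-- Approach `q` from the left along a line steeper than every edge. Edges strictly below `q` remain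
below by continuity. Edges above `q` or through `q` end up strictly above, because the approaching
points fall away from them. -/
theorem mem_closure_trapezoid (q : ℝ × ℝ) : q ∈ closure (S.trapezoid q) := by
  set B : ℝ := 1 + ∑ e, |S.slope e| with hB
  have hBe : ∀ e, S.slope e < B := by
    intro e
    have := Finset.single_le_sum (f := fun e => |S.slope e|) (fun _ _ => abs_nonneg _)
      (Finset.mem_univ e)
    have := le_abs_self (S.slope e)
    linarith
  have hlim : Tendsto (fun ε : ℝ => (q.1 - ε, q.2 - ε * B)) (𝓝[>] 0) (𝓝 q) := by
    have : Continuous fun ε : ℝ => (q.1 - ε, q.2 - ε * B) := by fun_prop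
    have h := this.tendsto 0
    simp only [sub_zero, zero_mul] at h
    exact h.mono_left nhdsWithin_le_nhds
  refine mem_closure_of_tendsto hlim ?_
  have hh : ∀ e, ∀ᶠ ε : ℝ in 𝓝[>] 0,
      (S.height e q.1 < q.2 → S.height e (q.1 - ε) < q.2 - ε * B) ∧
      (¬ S.height e q.1 < q.2 → q.2 - ε * B < S.height e (q.1 - ε)) := by
    intro e
    by_cases h : S.height e q.1 < q.2
    · have hc1 : Continuous fun ε : ℝ => S.height e (q.1 - ε) :=
        (continuous_height e).comp (by fun_prop)
      have hc2 : Continuous fun ε : ℝ => q.2 - ε * B := by fun_prop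
      have := (hc1.tendsto 0).eventually_lt (hc2.tendsto 0) (by simpa using h)
      filter_upwards [this.filter_mono nhdsWithin_le_nhds] with ε hε
      exact ⟨fun _ => hε, fun h' => absurd h h'⟩
    · filter_upwards [self_mem_nhdsWithin] with ε hε
      refine ⟨fun h' => absurd h' h, fun h' => ?_⟩
      have hε' : 0 < ε := hε
      have h1 : S.height e (q.1 - ε) = S.height e q.1 - ε * S.slope e := by unfold height; ring
      have h2 := mul_lt_mul_of_pos_left (hBe e) hε'
      rw [h1]
      linarith [not_lt.1 h']
  filter_upwards [eventually_slab q, eventually_all.2 hh] with ε h1 h2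
  exact ⟨h1, fun e _ => h2 e⟩

/-- A trapezoid is convex, hence connected, and avoids the skeleton, so it lies in one face, and any
of its points reveals which one. -/
theorem locates_of_mem {q z : ℝ × ℝ} {f : Fin S.nf} (hz : z ∈ S.trapezoid q)
    (hf : z ∈ S.face f) : S.Locates q f := by
  refine ⟨f, rfl, ?_⟩
  obtain ⟨z₀, hz₀, hface⟩ := S.face_component f
  have hsub : S.trapezoid q ⊆ S.face f := by
    rw [hface] at hf ⊢
    rw [connectedComponentIn_eq hf]
    exact (convex_trapezoid q).isPreconnected.subset_connectedComponentIn hz (trapezoid_subset q)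
  exact closure_mono hsub (mem_closure_trapezoid q)

/-- If no edge of the slab is below `q`, the trapezoid is unbounded downwards and leaves every
bounded set. -/
theorem locates_outer {q : ℝ × ℝ} (h : ∀ e, S.Spans q e → ¬ S.height e q.1 < q.2) :
    S.Locates q S.outer := by
  obtain ⟨x, hx⟩ := exists_slab (S := S) q
  have hb := S.outer_spec
  rw [← compl_compl (S.face S.outer), ← Bornology.isBounded_def] at hb
  obtain ⟨R, hR⟩ := hb.subset_closedBall 0
  -- Low enough to be below every edge at `x` and outside of the ball that contains the complement
  -- of the outer face.
  set y : ℝ := -(|R| + 1 + ∑ e, |S.height e x|) with hy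
  have hs : 0 ≤ ∑ e, |S.height e x| := Finset.sum_nonneg fun _ _ => abs_nonneg _
  have hout : (x, y) ∈ S.face S.outer := by
    by_contra hcon
    have := hR hcon
    rw [mem_closedBall_zero_iff, Prod.norm_def, max_le_iff] at this
    have h2 := this.2
    simp only [Real.norm_eq_abs] at h2
    have h3 := neg_le_abs y
    have h4 := le_abs_self R
    linarith
  refine locates_of_mem ⟨hx, fun e he => ⟨fun h' => absurd h' (h e he), fun _ => ?_⟩⟩ hout
  have := Finset.single_le_sum (f := fun e => |S.height e x|) (fun _ _ => abs_nonneg _)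
    (Finset.mem_univ e)
  have h5 := neg_abs_le (S.height e x)
  have h6 := abs_nonneg R
  simp only at *
  linarith

/-- By hypothesis `e` is the highest edge of the slab below `q`. A point just above `e` is on the
same side of all other edges as `q` by continuity, hence it is in the trapezoid; its face is named
by the incidence record of `e`. -/
theorem locates_upper {q : ℝ × ℝ} {e : Fin S.ne} (he : S.Spans q e)
    (hq : S.height e q.1 < q.2)
    (h₁ : ∀ e', e' ≠ e → S.Spans q e' → S.height e' q.1 < q.2 → S.Below e' e)
    (h₂ : ∀ e', e' ≠ e → S.Spans q e' → ¬ S.height e' q.1 < q.2 → S.Below e e') :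
    S.Locates q (S.upper e) := by
  obtain ⟨x, hx⟩ := exists_slab (S := S) q
  have hmem := he.mem hx
  have hseg := mem_openSegment_of_height hmem.1 hmem.2
  set nv := S.normal e with hnv
  have hc : Continuous fun t : ℝ => (x, S.height e x) + t • nv := by fun_prop
  have hopen : ∀ᶠ t : ℝ in 𝓝 0, S.Slab q ((x, S.height e x) + t • nv).1 ∧
      ∀ e', e' ≠ e → S.Spans q e' →
        (S.height e' q.1 < q.2 → S.height e' ((x, S.height e x) + t • nv).1 <
          ((x, S.height e x) + t • nv).2) ∧
        (¬ S.height e' q.1 < q.2 → ((x, S.height e x) + t • nv).2 <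
          S.height e' ((x, S.height e x) + t • nv).1) := by
    have hc1 : Continuous fun t : ℝ => ((x, S.height e x) + t • nv).1 := continuous_fst.comp hc
    have hc2 : Continuous fun t : ℝ => ((x, S.height e x) + t • nv).2 := continuous_snd.comp hc
    have s1 : ∀ a, ∀ᶠ t : ℝ in 𝓝 0, (S.vtx a).1 < q.1 →
        (S.vtx a).1 < ((x, S.height e x) + t • nv).1 := by
      intro a
      by_cases ha : (S.vtx a).1 < q.1
      · filter_upwards [(hc1.tendsto 0).eventually_const_lt (by simpa using hx.1 a ha)]
          with t ht _ using ht
      · exact Eventually.of_forall fun t h => absurd h ha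
    have s2 : ∀ a, ∀ᶠ t : ℝ in 𝓝 0, q.1 ≤ (S.vtx a).1 →
        ((x, S.height e x) + t • nv).1 < (S.vtx a).1 := by
      intro a
      by_cases ha : q.1 ≤ (S.vtx a).1
      · filter_upwards [(hc1.tendsto 0).eventually_lt_const (by simpa using hx.2 a ha)]
          with t ht _ using ht
      · exact Eventually.of_forall fun t h => absurd h ha
    have s3 : ∀ e', ∀ᶠ t : ℝ in 𝓝 0, e' ≠ e → S.Spans q e' →
        (S.height e' q.1 < q.2 → S.height e' ((x, S.height e x) + t • nv).1 <
          ((x, S.height e x) + t • nv).2) ∧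
        (¬ S.height e' q.1 < q.2 → ((x, S.height e x) + t • nv).2 <
          S.height e' ((x, S.height e x) + t • nv).1) := by
      intro e'
      by_cases hp : e' ≠ e ∧ S.Spans q e'
      · have hc3 := (continuous_height e').comp hc1
        by_cases hq' : S.height e' q.1 < q.2
        · have hb := (below_iff hp.1 (hp.2.mem hx) hmem).1 (h₁ e' hp.1 hp.2 hq')
          filter_upwards [(hc3.tendsto 0).eventually_lt (hc2.tendsto 0) (by simpa using hb)]
            with t ht _ _
          exact ⟨fun _ => ht, fun h => absurd hq' h⟩
        · have hb := (below_iff hp.1.symm hmem (hp.2.mem hx)).1 (h₂ e' hp.1 hp.2 hq')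
          filter_upwards [(hc2.tendsto 0).eventually_lt (hc3.tendsto 0) (by simpa using hb)]
            with t ht _ _
          exact ⟨fun h => absurd h hq', fun _ => ht⟩
      · exact Eventually.of_forall fun t h h' => absurd ⟨h, h'⟩ hp
    filter_upwards [eventually_all.2 s1, eventually_all.2 s2, eventually_all.2 s3] with t t1 t2 t3
    exact ⟨⟨t1, t2⟩, t3⟩
  -- Along the normal the point rises by `t * nv.2`, while the height of the edge below it changes
  -- by `-(t * nv.2) * slope ^ 2 ≤ 0`.
  have hself : ∀ t : ℝ, 0 < t * nv.2 →
      S.height e ((x, S.height e x) + t • nv).1 < ((x, S.height e x) + t • nv).2 := by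
    intro t ht
    have hlt := he.lt
    have hsl : S.slope e * nv.2 = -nv.1 := by
      rw [hnv]
      unfold slope PlaneGraph.normal
      unfold left right at hlt ⊢
      split_ifs at hlt ⊢
      · have : (S.vtx (S.dst e)).1 - (S.vtx (S.src e)).1 ≠ 0 := by linarith
        field_simp
      · have : (S.vtx (S.src e)).1 - (S.vtx (S.dst e)).1 ≠ 0 := by linarith
        field_simp
        ring
    have h1 : ((x, S.height e x) + t • nv).1 = x + t * nv.1 := by simp
    have h2 : ((x, S.height e x) + t • nv).2 = S.height e x + t * nv.2 := by simp
    have h3 : S.height e (x + t * nv.1) = S.height e x + t * nv.1 * S.slope e := by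
      unfold height; ring
    rw [h1, h2, h3]
    have h4 : nv.1 = -(S.slope e * nv.2) := by linarith
    have h5 : t * nv.1 * S.slope e = -(t * nv.2 * S.slope e ^ 2) := by rw [h4]; ring
    have h6 : 0 ≤ t * nv.2 * S.slope e ^ 2 := mul_nonneg ht.le (sq_nonneg _)
    linarith
  have htrap : ∀ t : ℝ, 0 < t * nv.2 → (S.Slab q ((x, S.height e x) + t • nv).1 ∧
      ∀ e', e' ≠ e → S.Spans q e' →
        (S.height e' q.1 < q.2 → S.height e' ((x, S.height e x) + t • nv).1 <
          ((x, S.height e x) + t • nv).2) ∧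
        (¬ S.height e' q.1 < q.2 → ((x, S.height e x) + t • nv).2 <
          S.height e' ((x, S.height e x) + t • nv).1)) →
      (x, S.height e x) + t • nv ∈ S.trapezoid q := by
    intro t ht h
    refine ⟨h.1, fun e' he' => ?_⟩
    by_cases hee : e' = e
    · subst hee
      exact ⟨fun _ => hself t ht, fun h' => absurd hq h'⟩
    · exact h.2 e' hee he'
  unfold upper
  split_ifs with c
  · have hn2 : 0 < nv.2 := by rw [hnv]; simp only [PlaneGraph.normal]; linarith
    obtain ⟨t, h1, h2, h3⟩ := ((S.leftFace_spec e _ hseg).and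
      ((hopen.filter_mono nhdsWithin_le_nhds).and self_mem_nhdsWithin)).exists
    exact locates_of_mem (htrap t (mul_pos h3 hn2) h2) h1
  -- An edge directed to the left has its upper face on its right, which is reached with negative
  -- `t`.
  · have hlt := he.lt
    unfold left right at hlt
    rw [if_neg c, if_neg c] at hlt
    have hn2 : nv.2 < 0 := by rw [hnv]; simp only [PlaneGraph.normal]; linarith
    obtain ⟨t, h1, h2, h3⟩ := ((S.rightFace_spec e _ hseg).and
      ((hopen.filter_mono nhdsWithin_le_nhds).and self_mem_nhdsWithin)).exists
    exact locates_of_mem (htrap t (mul_pos_of_neg_of_neg h3 hn2) h2) h1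

/-- This makes the edge tests of a row a sorted sequence, as a search requires. The weak order of
heights at `q.1` is sufficient. -/
theorem above_of_below {q : ℝ × ℝ} {e e' : Fin S.ne} (hne : e ≠ e') (he : S.Spans q e)
    (he' : S.Spans q e') (hb : S.Below e e') (h : S.height e' q.1 < q.2) :
    S.height e q.1 < q.2 := by
  obtain ⟨x, hx⟩ := exists_slab (S := S) q
  have := (below_iff hne (he.mem hx) (he'.mem hx)).1 hb
  exact (height_le_of_lt hne (he.mem hx) (he'.mem hx) ⟨he.1.le, he.2⟩ ⟨he'.1.le, he'.2⟩
    this).trans_lt h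

end PlanarSubdivision

/-! ### Majority votes -/

/-- The evaluations of processor `i` at the times `τ 0, …, τ (R - 1)`. -/
def evaluations (τ : ℕ → ℕ) (i R : ℕ) : Finset (ℕ × ℕ) := (Finset.range R).image fun l => (τ l, i)

theorem card_evaluations {τ : ℕ → ℕ} (hτ : Function.Injective τ) (i R : ℕ) :
    (evaluations τ i R).card = R := by
  rw [evaluations, Finset.card_image_of_injective, Finset.card_range]
  intro a b h
  exact hτ (Prod.ext_iff.1 h).1

/-- If fewer than half of the evaluations err, the correct answers have a strict majority. The
hypothesis concerns the noise only and not the query, so tests that are chosen adaptively create no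
dependence. -/
theorem Machine.majority_iff (M : Machine) {τ : ℕ → ℕ} (hτ : Function.Injective τ) {i R : ℕ}
    (h : ¬ BadBlock (evaluations τ i R) M.err) (x : Query) :
    R < 2 * ∑ l ∈ Finset.range R, M.answer (τ l) i x ↔ x.Holds M.pts := by
  classical
  have hcard : ((evaluations τ i R).filter fun k => M.err k = true).card =
      ((Finset.range R).filter fun l => M.err (τ l, i) = true).card := by
    rw [evaluations, Finset.filter_image, Finset.card_image_of_injective]
    intro a b h
    exact hτ (Prod.ext_iff.1 h).1
  unfold BadBlock at h
  rw [card_evaluations hτ, hcard] at h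
  have hsplit := Finset.card_filter_add_card_filter_not (s := Finset.range R)
    (fun l => M.err (τ l, i) = true)
  rw [Finset.card_range] at hsplit
  by_cases hx : x.Holds M.pts
  · have : ∑ l ∈ Finset.range R, M.answer (τ l) i x =
        ((Finset.range R).filter fun l => ¬ M.err (τ l, i) = true).card := by
      rw [Finset.card_filter]
      exact Finset.sum_congr rfl fun l _ => by simp [Machine.answer, hx]
    simp only [hx, iff_true]
    omega
  · have : ∑ l ∈ Finset.range R, M.answer (τ l) i x =
        ((Finset.range R).filter fun l => M.err (τ l, i) = true).card := by
      rw [Finset.card_filter]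
      exact Finset.sum_congr rfl fun l _ => by simp [Machine.answer, hx]
    simp only [hx, iff_false]
    omega

theorem Machine.answer_le_one (M : Machine) (t i : ℕ) (x : Query) : M.answer t i x ≤ 1 := by
  unfold Machine.answer; split_ifs <;> omega

theorem Machine.sum_answer_le (M : Machine) (τ : ℕ → ℕ) (i R : ℕ) (x : Query) :
    ∑ l ∈ Finset.range R, M.answer (τ l) i x ≤ R := by
  calc _ ≤ ∑ _l ∈ Finset.range R, 1 := Finset.sum_le_sum fun l _ => M.answer_le_one _ _ _
    _ = R := by simp

namespace Machine

variable {M : Machine} {V z B : ℕ}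

theorem Reaches.then {ctx : ℕ → Set Query} {P P' : Prog} {s : State} {k k' o : ℕ}
    {Q R : (ℕ → ℕ) → Prop} (h : M.Reaches B ctx P s k 0 Q)
    (h' : ∀ s', s'.span = s.span + k → Q s'.mem → M.Reaches B ctx P' s' k' o R) :
    M.Reaches B ctx (.seq P P') s (k + k') o R := by
  simpa using h.seq h'

theorem Reaches.of_eq {ctx : ℕ → Set Query} {P : Prog} {s : State} {k k' o o' : ℕ}
    {Q : (ℕ → ℕ) → Prop} (h : M.Reaches B ctx P s k o Q) (hk : k = k') (ho : o = o') :
    M.Reaches B ctx P s k' o' Q := hk ▸ ho ▸ h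

theorem Roomy.assign (hM : M.Roomy V z) (hB : B ≤ V)
    (hB1 : 1 ≤ B) {ctx : ℕ → Set Query} {a : ℕ} {e : Expr} {s : State} (hs : Bdd V s.mem)
    (hw : a ≤ z ∧ 1 ≤ z ∧ e.width ≤ z) (ha : a ∈ M.cells) (hv : e.ideal s.mem 0 0 ≤ V) :
    M.Reaches B ctx (Prog.set a e) s 1 0
      (fun m => Bdd V m ∧ m = Function.update s.mem a (e.ideal s.mem 0 0)) :=
  hM.set hB hB1 hs hw ha hv fun h => ⟨h, rfl⟩

end Machine

theorem Expr.ideal_ite_less (mem : ℕ → ℕ) (i j : ℕ) (a b c d : Expr) :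
    (Expr.ite (.less a b) c d).ideal mem i j =
      if a.ideal mem i j < b.ideal mem i j then c.ideal mem i j else d.ideal mem i j := by
  rw [Expr.ideal_ite, Expr.ideal_less]; split_ifs <;> simp_all

/-! ### The noisy binary search -/

/-- `R` repetitions of a program. -/
def Prog.rep (P : Prog) : ℕ → Prog
  | 0 => .set 19 0
  | R + 1 => .seq (P.rep R) P

/-- The position in the sequence of the test that compares `y` with the target. -/
def searchIndex (y : Expr) : Expr := (y - .load 5 - 1) / (2 * .load 5)

/-- Compare `y` with the target by a majority vote over `R` evaluations. -/
def compareTarget (T : Expr → Test) (R : ℕ) (y : Expr) (b : ℕ) : Prog :=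
  .seq (.set 6 (.ite (.less (.load 5) y)
    (.ite (.less (searchIndex y) (.load 24)) (searchIndex y) (.load 24 - 1)) 0))
  (.seq (.set 8 0)
  (.seq ((Prog.seq (.call 1 1 7 (T (.load 6))) (.set 8 (.load 8 + .load 7))).rep R)
  (.set b (.ite (.less (.load 5) y)
    (.ite (.less (searchIndex y) (.load 24)) (.less (.const R) (2 * .load 8)) 0) 1))))

/-- The times at which the comparison that starts at time `t` evaluates primitives. -/
def compareTimes (t : ℕ) (l : ℕ) : ℕ := t + 3 + 2 * l

theorem compareTimes_injective (t : ℕ) : Function.Injective (compareTimes t) := by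
  intro a b h; unfold compareTimes at h; omega

/-- What is fixed during a search in the sequence `q 0, …, q (m - 1)` of tests, of which the first
`t` hold. -/
structure SearchSetting (M : Machine) (V z B m t : ℕ) (T : Expr → Test) (q : ℕ → Query)
    (D : ℕ → ℕ) (v : ℕ) : Prop where
  roomy : M.Roomy V z
  le : B ≤ V
  one_le : 1 ≤ B
  cells : ∀ a < 20, a ∈ M.cells
  holds : ∀ j < m, (q j).Holds M.pts ↔ j < t
  t_le : t ≤ m
  pos : 0 < m
  side : D 24 = m
  test : ∀ mem : ℕ → ℕ, (∀ a, 20 ≤ a → mem a = D a) → mem 12 = v →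
    (T (.load 6)).ideal mem 0 0 = q (mem 6)
  width : (T (.load 6)).width ≤ z
  width_idx : (T .idx).width ≤ z
  test_idx : ∀ mem : ℕ → ℕ, (∀ a, 20 ≤ a → mem a = D a) → mem 12 = v →
    ∀ j < m, (T .idx).ideal mem 0 j = q j

namespace SearchSetting

variable {M : Machine} {V z B m t : ℕ} {T : Expr → Test} {q : ℕ → Query} {D : ℕ → ℕ} {v : ℕ}

theorem rep_call (h : SearchSetting M V z B m t T q D v) (hz : 100 ≤ z) {ctx : ℕ → Set Query}
    (hctx : ∀ j < m, q j ∈ ctx 0) {s : State} (hs : Bdd V s.mem)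
    (hD : ∀ a, 20 ≤ a → s.mem a = D a) (hv : s.mem 12 = v) (h8 : s.mem 8 = 0)
    (h6 : s.mem 6 < m) (R : ℕ) (hR : R ≤ V) :
    M.Reaches B ctx
      ((Prog.seq (.call 1 1 7 (T (.load 6))) (.set 8 (.load 8 + .load 7))).rep R) s (2 * R + 1) 0
      (fun mem => Bdd V mem ∧
        mem 8 = ∑ l ∈ Finset.range R, M.answer (s.span + 1 + 2 * l) 0 (q (s.mem 6)) ∧
        ∀ a, a ≠ 7 → a ≠ 8 → a ≠ 19 → mem a = s.mem a) := by
  induction R with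
  | zero =>
    refine h.roomy.set h.le h.one_le hs (by simp; omega) (h.cells _ (by norm_num)) (by simp)
      fun hb => ⟨hb, ?_, ?_⟩
    · simp [h8]
    · intro a _ _ h19; simp [h19]
  | succ R ih =>
    refine ((ih (by omega)).then (k' := 2) fun s₁ hs₁ ⟨b₁, c₁, f₁⟩ => ?_).of_eq (by ring) rfl
    have e6 : s₁.mem 6 = s.mem 6 := f₁ 6 (by norm_num) (by norm_num) (by norm_num)
    have eT : (T (.load 6)).ideal s₁.mem 0 0 = q (s.mem 6) := by
      rw [h.test s₁.mem (fun a ha => by rw [f₁ a (by omega) (by omega) (by omega), hD a ha])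
        (by rw [f₁ 12 (by norm_num) (by norm_num) (by norm_num), hv]), e6]
    refine Machine.Reaches.then (k := 1) (k' := 1)
      (Q := fun mem => Bdd V mem ∧ mem 7 = M.answer s₁.span 0 (q (s.mem 6)) ∧
        ∀ a, a ≠ 7 → mem a = s₁.mem a) ?_ fun s₂ _ ⟨b₂, c₂, f₂⟩ => ?_
    · refine h.roomy.call h.le b₁ (n := 1) ⟨by simp; omega, by omega, by simp; omega, h.width⟩
        (by simp) h.one_le ?_ ?_ ?_ ?_
      · intro i hi
        obtain rfl : i = 0 := by omega
        rw [eT]; exact hctx _ h6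
      · intro i _; simpa using h.cells 7 (by norm_num)
      · intro i hi k hk _; omega
      · intro mem' hb h1 h2
        refine ⟨hb, ?_, ?_⟩
        · have := h1 0 (by norm_num)
          rw [eT] at this
          simpa using this
        · intro a ha
          exact h2 a fun i _ => by simpa using Ne.symm ha
    · have e8 : s₂.mem 8 + s₂.mem 7 =
          ∑ l ∈ Finset.range (R + 1), M.answer (s.span + 1 + 2 * l) 0 (q (s.mem 6)) := by
        have e : s₁.span = s.span + 1 + 2 * R := by rw [hs₁]; ring
        rw [Finset.sum_range_succ, c₂, f₂ 8 (by norm_num), c₁, e]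
      refine h.roomy.set h.le h.one_le b₂ (by simp; omega) (h.cells _ (by norm_num)) ?_
        fun hb => ⟨hb, ?_, ?_⟩
      · simp only [Expr.ideal_add, Expr.ideal_load, Expr.ideal_ofNat]
        rw [e8]
        exact (M.sum_answer_le (fun l => s.span + 1 + 2 * l) 0 (R + 1) _).trans hR
      · simpa using e8
      · intro a h7 h8 h19
        rw [Function.update_of_ne h8, f₂ a h7, f₁ a h7 h8 h19]

theorem compareTarget (h : SearchSetting M V z B m t T q D v) {R : ℕ} (hz : R + 200 ≤ z)
    (hR : R ≤ V)
    {ctx : ℕ → Set Query} (hctx : ∀ j < m, q j ∈ ctx 0) {s : State} (hs : Bdd V s.mem)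
    (hD : ∀ a, 20 ≤ a → s.mem a = D a) (hv : s.mem 12 = v) {H : ℕ} (hH : s.mem 5 = H)
    (hH0 : 0 < H) {y : Expr} {Y b : ℕ} (hyw : y.width ≤ 20)
    (hy : ∀ mem : ℕ → ℕ, mem 2 = s.mem 2 → mem 3 = s.mem 3 → y.ideal mem 0 0 = Y)
    (hb : 9 ≤ b ∧ b ≤ 11) :
    M.Reaches B ctx (_root_.compareTarget T R y b) s (2 * R + 4) 0 (fun mem =>
      Bdd V mem ∧ mem b ≤ 1 ∧
      (¬ BadBlock (evaluations (compareTimes s.span) 0 R) M.err →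
        (mem b = 1 ↔ Y ≤ t * (2 * H) + H)) ∧
      ∀ a, a ≠ 6 → a ≠ 7 → a ≠ 8 → a ≠ 19 → a ≠ b → mem a = s.mem a) := by
  have hV2 := h.roomy.two_le
  have hm := h.pos
  have hidx : ∀ mem : ℕ → ℕ, mem 2 = s.mem 2 → mem 3 = s.mem 3 → mem 5 = s.mem 5 →
      (searchIndex y).ideal mem 0 0 = (Y - H - 1) / (2 * H) := by
    intro mem h2 h3 h5
    simp [searchIndex, hy mem h2 h3, h5, hH]
  have hiw : (searchIndex y).width ≤ 39 := by simp [searchIndex]; omega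
  have hmV : m ≤ V := by rw [← h.side, ← hD 24 (by norm_num)]; exact hs _
  have h24 : s.mem 24 = m := by rw [hD 24 (by norm_num), h.side]
  -- Comparisons that fall outside of the sequence have known outcomes. An admissible test, at the
  -- clipped index, is evaluated all the same, so that each comparison takes the same time.
  set ix := if H < Y then (if (Y - H - 1) / (2 * H) < m then (Y - H - 1) / (2 * H) else m - 1)
    else 0 with hix
  have hixm : ix < m := by rw [hix]; split_ifs <;> omega
  have e6 : (Expr.ite (.less (.load 5) y) (.ite (.less (searchIndex y) (.load 24)) (searchIndex y)
      (.load 24 - 1)) 0).ideal s.mem 0 0 = ix := by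
    simp only [Expr.ideal_ite_less, Expr.ideal_load, Expr.ideal_ofNat,
      Expr.ideal_sub, hidx s.mem rfl rfl rfl, hy s.mem rfl rfl, hH, h24, hix]
  refine Machine.Reaches.of_eq (k := 1 + (1 + ((2 * R + 1) + 1))) (o := 0) ?_ (by ring) rfl
  refine (h.roomy.assign h.le h.one_le hs (by simp; omega) (h.cells 6 (by norm_num))
    (by rw [e6]; omega)).then fun s₁ hs₁ ⟨b₁, e₁⟩ => ?_
  rw [e6] at e₁
  refine (h.roomy.assign h.le h.one_le b₁ (by simp; omega) (h.cells 8 (by norm_num))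
    (by simp)).then fun s₂ hs₂ ⟨b₂, e₂⟩ => ?_
  have f₂ : ∀ a, a ≠ 6 → a ≠ 8 → s₂.mem a = s.mem a := by
    intro a h6 h8; rw [e₂, Function.update_of_ne h8, e₁, Function.update_of_ne h6]
  have g6 : s₂.mem 6 = ix := by rw [e₂, Function.update_of_ne (by norm_num), e₁]; simp
  refine (h.rep_call (by omega) hctx b₂
    (fun a ha => by rw [f₂ a (by omega) (by omega), hD a ha])
    (by rw [f₂ 12 (by norm_num) (by norm_num), hv]) (by rw [e₂]; simp)
    (by rw [g6]; exact hixm) R hR).then fun s₃ hs₃ ⟨b₃, c₃, f₃⟩ => ?_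
  have f : ∀ a, a ≠ 6 → a ≠ 7 → a ≠ 8 → a ≠ 19 → s₃.mem a = s.mem a :=
    fun a h6 h7 h8 h19 => by rw [f₃ a h7 h8 h19, f₂ a h6 h8]
  have g2 := f 2 (by norm_num) (by norm_num) (by norm_num) (by norm_num)
  have g3 := f 3 (by norm_num) (by norm_num) (by norm_num) (by norm_num)
  have g5 := f 5 (by norm_num) (by norm_num) (by norm_num) (by norm_num)
  have g24 := f 24 (by norm_num) (by norm_num) (by norm_num) (by norm_num)
  rw [g6] at c₃
  -- Two assignments and the initialisation of the repetition precede the first evaluation.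
  have hspan : s₂.span + 1 = s.span + 3 := by omega
  rw [hspan] at c₃
  have hval : (Expr.ite (.less (.load 5) y) (.ite (.less (searchIndex y) (.load 24))
      (.less (.const R) (2 * .load 8)) 0) 1).ideal s₃.mem 0 0 =
      if H < Y then (if (Y - H - 1) / (2 * H) < m then
        (if R < 2 * s₃.mem 8 then 1 else 0) else 0) else 1 := by
    simp only [Expr.ideal_ite_less, Expr.ideal_less, Expr.ideal_load, Expr.ideal_ofNat,
      Expr.ideal_mul, Expr.ideal_const, hidx s₃.mem g2 g3 g5, hy s₃.mem g2 g3, g5, g24, hH, h24]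
    rfl
  have hle : (Expr.ite (.less (.load 5) y) (.ite (.less (searchIndex y) (.load 24))
      (.less (.const R) (2 * .load 8)) 0) 1).ideal s₃.mem 0 0 ≤ 1 := by
    rw [hval]; split_ifs <;> omega
  refine h.roomy.set h.le h.one_le b₃ (by simp; omega) (h.cells b (by omega)) (by omega)
    fun hb' => ⟨hb', by simpa using hle, fun hgood => ?_, ?_⟩
  · rw [Function.update_self, hval, le_target_iff hH0]
    have hmaj := M.majority_iff (compareTimes_injective s.span) hgood (q ix)
    unfold compareTimes at hmaj
    rw [← c₃, h.holds ix hixm] at hmaj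
    have ht := h.t_le
    rw [hix] at hmaj
    clear_value ix
    clear hval hle e6 hy hidx
    split_ifs at hmaj ⊢ <;> simp only [false_iff, true_iff] <;> omega
  · intro a h6 h7 h8 h19 hab
    rw [Function.update_of_ne hab, f a h6 h7 h8 h19]

end SearchSetting

/-- One step of the walk. -/
def searchRound (T : Expr → Test) (R : ℕ) : Prog :=
  .seq (compareTarget T R (.load 3) 9)
  (.seq (compareTarget T R (.load 3 + .load 2) 10)
  (.seq (compareTarget T R (.load 3 + .load 2 / 2) 11)
  (.seq (.set 3 (.ite (.load 9)
      (.ite (.load 10)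
        (.ite (.less (.load 2) (.load 4)) (.load 3 - .load 3 % (2 * .load 2)) (.load 3))
        (.ite (.load 11) (.load 3 + .load 2 / 2) (.load 3)))
      (.ite (.less (.load 2) (.load 4)) (.load 3 - .load 3 % (2 * .load 2)) (.load 3))))
    (.set 2 (.ite (.load 9)
      (.ite (.load 10) (.ite (.less (.load 2) (.load 4)) (2 * .load 2) (.load 2)) (.load 2 / 2))
      (.ite (.less (.load 2) (.load 4)) (2 * .load 2) (.load 2)))))))

/-- The evaluations of the `b`-th comparison of a search whose first round starts at time `t₀`. -/
def searchBlocks (t₀ R b : ℕ) : Finset (ℕ × ℕ) :=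
  evaluations (compareTimes (t₀ + b / 3 * (6 * R + 16) + b % 3 * (2 * R + 4))) 0 R

theorem card_searchBlocks (t₀ R b : ℕ) : (searchBlocks t₀ R b).card = R :=
  card_evaluations (compareTimes_injective _) _ _

/-- An evaluation time has the round, the comparison and the repetition as its digits in a mixed
radix system. The radices are `2 * R + 4`, the duration of a comparison, and `6 * R + 16`, that of a
round with two final assignments and two steps of loop control. -/
theorem disjoint_searchBlocks (t₀ R : ℕ) :
    Pairwise fun a b => Disjoint (searchBlocks t₀ R a) (searchBlocks t₀ R b) := by
  intro a b hab
  rw [Finset.disjoint_left]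
  intro x hx hx'
  simp only [searchBlocks, evaluations, Finset.mem_image, Finset.mem_range, compareTimes] at hx hx'
  obtain ⟨l, hl, rfl⟩ := hx
  obtain ⟨l', hl', h⟩ := hx'
  have h := (Prod.ext_iff.1 h).1
  simp only at h
  have hu : ∀ c l, l < R → c % 3 * (2 * R + 4) + 2 * l < 6 * R + 16 := by
    intro c l hl
    have : c % 3 ≤ 2 := by omega
    nlinarith
  have h1 := hu a l hl
  have h2 := hu b l' hl'
  have key : ∀ {x y u v d : ℕ}, u < d → v < d → x * d + u = y * d + v → x = y ∧ u = v := by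
    intro x y u v d hu hv h
    have hd : 0 < d := by omega
    have e1 : (x * d + u) / d = x := by
      rw [mul_comm, Nat.mul_add_div hd, Nat.div_eq_of_lt hu, add_zero]
    have e2 : (y * d + v) / d = y := by
      rw [mul_comm, Nat.mul_add_div hd, Nat.div_eq_of_lt hv, add_zero]
    have : x = y := by rw [← e1, ← e2, h]
    subst this
    omega
  have k1 := key h1 h2 (x := a / 3) (y := b / 3) (by omega)
  have k2 := key (x := a % 3) (y := b % 3) (u := 2 * l) (v := 2 * l') (d := 2 * R + 4)
    (by omega) (by omega) k1.2
  exact hab (by omega)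

theorem badCount_mono (F : ℕ → Finset (ℕ × ℕ)) (ω : Noise) {a b : ℕ} (h : a ≤ b) :
    badCount F ω a ≤ badCount F ω b := by
  induction b, h using Nat.le_induction with
  | base => exact le_rfl
  | succ b _ ih =>
    by_cases hb : BadBlock (F b) ω
    · rw [badCount_succ_of_bad hb]; omega
    · rw [badCount_succ_of_not hb]; exact ih

/-- The memory after `j` rounds of a search. -/
def SearchInv (M : Machine) (V N H t t₀ R : ℕ) (D : ℕ → ℕ) (v j : ℕ) (mem : ℕ → ℕ) : Prop :=
  Bdd V mem ∧ (∀ a, 20 ≤ a → mem a = D a) ∧ mem 12 = v ∧ mem 4 = 2 ^ N ∧ mem 5 = H ∧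
    ∃ bad ≤ badCount (searchBlocks t₀ R) M.err (3 * j),
      WalkInv N (t * (2 * H) + H) j bad (mem 3) (mem 2)

namespace SearchSetting

variable {M : Machine} {V z B m t : ℕ} {T : Expr → Test} {q : ℕ → Query} {D : ℕ → ℕ} {v : ℕ}

/-- A round with three good votes is a correct step of the walk. Any other round is charged to one
of its bad blocks, however wrong its answers are. -/
theorem searchRound (h : SearchSetting M V z B m t T q D v) {R N H t₀ j : ℕ} (hz : R + 200 ≤ z)
    (hR : R ≤ V) (hV : 2 ^ (N + 2) ≤ V)
    {ctx : ℕ → Set Query} (hctx : ∀ j < m, q j ∈ ctx 0) (hH0 : 0 < H)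
    (hT : t * (2 * H) + H < 2 ^ N) (hj : j < N) {s : State}
    (hspan : s.span = t₀ + j * (6 * R + 16))
    (hI : SearchInv M V N H t t₀ R D v j s.mem) :
    M.Reaches B ctx (_root_.searchRound T R) s (6 * R + 14) 0 (fun mem =>
      SearchInv M V N H t t₀ R D v (j + 1) mem ∧ mem 1 = s.mem 1) := by
  obtain ⟨hs, hD, hv, h4, h5, bad, hbad, hwalk⟩ := hI
  have hbd := hwalk.bounds hT
  have hpow : 2 ^ (N + 2) = 4 * 2 ^ N := by ring
  set w := s.mem 2 with hw
  set lo := s.mem 3 with hlo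
  refine Machine.Reaches.of_eq (k := (2 * R + 4) + ((2 * R + 4) + ((2 * R + 4) + (1 + 1))))
    (o := 0) ?_ (by ring) rfl
  refine (h.compareTarget hz hR hctx hs hD hv h5 hH0 (Y := lo) (by simp)
    (fun mem _ h3 => by simpa using h3) (by norm_num)).then
    fun s₁ hs₁ ⟨b₁, l₁, g₁, f₁⟩ => ?_
  refine (h.compareTarget hz hR hctx b₁
    (fun a ha => by rw [f₁ a (by omega) (by omega) (by omega) (by omega) (by omega), hD a ha])
    (by rw [f₁ 12 (by norm_num) (by norm_num) (by norm_num) (by norm_num) (by norm_num), hv])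
    (by rw [f₁ 5 (by norm_num) (by norm_num) (by norm_num) (by norm_num) (by norm_num), h5]) hH0
    (Y := lo + w) (by simp)
    (fun mem h2 h3 => by
      rw [f₁ 2 (by norm_num) (by norm_num) (by norm_num) (by norm_num) (by norm_num)] at h2
      rw [f₁ 3 (by norm_num) (by norm_num) (by norm_num) (by norm_num) (by norm_num)] at h3
      simp [h2, h3, hw, hlo]) (by norm_num)).then
    fun s₂ hs₂ ⟨b₂, l₂, g₂, f₂⟩ => ?_
  have k₂ : ∀ a, a ≠ 6 → a ≠ 7 → a ≠ 8 → a ≠ 19 → a ≠ 9 → a ≠ 10 → s₂.mem a = s.mem a :=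
    fun a h6 h7 h8 h19 h9 h10 => by rw [f₂ a h6 h7 h8 h19 h10, f₁ a h6 h7 h8 h19 h9]
  refine (h.compareTarget hz hR hctx b₂
    (fun a ha => by
      rw [k₂ a (by omega) (by omega) (by omega) (by omega) (by omega) (by omega), hD a ha])
    (by rw [k₂ 12 (by norm_num) (by norm_num) (by norm_num) (by norm_num) (by norm_num)
      (by norm_num), hv])
    (by rw [k₂ 5 (by norm_num) (by norm_num) (by norm_num) (by norm_num) (by norm_num)
      (by norm_num), h5]) hH0
    (Y := lo + w / 2) (by simp)
    (fun mem h2 h3 => by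
      rw [k₂ 2 (by norm_num) (by norm_num) (by norm_num) (by norm_num) (by norm_num)
        (by norm_num)] at h2
      rw [k₂ 3 (by norm_num) (by norm_num) (by norm_num) (by norm_num) (by norm_num)
        (by norm_num)] at h3
      simp [h2, h3, hw, hlo]) (by norm_num)).then
    fun s₃ hs₃ ⟨b₃, l₃, g₃, f₃⟩ => ?_
  have k₃ : ∀ a, a ≠ 6 → a ≠ 7 → a ≠ 8 → a ≠ 19 → a ≠ 9 → a ≠ 10 → a ≠ 11 →
      s₃.mem a = s.mem a :=
    fun a h6 h7 h8 h19 h9 h10 h11 => by rw [f₃ a h6 h7 h8 h19 h11, k₂ a h6 h7 h8 h19 h9 h10]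
  have e9 : s₃.mem 9 = s₁.mem 9 := by
    rw [f₃ 9 (by norm_num) (by norm_num) (by norm_num) (by norm_num) (by norm_num),
      f₂ 9 (by norm_num) (by norm_num) (by norm_num) (by norm_num) (by norm_num)]
  have e10 : s₃.mem 10 = s₂.mem 10 :=
    f₃ 10 (by norm_num) (by norm_num) (by norm_num) (by norm_num) (by norm_num)
  rw [← e9] at g₁ l₁
  rw [← e10] at g₂ l₂
  have c2 : s₃.mem 2 = w := k₃ 2 (by norm_num) (by norm_num) (by norm_num) (by norm_num)
    (by norm_num) (by norm_num) (by norm_num)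
  have c3 : s₃.mem 3 = lo := k₃ 3 (by norm_num) (by norm_num) (by norm_num) (by norm_num)
    (by norm_num) (by norm_num) (by norm_num)
  have c4 : s₃.mem 4 = 2 ^ N := by
    rw [k₃ 4 (by norm_num) (by norm_num) (by norm_num) (by norm_num)
      (by norm_num) (by norm_num) (by norm_num), h4]
  have hlo' : (Expr.ite (.load 9)
      (.ite (.load 10)
        (.ite (.less (.load 2) (.load 4)) (.load 3 - .load 3 % (2 * .load 2)) (.load 3))
        (.ite (.load 11) (.load 3 + .load 2 / 2) (.load 3)))
      (.ite (.less (.load 2) (.load 4)) (.load 3 - .load 3 % (2 * .load 2))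
        (.load 3))).ideal s₃.mem 0 0 =
      walkLo (2 ^ N) lo w (decide (s₃.mem 9 = 1)) (decide (s₃.mem 10 = 1))
        (decide (s₃.mem 11 = 1)) := by
    simp only [Expr.ideal_ite, Expr.ideal_less, Expr.ideal_load, Expr.ideal_ofNat, Expr.ideal_add, Expr.ideal_div,
      Expr.ideal_sub, Expr.ideal_mod, Expr.ideal_mul, c2, c3, c4, walkLo]
    generalize s₃.mem 9 = x at *
    generalize s₃.mem 10 = y at *
    generalize s₃.mem 11 = u at *
    interval_cases x <;> interval_cases y <;> interval_cases u <;> simp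
  have hw' : ∀ mem : ℕ → ℕ, mem 9 = s₃.mem 9 → mem 10 = s₃.mem 10 → mem 2 = w →
      mem 4 = 2 ^ N → (Expr.ite (.load 9)
      (.ite (.load 10) (.ite (.less (.load 2) (.load 4)) (2 * .load 2) (.load 2)) (.load 2 / 2))
      (.ite (.less (.load 2) (.load 4)) (2 * .load 2) (.load 2))).ideal mem 0 0 =
      walkWidth (2 ^ N) w (decide (s₃.mem 9 = 1)) (decide (s₃.mem 10 = 1)) := by
    intro mem m9 m10 m2 m4
    simp only [Expr.ideal_ite, Expr.ideal_less, Expr.ideal_load, Expr.ideal_ofNat, Expr.ideal_div,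
      Expr.ideal_mul, walkWidth, m9, m10, m2, m4]
    generalize s₃.mem 9 = x at *
    generalize s₃.mem 10 = y at *
    interval_cases x <;> interval_cases y <;> simp
  have hnew : ∃ bad' ≤ badCount (searchBlocks t₀ R) M.err (3 * (j + 1)),
      WalkInv N (t * (2 * H) + H) (j + 1) bad'
        (walkLo (2 ^ N) lo w (decide (s₃.mem 9 = 1)) (decide (s₃.mem 10 = 1))
          (decide (s₃.mem 11 = 1)))
        (walkWidth (2 ^ N) w (decide (s₃.mem 9 = 1)) (decide (s₃.mem 10 = 1))) := by
    have hb : ∀ i < 3, searchBlocks t₀ R (3 * j + i) =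
        evaluations (compareTimes (s.span + i * (2 * R + 4))) 0 R := by
      intro i hi
      unfold searchBlocks
      rw [show (3 * j + i) / 3 = j by omega, show (3 * j + i) % 3 = i by omega, hspan]
    by_cases hg : ∀ i < 3, ¬ BadBlock (searchBlocks t₀ R (3 * j + i)) M.err
    · refine ⟨bad, hbad.trans (badCount_mono _ _ (by omega)), hwalk.step_good hj ?_ ?_ ?_⟩
      · rw [decide_eq_true_iff]
        exact g₁ (by have := hg 0 (by norm_num); rw [hb 0 (by norm_num)] at this; simpa using this)
      · rw [decide_eq_true_iff]
        exact g₂ (by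
          have := hg 1 (by norm_num); rw [hb 1 (by norm_num)] at this; rw [hs₁]; simpa using this)
      · rw [decide_eq_true_iff]
        refine g₃ ?_
        have := hg 2 (by norm_num)
        rw [hb 2 (by norm_num)] at this
        rwa [hs₂, hs₁, add_assoc, ← two_mul]
    · push Not at hg
      obtain ⟨i, hi, hbi⟩ := hg
      refine ⟨bad + 1, ?_, hwalk.step_any hj _ _ _⟩
      have h1 := badCount_succ_of_bad hbi
      have h2 := badCount_mono (searchBlocks t₀ R) M.err (show 3 * j ≤ 3 * j + i by omega)
      have h3 := badCount_mono (searchBlocks t₀ R) M.err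
        (show 3 * j + i + 1 ≤ 3 * (j + 1) by omega)
      omega
  have hnb := (hnew.choose_spec.2).bounds hT
  refine (h.roomy.assign h.le h.one_le b₃ (by simp; omega) (h.cells 3 (by norm_num))
    (by rw [hlo']; omega)).then fun s₄ _ ⟨b₄, e₄⟩ => ?_
  rw [hlo'] at e₄
  replace hw' := hw' s₄.mem (by rw [e₄, Function.update_of_ne (by norm_num)])
    (by rw [e₄, Function.update_of_ne (by norm_num)])
    (by rw [e₄, Function.update_of_ne (by norm_num), c2])
    (by rw [e₄, Function.update_of_ne (by norm_num), c4])
  refine h.roomy.set h.le h.one_le b₄ (by simp; omega) (h.cells 2 (by norm_num))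
    (by rw [hw']; omega) fun b₅ => ?_
  rw [hw'] at b₅ ⊢
  have k₅ : ∀ a, a ≠ 6 → a ≠ 7 → a ≠ 8 → a ≠ 19 → a ≠ 9 → a ≠ 10 → a ≠ 11 → a ≠ 2 → a ≠ 3 →
      Function.update s₄.mem 2 (walkWidth (2 ^ N) w (decide (s₃.mem 9 = 1))
        (decide (s₃.mem 10 = 1))) a = s.mem a :=
    fun a h6 h7 h8 h19 h9 h10 h11 h2 h3 => by
      rw [Function.update_of_ne h2, e₄, Function.update_of_ne h3, k₃ a h6 h7 h8 h19 h9 h10 h11]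
  refine ⟨⟨b₅, fun a ha => ?_, ?_, ?_, ?_, ?_⟩, ?_⟩
  · rw [k₅ a (by omega) (by omega) (by omega) (by omega) (by omega) (by omega) (by omega)
      (by omega) (by omega), hD a ha]
  · rw [k₅ 12 (by norm_num) (by norm_num) (by norm_num) (by norm_num) (by norm_num) (by norm_num)
      (by norm_num) (by norm_num) (by norm_num), hv]
  · rw [k₅ 4 (by norm_num) (by norm_num) (by norm_num) (by norm_num) (by norm_num) (by norm_num)
      (by norm_num) (by norm_num) (by norm_num), h4]
  · rw [k₅ 5 (by norm_num) (by norm_num) (by norm_num) (by norm_num) (by norm_num) (by norm_num)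
      (by norm_num) (by norm_num) (by norm_num), h5]
  · rw [Function.update_self, Function.update_of_ne (by norm_num), e₄, Function.update_self]
    exact hnew
  · rw [k₅ 1 (by norm_num) (by norm_num) (by norm_num) (by norm_num) (by norm_num) (by norm_num)
      (by norm_num) (by norm_num) (by norm_num)]

end SearchSetting

/-- The noisy binary search: cell `13` receives the number of positive tests among the tests
`T 0, …, T (m - 1)`, where `m` is stored in cell `24`. -/
def noisySearch (C R : ℕ) (T : Expr → Test) : Prog :=
  .seq (.set 2 1)
  (.seq (forLog C (.set 2 (2 * .load 2)))
  (.seq (.set 4 (.load 2))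
  (.seq (.set 3 0)
  (.seq (.set 5 (.load 4 / (2 * (.load 24 + 1))))
  (.seq (.noisy 1 (.load 24) (T .idx) (forLog C (searchRound T R)))
    (.set 13 (.load 3 / (2 * .load 5))))))))

/-- The duration of a noisy search. -/
def searchSpan (N R : ℕ) : ℕ := N * (6 * R + 19) + 10

/-- The range `[0, 2 ^ N)` has room for `m + 1` intervals of length `2 * H`, one for each possible
threshold, and the target is the midpoint of the `t`-th. The hypothesis `hm` gives `2 ^ (N / 2) ≤
H`, the padding that the walk needs. The number `2 ^ N` is computed by doubling; `3 * N + 9` steps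
precede the first round of the walk. -/
theorem SearchSetting.noisySearch {M : Machine} {V z B m t : ℕ} {T : Expr → Test} {q : ℕ → Query}
    {D : ℕ → ℕ} {v : ℕ} (h : SearchSetting M V z B m t T q D v) {C R n N : ℕ}
    (hz : 22 * C + R + 200 ≤ z) (hR : R ≤ V) (hN : N = (n ^ C).size) (hV : 2 ^ (N + 2) ≤ V)
    (hm : 2 * (m + 1) ≤ 2 ^ (N - N / 2)) (hn : D 20 = n) {ctx : ℕ → Set Query} {s : State}
    (hs : Bdd V s.mem) (hD : ∀ a, 20 ≤ a → s.mem a = D a) (hv : s.mem 12 = v)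
    (hbad : 4 * badCount (searchBlocks (s.span + 3 * N + 9) R) M.err (3 * N) ≤ N) :
    M.Reaches B ctx (_root_.noisySearch C R T) s (searchSpan N R) 1 (fun mem =>
      Bdd V mem ∧ (∀ a, 20 ≤ a → mem a = D a) ∧ mem 12 = v ∧ mem 13 = t) := by
  have hpow : 2 ^ (N + 2) = 4 * 2 ^ N := by ring
  have hnN : n ^ C < 2 ^ N := by rw [hN]; exact Nat.lt_size_self _
  have hV2 := h.roomy.two_le
  set H := 2 ^ N / (2 * (m + 1)) with hH
  have hHle : 2 ^ (N / 2) ≤ H := by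
    rw [hH, Nat.le_div_iff_mul_le (by omega)]
    calc 2 ^ (N / 2) * (2 * (m + 1)) ≤ 2 ^ (N / 2) * 2 ^ (N - N / 2) := by gcongr
      _ = 2 ^ N := by rw [← pow_add]; congr 1; omega
  have hH0 : 0 < H := (Nat.two_pow_pos _).trans_le hHle
  have hT : t * (2 * H) + H < 2 ^ N := by
    have h1 : H * (2 * (m + 1)) ≤ 2 ^ N := Nat.div_mul_le_self _ _
    have h2 := h.t_le
    nlinarith
  refine Machine.Reaches.of_eq (k := 1 + ((N * (1 + 2) + 2) + (1 + (1 + (1 +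
    ((1 + (N * ((6 * R + 14) + 2) + 2)) + 1)))))) (o := 1) ?_ (by unfold searchSpan; ring) rfl
  refine (h.roomy.assign h.le h.one_le hs (by simp; omega) (h.cells 2 (by norm_num))
    (by simp; omega)).then fun s₁ hs₁ ⟨b₁, e₁⟩ => ?_
  have hloop := h.roomy.forLog h.le h.one_le (ctx := ctx) (C := C) (n := n) (k := 1)
    (body := .set 2 (2 * .load 2)) (s := s₁) (by omega)
    (by rw [e₁, Function.update_of_ne (by norm_num), hD 20 le_rfl, hn]) (by omega)
    (h.cells 1 (by norm_num))
    (fun i mem => Bdd V mem ∧ (∀ a, 20 ≤ a → mem a = D a) ∧ mem 12 = v ∧ (i ≤ N → mem 2 = 2 ^ i))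
    (fun _ _ h => h.1)
    (fun i mem u hu hI => ⟨hI.1.update _ hu,
      fun a ha => by rw [Function.update_of_ne (by omega)]; exact hI.2.1 a ha,
      by rw [Function.update_of_ne (by norm_num)]; exact hI.2.2.1,
      fun hi => by rw [Function.update_of_ne (by norm_num)]; exact hI.2.2.2 hi⟩)
    (fun i hi s' _ hI => by
      rw [← hN] at hi
      have h2 := hI.2.2.2 hi.le
      have hle : 2 ^ (i + 1) ≤ 2 ^ N := Nat.pow_le_pow_right (by norm_num) hi
      have hval : (2 * Expr.load 2).ideal s'.mem 0 0 = 2 ^ (i + 1) := by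
        simp [h2, pow_succ, mul_comm]
      refine h.roomy.set h.le h.one_le hI.1 (by simp; omega) (h.cells 2 (by norm_num))
        (by rw [hval]; omega) fun hb => ⟨⟨hb, fun a ha => ?_, ?_, fun _ => ?_⟩, ?_⟩
      · rw [Function.update_of_ne (by omega)]; exact hI.2.1 a ha
      · rw [Function.update_of_ne (by norm_num)]; exact hI.2.2.1
      · rw [Function.update_self, hval]
      · rw [Function.update_of_ne (by norm_num)])
    ⟨b₁, fun a ha => by rw [e₁, Function.update_of_ne (by omega)]; exact hD a ha,
      by rw [e₁, Function.update_of_ne (by norm_num)]; exact hv, fun _ => by rw [e₁]; simp⟩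
  rw [← hN] at hloop
  refine hloop.then fun s₂ hs₂ ⟨b₂, d₂, v₂, w₂⟩ => ?_
  have w₂ := w₂ le_rfl
  refine (h.roomy.assign h.le h.one_le b₂ (by simp; omega) (h.cells 4 (by norm_num))
    (by simp [w₂]; omega)).then fun s₃ hs₃ ⟨b₃, e₃⟩ => ?_
  simp only [Expr.ideal_load, Expr.ideal_ofNat, w₂] at e₃
  refine (h.roomy.assign h.le h.one_le b₃ (by simp; omega) (h.cells 3 (by norm_num))
    (by simp)).then fun s₄ hs₄ ⟨b₄, e₄⟩ => ?_
  have hval : (Expr.load 4 / (2 * (.load 24 + 1))).ideal s₄.mem 0 0 = H := by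
    simp [e₄, e₃, d₂ 24 (by norm_num), h.side, hH]
  refine (h.roomy.assign h.le h.one_le b₄ (by simp; omega) (h.cells 5 (by norm_num))
    (by rw [hval, hH]; exact (Nat.div_le_self _ _).trans (by omega))).then
    fun s₅ hs₅ ⟨b₅, e₅⟩ => ?_
  rw [hval] at e₅
  have d₅ : ∀ a, 20 ≤ a → s₅.mem a = D a := fun a ha => by
    rw [e₅, Function.update_of_ne (by omega), e₄, Function.update_of_ne (by omega), e₃,
      Function.update_of_ne (by omega), d₂ a ha]
  have v₅ : s₅.mem 12 = v := by
    rw [e₅, Function.update_of_ne (by norm_num), e₄, Function.update_of_ne (by norm_num), e₃,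
      Function.update_of_ne (by norm_num), v₂]
  have hmV : m ≤ V := by rw [← h.side, ← d₅ 24 (by norm_num)]; exact b₅ _
  have hnoisy : M.Reaches B ctx (.noisy 1 (.load 24) (T .idx) (forLog C (_root_.searchRound T R)))
      s₅ (1 + (N * ((6 * R + 14) + 2) + 2)) 1
      (SearchInv M V N H t (s.span + 3 * N + 9) R D v N) := by
    refine h.roomy.noisy h.le b₅ (l := m) ⟨by simp; omega, by simp; omega, h.width_idx⟩ (by simp)
      h.one_le (fun i _ => by simp [d₅ 24 (by norm_num), h.side]) hmV ?_ ?_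
    · intro i hi j j' hj hj' hh
      obtain rfl : i = 0 := by omega
      rw [h.test_idx _ d₅ v₅ j' hj', h.holds j' hj'] at hh
      rw [h.test_idx _ d₅ v₅ j (by omega), h.holds j (by omega)]
      omega
    · intro s₆ ctx' e₆ hs₆ hctx
      have hctx' : ∀ j < m, q j ∈ ctx' 0 := fun j hj => by
        rw [← h.test_idx _ d₅ v₅ j hj]; exact hctx 0 (by norm_num) j hj
      have := h.roomy.forLog h.le h.one_le (ctx := ctx') (C := C) (n := n) (k := 6 * R + 14)
        (body := _root_.searchRound T R) (s := s₆) (by omega)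
        (by rw [e₆, d₅ 20 le_rfl, hn]) (by omega)
        (h.cells 1 (by norm_num))
        (SearchInv M V N H t (s.span + 3 * N + 9) R D v)
        (fun _ _ h => h.1)
        (fun i mem u hu hI => by
          obtain ⟨i1, i2, i3, i4, i5, i6⟩ := hI
          refine ⟨i1.update _ hu, fun a ha => ?_, ?_, ?_, ?_, ?_⟩
          · rw [Function.update_of_ne (by omega)]; exact i2 a ha
          · rw [Function.update_of_ne (by norm_num)]; exact i3
          · rw [Function.update_of_ne (by norm_num)]; exact i4
          · rw [Function.update_of_ne (by norm_num)]; exact i5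
          · rw [Function.update_of_ne (by norm_num), Function.update_of_ne (by norm_num)]
            exact i6)
        (fun i hi s' hs' hI => by
          rw [← hN] at hi
          exact h.searchRound (by omega) hR hV hctx' hH0 hT hi (by
            have e : i * (6 * R + 14 + 2) = i * (6 * R + 16) := rfl
            rw [hs', e]; omega) hI)
        (by
          rw [e₆]
          refine ⟨b₅, d₅, v₅, ?_, ?_, 0, Nat.zero_le _, ?_⟩
          · simp [e₅, e₄, e₃]
          · simp [e₅]
          · have c3 : s₅.mem 3 = 0 := by simp [e₅, e₄]
            have c2 : s₅.mem 2 = 2 ^ N := by simp [e₅, e₄, e₃, w₂]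
            rw [c3, c2]
            exact WalkInv.zero hT)
      rw [← hN] at this
      exact this
  refine (hnoisy.seq (o' := 0) (k' := 1) fun s₇ _ hI => ?_).of_eq rfl rfl
  obtain ⟨i1, i2, i3, i4, i5, bad, hbad', hwalk⟩ := hI
  have hres := hwalk.result hHle (by omega)
  have hval : (Expr.load 3 / (2 * .load 5)).ideal s₇.mem 0 0 = t := by
    simp [i5, hres]
  refine h.roomy.set h.le h.one_le i1 (by simp; omega) (h.cells 13 (by norm_num))
    (by rw [hval]; exact h.t_le.trans hmV) fun hb => ⟨hb, fun a ha => ?_, ?_, ?_⟩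
  · rw [Function.update_of_ne (by omega)]; exact i2 a ha
  · rw [Function.update_of_ne (by norm_num)]; exact i3
  · rw [Function.update_self, hval]

/-! ### The sorted rows of the structure -/

/-- The entry `(x, y)` of the `a`-th of the arrays of side `m` in the memory. -/
def arr (m : ℕ) (mem : ℕ → ℕ) (a x y : ℕ) : ℕ := mem (a * (m * m) + (x * m + y))

namespace PlanarSubdivision

/-- The first vertex is strictly to the left of the second one. -/
def XLess (S : PlanarSubdivision) (x y : ℕ) : Prop := (Query.xLess x y).Holds S.sites

/-- The items of a row: the vertices in row `m - 1`, and in the row of a vertex the edges that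
cross the slab to its left. -/
def InRow (S : PlanarSubdivision) (m s x : ℕ) : Prop :=
  if s = m - 1 then x < S.nv
  else ∃ (hx : x < S.ne) (hs : s < S.nv), S.Spans (S.vtx ⟨s, hs⟩) ⟨x, hx⟩

/-- The comparison of two items of a row. -/
def RowCmp (S : PlanarSubdivision) (m s x y : ℕ) : Prop :=
  if s = m - 1 then S.XLess x y ∨ (¬ S.XLess y x ∧ x < y)
  else ∃ (hx : x < S.ne) (hy : y < S.ne), S.Below ⟨x, hx⟩ ⟨y, hy⟩

/-- The order of a row: its items from left to right or from bottom to top, then all other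
numbers. -/
def RowLt (S : PlanarSubdivision) (m s x y : ℕ) : Prop :=
  (S.InRow m s x ∧ ¬ S.InRow m s y) ∨ (S.InRow m s x ∧ S.InRow m s y ∧ S.RowCmp m s x y) ∨
    (¬ S.InRow m s x ∧ ¬ S.InRow m s y ∧ x < y)

end PlanarSubdivision

theorem isRowOrder_of_key (m : ℕ) {I : ℕ → Prop} {cmp : ℕ → ℕ → Prop} (key : ℕ → ℝ)
    (h : ∀ x y, I x → I y → (cmp x y ↔ key x < key y ∨ key x = key y ∧ x < y)) :
    IsRowOrder m fun x y => (I x ∧ ¬ I y) ∨ (I x ∧ I y ∧ cmp x y) ∨ (¬ I x ∧ ¬ I y ∧ x < y) := by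
  constructor
  · rintro x _ (⟨h1, h2⟩ | ⟨h1, _, h2⟩ | ⟨_, _, h2⟩)
    · exact h2 h1
    · rw [h x x h1 h1] at h2; simp at h2
    · simp at h2
  · intro x _ y _ z _ hxy hyz
    by_cases hx : I x <;> by_cases hy : I y <;> by_cases hz : I z <;>
      simp only [hx, hy, hz, not_true, not_false_eq_true, true_and, false_and, and_false,
        false_or, or_false, and_true] at hxy hyz ⊢
    · rw [h x y hx hy] at hxy
      rw [h y z hy hz] at hyz
      rw [h x z hx hz]
      rcases hxy with a | ⟨a, a'⟩ <;> rcases hyz with b | ⟨b, b'⟩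
      · exact Or.inl (a.trans b)
      · exact Or.inl (b ▸ a)
      · exact Or.inl (a ▸ b)
      · exact Or.inr ⟨a.trans b, a'.trans b'⟩
    · exact hxy.trans hyz
  · intro x _ y _ hne
    by_cases hx : I x <;> by_cases hy : I y <;>
      simp only [hx, hy, not_true, not_false_eq_true, true_and, false_and, and_false,
        false_or, or_false, or_true]
    · rw [h x y hx hy, h y x hy hx]
      rcases lt_trichotomy (key x) (key y) with a | a | a
      · exact Or.inl (Or.inl a)
      · rcases hne.lt_or_gt with b | b
        · exact Or.inl (Or.inr ⟨a, b⟩)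
        · exact Or.inr (Or.inr ⟨a.symm, b⟩)
      · exact Or.inr (Or.inl a)
    · exact hne.lt_or_gt

theorem exists_threshold {m : ℕ} {P : ℕ → Prop} (h : ∀ j j', j ≤ j' → j' < m → P j' → P j) :
    ∃ t ≤ m, ∀ j < m, P j ↔ j < t := by
  induction m with
  | zero => exact ⟨0, le_rfl, fun j hj => absurd hj (Nat.not_lt_zero _)⟩
  | succ m ih =>
    by_cases hm : P m
    · exact ⟨m + 1, le_rfl, fun j hj => ⟨fun _ => hj, fun _ => h j m (by omega) (by omega) hm⟩⟩
    · obtain ⟨t, ht, hP⟩ := ih fun j j' hj hj' => h j j' hj (by omega)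
      refine ⟨t, by omega, fun j hj => ?_⟩
      rcases Nat.lt_succ_iff_lt_or_eq.1 hj with hj | rfl
      · exact hP j hj
      · exact ⟨fun h' => absurd h' hm, fun h' => by omega⟩

/-! ### Ranks in sorted rows locate a point. -/

namespace PlanarSubdivision

variable {S : PlanarSubdivision}

theorem sites_of_lt {i : ℕ} (h : i < S.nv) : S.sites i = some (S.vtx ⟨i, h⟩) := dif_pos h

theorem sites_of_le {i : ℕ} (h : S.nv ≤ i) : S.sites i = none := dif_neg (by omega)

theorem xLess_iff {x y : ℕ} :
    S.XLess x y ↔ ∃ (hx : x < S.nv) (hy : y < S.nv), (S.vtx ⟨x, hx⟩).1 < (S.vtx ⟨y, hy⟩).1 := by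
  unfold XLess Query.Holds
  constructor
  · rintro ⟨a, b, ha, hb, hab⟩
    have hx : x < S.nv := by
      by_contra h; rw [sites_of_le (not_lt.1 h)] at ha; cases ha
    have hy : y < S.nv := by
      by_contra h; rw [sites_of_le (not_lt.1 h)] at hb; cases hb
    rw [sites_of_lt hx] at ha
    rw [sites_of_lt hy] at hb
    cases ha; cases hb
    exact ⟨hx, hy, hab⟩
  · rintro ⟨hx, hy, h⟩
    exact ⟨_, _, sites_of_lt hx, sites_of_lt hy, h⟩

theorem inRow_of_ne {m s x : ℕ} (hs : s ≠ m - 1) : S.InRow m s x ↔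
    ∃ (hx : x < S.ne) (hs : s < S.nv), S.Spans (S.vtx ⟨s, hs⟩) ⟨x, hx⟩ := by
  unfold InRow; rw [if_neg hs]

theorem inRow_last {m x : ℕ} : S.InRow m (m - 1) x ↔ x < S.nv := by
  unfold InRow; rw [if_pos rfl]

/-- The order comes from a real key: the abscissa of a vertex, with ties broken by the name, or the
height of an edge over one fixed abscissa in the slab, where distinct edges have distinct heights.
-/
theorem isRowOrder_rowLt (S : PlanarSubdivision) (m s : ℕ) : IsRowOrder m (S.RowLt m s) := by
  classical
  unfold RowLt
  by_cases hs : s = m - 1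
  · subst hs
    refine isRowOrder_of_key m (fun x => if h : x < S.nv then (S.vtx ⟨x, h⟩).1 else 0) ?_
    intro x y hx hy
    rw [inRow_last] at hx hy
    simp only [RowCmp, if_true, xLess_iff, hx, hy, exists_true_left, dif_pos, not_lt]
    constructor
    · rintro (h | ⟨h, h'⟩)
      · exact Or.inl h
      · rcases h.lt_or_eq with h | h
        · exact Or.inl h
        · exact Or.inr ⟨h, h'⟩
    · rintro (h | ⟨h, h'⟩)
      · exact Or.inl h
      · exact Or.inr ⟨h.le, h'⟩
  · by_cases hv : s < S.nv
    · obtain ⟨x₀, hx₀⟩ := exists_slab (S := S) (S.vtx ⟨s, hv⟩)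
      refine isRowOrder_of_key m (fun x => if h : x < S.ne then S.height ⟨x, h⟩ x₀ else 0) ?_
      intro x y hx hy
      rw [inRow_of_ne hs] at hx hy
      obtain ⟨hx, _, hxs⟩ := hx
      obtain ⟨hy, _, hys⟩ := hy
      simp only [RowCmp, hs, if_false, hx, hy, exists_true_left, dif_pos]
      by_cases hxy : x = y
      · subst hxy
        simp [Below, orient]
        exact (mul_comm _ _).le
      · have hne : (⟨x, hx⟩ : Fin S.ne) ≠ ⟨y, hy⟩ := fun h => hxy (Fin.mk.inj h)
        rw [below_iff hne (hxs.mem hx₀) (hys.mem hx₀)]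
        have := height_ne hne (hxs.mem hx₀) (hys.mem hx₀)
        simp [this]
    · refine isRowOrder_of_key m (fun _ => 0) fun x y hx => ?_
      rw [inRow_of_ne hs] at hx
      exact absurd hx.2.1 hv

theorem RowLt.inRow {m s x y : ℕ} (h : S.RowLt m s x y) (hy : S.InRow m s y) :
    S.InRow m s x ∧ S.RowCmp m s x y := by
  rcases h with h | h | h
  · exact absurd hy h.2
  · exact ⟨h.1, h.2.2⟩
  · exact absurd hy h.2.1

/-- `A` lists the numbers below `m` in the order of row `s`. -/
def SortedRow (S : PlanarSubdivision) (m s : ℕ) (A : ℕ → ℕ) : Prop :=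
  (∀ j < m, A j < m) ∧ (∀ e < m, ∃ j < m, A j = e) ∧
    ∀ j < m, ∀ j' < m, S.RowLt m s (A j) (A j') ↔ j < j'

/-- The `j`-th vertex is strictly to the left of `q`. -/
def VertexTest (S : PlanarSubdivision) (q : ℝ × ℝ) (x : ℕ) : Prop :=
  ∃ h : x < S.nv, (S.vtx ⟨x, h⟩).1 < q.1

/-- The edge `x` belongs to row `s` and is strictly below `q`. -/
def EdgeTest (S : PlanarSubdivision) (m s : ℕ) (q : ℝ × ℝ) (x : ℕ) : Prop :=
  S.InRow m s x ∧ ∃ h : x < S.ne, S.height ⟨x, h⟩ q.1 < q.2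

/-- If some vertex is not to the left of `q`, then `A t` is a first such vertex. No vertex abscissa
lies between `q.1` and that of `A t`, so the same edges cross to the left of both. If all vertices
are to the left of `q`, then `A t` is the number `nv`, whose row is empty, and indeed no edge spans
`q`. -/
theorem SortedRow.exists_vertex {m : ℕ} {A : ℕ → ℕ} (hA : S.SortedRow m (m - 1) A)
    (hm : S.nv + 1 < m) (q : ℝ × ℝ) :
    ∃ t < m, (∀ j < m, S.VertexTest q (A j) ↔ j < t) ∧ A t ≤ S.nv ∧
      ∀ e : Fin S.ne, S.InRow m (A t) e ↔ S.Spans q e := by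
  obtain ⟨hA1, hA2, hA3⟩ := hA
  obtain ⟨t, htm, ht⟩ := exists_threshold (m := m) (P := fun j => S.VertexTest q (A j)) (by
    intro j j' hj hj' h
    rcases hj.eq_or_lt with rfl | hj
    · exact h
    obtain ⟨h1, h2⟩ := h
    obtain ⟨g1, g2⟩ := ((hA3 j (by omega) j' hj').2 hj).inRow (inRow_last.2 h1)
    rw [inRow_last] at g1
    refine ⟨g1, lt_of_le_of_lt ?_ h2⟩
    simp only [RowCmp, if_true, xLess_iff, g1, h1, exists_true_left, not_lt] at g2
    rcases g2 with g2 | g2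
    · exact g2.le
    · exact g2.1)
  have htm' : t < m := by
    -- The number `nv` occurs in the row and names no vertex, so the tests fail before the end.
    obtain ⟨j, hj, hjA⟩ := hA2 S.nv (by omega)
    have : ¬ S.VertexTest q (A j) := by
      rintro ⟨h, _⟩; omega
    rw [ht j hj] at this
    omega
  refine ⟨t, htm', ht, ?_⟩
  have hlt : ∀ a < m, S.RowLt m (m - 1) a (A t) → S.VertexTest q a := by
    intro a ha h
    obtain ⟨j, hj, rfl⟩ := hA2 a ha
    exact (ht j hj).2 ((hA3 j hj t htm').1 h)
  by_cases hv : A t < S.nv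
  · have hq : q.1 ≤ (S.vtx ⟨A t, hv⟩).1 := by
      by_contra h
      exact absurd ((ht t htm').1 ⟨hv, not_le.1 h⟩) (lt_irrefl _)
    have hprev : ∀ a : Fin S.nv, (S.vtx a).1 < (S.vtx ⟨A t, hv⟩).1 → (S.vtx a).1 < q.1 := by
      intro a ha
      refine (hlt a (by omega) (Or.inr (Or.inl ⟨inRow_last.2 a.2, inRow_last.2 hv, ?_⟩))).2
      simp only [RowCmp, if_true]
      exact Or.inl (xLess_iff.2 ⟨a.2, hv, ha⟩)
    refine ⟨hv.le, fun e => ?_⟩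
    rw [inRow_of_ne (by omega)]
    constructor
    · rintro ⟨_, _, h1, h2⟩
      exact ⟨hprev _ h1, hq.trans h2⟩
    · rintro ⟨h1, h2⟩
      refine ⟨e.2, hv, h1.trans_le hq, ?_⟩
      by_contra h
      exact absurd (hprev _ (not_le.1 h)) (not_lt.2 h2)
  -- After the vertices the row lists the remaining numbers in increasing order.
  · have hvt : A t = S.nv := by
      by_contra hne
      have := hlt S.nv (by omega) (Or.inr (Or.inr ⟨by rw [inRow_last]; omega,
        by rw [inRow_last]; omega, by omega⟩))
      obtain ⟨h, _⟩ := this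
      omega
    refine ⟨hvt.le, fun e => ?_⟩
    rw [inRow_of_ne (by omega), hvt]
    constructor
    · rintro ⟨_, h, _⟩
      omega
    · intro h
      have := hlt (S.right e) (by omega) (Or.inl ⟨inRow_last.2 (S.right e).2,
        by rw [inRow_last]; omega⟩)
      exact absurd this.2 (not_lt.2 h.2)

/-- Since edges do not cross, those below `q` form an initial segment of the row, and numbers that
are not in the row come last and fail the test. At position `t - 1` stands the highest edge below
`q`, and the order of the row yields the hypotheses of `locates_upper`. -/
theorem SortedRow.exists_edge {m s : ℕ} {A : ℕ → ℕ} (hA : S.SortedRow m s A)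
    (hs : s ≤ S.nv) (hm : S.nv + 1 < m) (hne : S.ne ≤ m) {q : ℝ × ℝ}
    (hrow : ∀ e : Fin S.ne, S.InRow m s e ↔ S.Spans q e) :
    ∃ t ≤ m, (∀ j < m, S.EdgeTest m s q (A j) ↔ j < t) ∧
      (t = 0 → S.Locates q S.outer) ∧
      (t ≠ 0 → ∃ h : A (t - 1) < S.ne, S.Locates q (S.upper ⟨A (t - 1), h⟩)) := by
  obtain ⟨hA1, hA2, hA3⟩ := hA
  have hsm : s ≠ m - 1 := by omega
  have hcmp : ∀ {x y : ℕ} (hx : x < S.ne) (hy : y < S.ne), S.RowLt m s x y → S.InRow m s y →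
      S.Below ⟨x, hx⟩ ⟨y, hy⟩ := by
    intro x y hx hy h hI
    have := (h.inRow hI).2
    rw [RowCmp, if_neg hsm] at this
    exact this.2.2
  obtain ⟨t, htm, ht⟩ := exists_threshold (m := m) (P := fun j => S.EdgeTest m s q (A j)) (by
    intro j j' hj hj' h
    rcases hj.eq_or_lt with rfl | hj
    · exact h
    obtain ⟨h1, h2, h3⟩ := h
    have hlt := (hA3 j (by omega) j' hj').2 hj
    have g1 := (hlt.inRow h1).1
    have g2 : A j < S.ne := ((inRow_of_ne hsm).1 g1).1
    refine ⟨g1, g2, ?_⟩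
    have hne' : (⟨A j, g2⟩ : Fin S.ne) ≠ ⟨A j', h2⟩ := by
      intro heq
      rw [Fin.mk.inj heq] at hlt
      exact (S.isRowOrder_rowLt m s).irrefl _ (hA1 _ hj') hlt
    exact above_of_below hne' ((hrow ⟨_, g2⟩).1 g1) ((hrow ⟨_, h2⟩).1 h1) (hcmp g2 h2 hlt h1) h3)
  have hpos : ∀ e : Fin S.ne, ∃ j < m, A j = e := fun e => hA2 e (by omega)
  refine ⟨t, htm, ht, fun h0 => ?_, fun h0 => ?_⟩
  · refine locates_outer fun e he hlt => ?_
    obtain ⟨j, hj, hje⟩ := hpos e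
    have := (ht j hj).1 (by rw [hje]; exact ⟨(hrow e).2 he, e.2, hlt⟩)
    omega
  · obtain ⟨g1, g2, g3⟩ := (ht (t - 1) (by omega)).2 (by omega)
    refine ⟨g2, locates_upper ((hrow ⟨_, g2⟩).1 g1) g3 ?_ ?_⟩
    · intro e hee he hlt
      obtain ⟨j, hj, hje⟩ := hpos e
      have hjt := (ht j hj).1 (by rw [hje]; exact ⟨(hrow e).2 he, e.2, hlt⟩)
      have hjne : j ≠ t - 1 := by
        rintro rfl
        exact hee (Fin.ext hje.symm)
      have := (hA3 j hj (t - 1) (by omega)).2 (by omega)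
      rw [hje] at this
      exact hcmp e.2 g2 this g1
    · intro e hee he hlt
      obtain ⟨j, hj, hje⟩ := hpos e
      have hjt : ¬ j < t := by
        rw [← ht j hj, hje]
        rintro ⟨_, _, h⟩
        exact hlt h
      have := (hA3 (t - 1) (by omega) j hj).2 (by omega)
      rw [hje] at this
      exact hcmp g2 e.2 this ((hrow e).2 he)

end PlanarSubdivision

/-! ### The query algorithm -/

/-- The entry `(x, y)` of the array `a`, where the side of the arrays is stored in cell `24`. -/
def entry (a : ℕ) (x y : Expr) : Expr :=
  .load (.const a * (.load 24 * .load 24) + (x * .load 24 + y))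

theorem entry_ideal {m : ℕ} {mem : ℕ → ℕ} (hm : mem 24 = m) (a i j : ℕ) (x y : Expr) :
    (entry a x y).ideal mem i j = arr m mem a (x.ideal mem i j) (y.ideal mem i j) := by
  simp [entry, arr, hm]

theorem entry_width (a : ℕ) (x y : Expr) :
    (entry a x y).width = a + x.width + y.width + 81 := by
  simp [entry]; ring

/-- The arrays with positive number begin at `m * m ≥ 25`, beyond the scratch cells. -/
theorem arr_congr {m : ℕ} (hm : 5 ≤ m) {mem D : ℕ → ℕ} (h : ∀ b, 20 ≤ b → mem b = D b) {a : ℕ}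
    (ha : 1 ≤ a) (x y : ℕ) : arr m mem a x y = arr m D a x y :=
  h _ (by nlinarith)

/-- The comparison of the query point with the vertex at a position of the last row. -/
def vertexTest (ix : Expr) : Test := .xLess (entry 8 (.load 24 - 1) ix) (.load 21)

/-- The comparison of the query point with the edge at a position of the row in cell `12`. -/
def edgeTest (ix : Expr) : Test :=
  .ccw (.ite (entry 6 (.load 12) (entry 8 (.load 12) ix)) (entry 9 (entry 8 (.load 12) ix) 0)
    (.load 21 + 1)) (entry 9 (entry 8 (.load 12) ix) 1) (.load 21)

/-- The query algorithm. -/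
def queryProg (C R : ℕ) : Prog :=
  .seq (.write 20 1 .pid 0)
  (.seq (noisySearch C R vertexTest)
  (.seq (.set 12 (entry 8 (.load 24 - 1) (.load 13)))
  (.seq (noisySearch C R edgeTest)
  (.set 0 (.ite (.load 13) (entry 9 (entry 8 (.load 12) (.load 13 - 1)) 2) (.load 23))))))

/-- The finished data structure. -/
structure PlanarSubdivision.Built (S : PlanarSubdivision) (n m V : ℕ) (D : ℕ → ℕ) : Prop where
  bdd : Bdd V D
  size : D 20 = n
  nv : D 21 = S.nv
  outer : D 23 = S.outer
  side : D 24 = m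
  left : ∀ e : Fin S.ne, arr m D 9 e 0 = S.left e
  right : ∀ e : Fin S.ne, arr m D 9 e 1 = S.right e
  upper : ∀ e : Fin S.ne, arr m D 9 e 2 = S.upper e
  inRow : ∀ s < m, ∀ x < m, arr m D 6 s x ≠ 0 ↔ S.InRow m s x
  sorted : ∀ s < m, S.SortedRow m s (arr m D 8 s)

namespace PlanarSubdivision

variable {S : PlanarSubdivision}

theorem sitesWith_self (q : ℝ × ℝ) : S.sitesWith q S.nv = some q := if_pos rfl

theorem sitesWith_of_lt (q : ℝ × ℝ) (v : Fin S.nv) : S.sitesWith q v = some (S.vtx v) := by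
  unfold sitesWith
  rw [if_neg (by omega), sites_of_lt v.2]

theorem sitesWith_of_gt (q : ℝ × ℝ) {i : ℕ} (h : S.nv < i) : S.sitesWith q i = none := by
  unfold sitesWith
  rw [if_neg (by omega), sites_of_le h.le]

theorem holds_vertexTest (q : ℝ × ℝ) (x : ℕ) :
    (Query.xLess x S.nv).Holds (S.sitesWith q) ↔ S.VertexTest q x := by
  unfold Query.Holds VertexTest
  simp only [sitesWith_self]
  rcases lt_trichotomy x S.nv with h | rfl | h
  · simp [sitesWith_of_lt q ⟨x, h⟩, h]
  · simp [sitesWith_self]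
  · simp [sitesWith_of_gt q h, h.le]

theorem holds_ccw (q : ℝ × ℝ) {e : Fin S.ne}
    (h : (S.vtx (S.left e)).1 < (S.vtx (S.right e)).1) :
    (Query.ccw (S.left e) (S.right e) S.nv).Holds (S.sitesWith q) ↔ S.height e q.1 < q.2 := by
  rw [← orient_pos_iff h]
  simp [Query.Holds, sitesWith_of_lt, sitesWith_self]

/-- The name `nv + 1` denotes no point. `edgeTest` uses it in place of an endpoint for items outside
of the row, which makes their tests fail and keeps the sequence sorted. -/
theorem not_holds_ccw (q : ℝ × ℝ) (y z : ℕ) :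
    ¬ (Query.ccw (S.nv + 1) y z).Holds (S.sitesWith q) := by
  simp [Query.Holds, sitesWith_of_gt q (Nat.lt_succ_self S.nv)]

/-- The rank of `q` among the vertices yields the row `v`, which is stored in cell `12` for the
search among the edges. As a search has a fixed duration, both searches start at known times, `1`
and `2 + searchSpan N R`, and the two noise hypotheses refer to fixed blocks. -/
theorem Built.query {n m V : ℕ} {D : ℕ → ℕ} (hD : S.Built n m V D) {C R N z : ℕ} {q : ℝ × ℝ}
    {W : ℕ} {err : Noise}
    (hm : m = S.size + 20) (hM : (Machine.mk W {a | a < 20} (S.sitesWith q) err).Roomy V z)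
    (hz : 22 * C + R + 3000 ≤ z) (hR : R ≤ V) (hN : N = (n ^ C).size) (hV : 2 ^ (N + 2) ≤ V)
    (hV20 : 20 ≤ V)
    (hmN : 2 * (m + 1) ≤ 2 ^ (N - N / 2)) {mem : ℕ → ℕ} (hmem : ∀ a, 20 ≤ a → mem a = D a)
    (hbad₁ : 4 * badCount (searchBlocks (1 + 3 * N + 9) R) err (3 * N) ≤ N)
    (hbad₂ : 4 * badCount (searchBlocks (2 + searchSpan N R + 3 * N + 9) R) err (3 * N) ≤ N) :
    (Machine.mk W {a | a < 20} (S.sitesWith q) err).Reaches 20 (fun _ => ∅) (queryProg C R)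
      ⟨mem, 0, 0, 0⟩ (3 + 2 * searchSpan N R) 2 (fun mem' => S.Locates q (mem' 0)) := by
  set M := Machine.mk W {a | a < 20} (S.sitesWith q) err with hMdef
  have hsz : S.size = S.nv + S.ne + S.nf := rfl
  have hm5 : 5 ≤ m := by omega
  obtain ⟨t₁, ht₁m, ht₁, hrow, hspan⟩ := (hD.sorted (m - 1) (by omega)).exists_vertex (by omega) q
  set v := arr m D 8 (m - 1) t₁ with hv
  obtain ⟨t₂, ht₂m, ht₂, hout, hup⟩ := (hD.sorted v (by omega)).exists_edge hrow (by omega)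
    (by omega) hspan
  have hcells : ∀ a < 20, a ∈ M.cells := fun a ha => ha
  have side : ∀ {mem' : ℕ → ℕ}, (∀ a, 20 ≤ a → mem' a = D a) → mem' 24 = m :=
    fun h => by rw [h 24 (by norm_num), hD.side]
  have hs₁ : SearchSetting M V z 20 m t₁ vertexTest
      (fun j => .xLess (arr m D 8 (m - 1) j) S.nv) D 0 := by
    refine ⟨hM, hV20, by norm_num, hcells, fun j hj => ?_, ht₁m.le, by omega, hD.side, ?_, ?_, ?_, ?_⟩
    · rw [← ht₁ j hj]; exact holds_vertexTest q _
    · intro mem' h _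
      simp [vertexTest, Test.ideal, entry_ideal (side h), side h, h 21 (by norm_num), hD.nv,
        arr_congr hm5 h]
    · simp [vertexTest, Test.width, entry_width]; omega
    · simp [vertexTest, Test.width, entry_width]; omega
    · intro mem' h _ j _
      simp [vertexTest, Test.ideal, entry_ideal (side h), side h, h 21 (by norm_num), hD.nv,
        arr_congr hm5 h]
  have hs₂ : SearchSetting M V z 20 m t₂ edgeTest
      (fun j => .ccw (if arr m D 6 v (arr m D 8 v j) ≠ 0 then arr m D 9 (arr m D 8 v j) 0
        else S.nv + 1) (arr m D 9 (arr m D 8 v j) 1) S.nv) D v := by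
    refine ⟨hM, hV20, by norm_num, hcells, fun j hj => ?_, ht₂m, by omega, hD.side, ?_, ?_, ?_, ?_⟩
    · rw [← ht₂ j hj]
      have hin := hD.inRow v (by omega) (arr m D 8 v j) ((hD.sorted v (by omega)).1 j hj)
      by_cases hc : arr m D 6 v (arr m D 8 v j) ≠ 0
      · have hI := hin.1 hc
        obtain ⟨he, _⟩ := (inRow_of_ne (by omega)).1 hI
        rw [if_pos hc]
        have hsp := (hspan ⟨_, he⟩).1 hI
        have h1 := hD.left ⟨_, he⟩
        have h2 := hD.right ⟨_, he⟩
        simp only at h1 h2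
        rw [h1, h2]
        refine (holds_ccw q hsp.lt).trans ?_
        exact ⟨fun h => ⟨hI, he, h⟩, fun h => h.2.2⟩
      · rw [if_neg hc]
        refine iff_of_false (not_holds_ccw q _ _) fun h => hc (hin.2 h.1)
    · intro mem' h h12
      simp [edgeTest, Test.ideal, entry_ideal (side h), h 21 (by norm_num), hD.nv,
        arr_congr hm5 h, h12]
    · simp [edgeTest, Test.width, entry_width]; omega
    · simp [edgeTest, Test.width, entry_width]; omega
    · intro mem' h h12 j _
      simp [edgeTest, Test.ideal, entry_ideal (side h), h 21 (by norm_num), hD.nv,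
        arr_congr hm5 h, h12]
  have hW : 20 < W := by
    have := hM.lt
    have h2 : V ^ 1 ≤ V ^ z := Nat.pow_le_pow_right (by omega) (by omega)
    rw [pow_one] at h2
    change V ^ z < W at this
    omega
  have hinit : M.Reaches 20 (fun _ => ∅) (.write 20 1 .pid 0) ⟨mem, 0, 0, 0⟩ 1 0
      (fun mem' => Bdd V mem' ∧ (∀ a, 20 ≤ a → mem' a = D a) ∧ mem' 12 = 0) := by
    have hp : M.val ⟨mem, 0, 0, 0⟩ 20 0 = 20 := Nat.mod_eq_of_lt hW
    have hact : ∀ i, M.Active ⟨mem, 0, 0, 0⟩ 20 1 i ↔ i < 20 := by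
      intro i
      unfold Machine.Active
      rw [hp]
      refine and_iff_left ?_
      have : M.val ⟨mem, 0, 0, 0⟩ 1 i = 1 := Nat.mod_eq_of_lt (by omega : 1 < W)
      rw [this]; norm_num
    have ha : M.val ⟨mem, 0, 0, 0⟩ .pid = id := rfl
    have h0 : ∀ i, M.val ⟨mem, 0, 0, 0⟩ 0 i = 0 := fun i => Nat.zero_mod _
    obtain ⟨mem', h'⟩ := M.exists_commit (act := M.Active ⟨mem, 0, 0, 0⟩ 20 1)
      (addr := M.val ⟨mem, 0, 0, 0⟩ .pid) (M.val ⟨mem, 0, 0, 0⟩ 0) mem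
      (fun i hi => (hact i).1 hi) (fun i k _ _ h => h)
    refine ⟨_, .write _ _ _ _ _ _ mem' h', rfl, by simp [hp], by simp, ?_, ?_, ?_⟩
    · intro a
      by_cases h : a < 20
      · have := h'.2.2.1 a ((hact a).2 h)
        rw [h0] at this
        exact this.le.trans (Nat.zero_le _)
      · have := h'.2.2.2 a fun i hi hia => h (hia ▸ (hact i).1 hi)
        exact (this.trans (hmem a (by omega))).le.trans (hD.bdd a)
    · intro a h
      have := h'.2.2.2 a fun i hi hia => absurd (hia ▸ (hact i).1 hi : a < 20) (by omega)
      exact this.trans (hmem a h)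
    · have := h'.2.2.1 12 ((hact 12).2 (by norm_num))
      rw [h0] at this
      exact this
  refine Machine.Reaches.of_eq
    (k := 1 + (searchSpan N R + (1 + (searchSpan N R + 1)))) (o := 1 + (1 + 0)) ?_ (by ring) rfl
  refine hinit.then fun s₁ e₁ ⟨b₁, d₁, v₁⟩ => ?_
  refine (hs₁.noisySearch (by omega) hR hN hV hmN hD.size b₁ d₁ v₁ (by rw [e₁]; simpa using hbad₁)).seq
    fun s₂ e₂ ⟨b₂, d₂, _, r₂⟩ => ?_
  have hval : (entry 8 (.load 24 - 1) (.load 13)).ideal s₂.mem 0 0 = v := by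
    simp [entry_ideal (side d₂), side d₂, r₂, arr_congr hm5 d₂, hv]
  refine (hM.assign hV20 (by norm_num) b₂ (by simp [entry_width]; omega)
    (hcells 12 (by norm_num)) (by rw [hval]; exact hD.bdd _)).then fun s₃ e₃ ⟨b₃, u₃⟩ => ?_
  rw [hval] at u₃
  refine (hs₂.noisySearch (by omega) hR hN hV hmN hD.size b₃
    (fun a ha => by rw [u₃, Function.update_of_ne (by omega), d₂ a ha]) (by rw [u₃]; simp)
    (by
      have : s₃.span = 2 + searchSpan N R := by rw [e₃, e₂, e₁]; ring
      rw [this]; exact hbad₂)).seq fun s₄ _ ⟨b₄, d₄, v₄, r₄⟩ => ?_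
  have hres : (Expr.ite (.load 13) (entry 9 (entry 8 (.load 12) (.load 13 - 1)) 2)
      (.load 23)).ideal s₄.mem 0 0 =
      if t₂ ≠ 0 then arr m D 9 (arr m D 8 v (t₂ - 1)) 2 else S.outer := by
    simp [entry_ideal (side d₄), r₄, v₄, arr_congr hm5 d₄, d₄ 23 (by norm_num), hD.outer]
  have hle : (Expr.ite (.load 13) (entry 9 (entry 8 (.load 12) (.load 13 - 1)) 2)
      (.load 23)).ideal s₄.mem 0 0 ≤ V := by
    rw [hres]
    split_ifs
    · exact hD.bdd _
    · rw [← hD.outer]; exact hD.bdd _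
  refine hM.set hV20 (by norm_num) b₄ (by simp [entry_width]; omega) (hcells 0 (by norm_num)) hle
    fun _ => ?_
  rw [Function.update_self, hres]
  split_ifs with h0
  · obtain ⟨he, hloc⟩ := hup h0
    have := hD.upper ⟨_, he⟩
    simp only at this
    rw [this]; exact hloc
  · exact hout (not_not.1 h0)

end PlanarSubdivision

/-! ### Parallel steps on square arrays -/

theorem div_mod_of_lt {m x y : ℕ} (hy : y < m) : (x * m + y) / m = x ∧ (x * m + y) % m = y := by
  have hm : 0 < m := by omega
  constructor
  · rw [mul_comm, Nat.mul_add_div hm, Nat.div_eq_of_lt hy, add_zero]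
  · rw [mul_comm, Nat.mul_add_mod, Nat.mod_eq_of_lt hy]

theorem mul_add_lt_sq {m x y : ℕ} (hx : x < m) (hy : y < m) : x * m + y < m * m := by
  have : (x + 1) * m ≤ m * m := Nat.mul_le_mul_right m hx
  rw [add_mul] at this
  omega

/-- Write `v` to all entries of the array `a` of side `side`. -/
def Prog.fill (side : Expr) (a : ℕ) (v : Expr) : Prog :=
  .write (side * side) 1 (.const a * (side * side) + .pid) v

theorem Machine.Roomy.fill {M : Machine} {V z B : ℕ} (hM : M.Roomy V z) (hB : B ≤ V)
    {ctx : ℕ → Set Query} {side v : Expr} {a m : ℕ} {s : State} (hs : Bdd V s.mem)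
    (hside : ∀ i, side.ideal s.mem i 0 = m) (hmB : m * m ≤ B)
    (hw : side.width ≤ 100 ∧ a ≤ 100 ∧ 500 ≤ z ∧ v.width ≤ z)
    (hcells : ∀ b < (a + 1) * (m * m), b ∈ M.cells)
    (hval : ∀ x < m, ∀ y < m, v.ideal s.mem (x * m + y) 0 ≤ V) :
    M.Reaches B ctx (.fill side a v) s 1 0 (fun mem => Bdd V mem ∧
      (∀ x < m, ∀ y < m, arr m mem a x y = v.ideal s.mem (x * m + y) 0) ∧
      ∀ b, b / (m * m) ≠ a → mem b = s.mem b) := by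
  have haddr : ∀ i, (Expr.const a * (side * side) + .pid).ideal s.mem i 0 = a * (m * m) + i := by
    intro i; simp [hside]
  refine hM.write hB hs (by simp; omega) (by simp [hside]) hmB ?_ ?_ ?_ ?_
  · intro i hi _
    rw [haddr]
    exact hcells _ (by rw [add_mul]; omega)
  · intro i hi k hk _ _ h
    rw [haddr, haddr] at h
    omega
  · intro i hi _
    have hm : 0 < m := by
      rcases Nat.eq_zero_or_pos m with rfl | h
      · simp at hi
      · exact h
    have := hval (i / m) (Nat.div_lt_of_lt_mul hi) (i % m) (Nat.mod_lt _ hm)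
    rwa [mul_comm, Nat.div_add_mod] at this
  · intro mem' hb h1 h2
    refine ⟨hb, fun x hx y hy => ?_, fun b hb => h2 b fun i hi _ => ?_⟩
    · have := h1 (x * m + y) (mul_add_lt_sq hx hy) (by simp)
      rw [haddr] at this
      exact this
    · rw [haddr]
      rintro rfl
      exact hb (div_mod_of_lt hi).1

theorem arr_div {m a x y : ℕ} (hx : x < m) (hy : y < m) :
    (a * (m * m) + (x * m + y)) / (m * m) = a := (div_mod_of_lt (mul_add_lt_sq hx hy)).1

theorem arr_frame {m : ℕ} {mem mem' : ℕ → ℕ} {a c x y : ℕ}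
    (h : ∀ b, b / (m * m) ≠ a → mem' b = mem b) (hac : c ≠ a) (hx : x < m) (hy : y < m) :
    arr m mem' c x y = arr m mem c x y :=
  h _ (by rw [arr_div hx hy]; exact hac)

/-- The row of the entry that processor `pid` works on. -/
def rowExpr : Expr := .pid / .load 24

/-- The column of the entry that processor `pid` works on. -/
def colExpr : Expr := .pid % .load 24

theorem rowExpr_ideal {m : ℕ} {mem : ℕ → ℕ} (h : mem 24 = m) {x y : ℕ} (hy : y < m) (j : ℕ) :
    rowExpr.ideal mem (x * m + y) j = x := by
  simp [rowExpr, h, (div_mod_of_lt hy).1]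

theorem colExpr_ideal {m : ℕ} {mem : ℕ → ℕ} (h : mem 24 = m) {x y : ℕ} (hy : y < m) (j : ℕ) :
    colExpr.ideal mem (x * m + y) j = y := by
  simp [colExpr, h, (div_mod_of_lt hy).2]

@[simp] theorem rowExpr_width : rowExpr.width = 27 := by simp [rowExpr]

@[simp] theorem colExpr_width : colExpr.width = 27 := by simp [colExpr]

/-! ### Tables of majority votes -/

/-- One evaluation of the test for every pair, counted in the array `4`. -/
def voteRound (test : Test) : Prog :=
  .seq (.call (.load 24 * .load 24) 1 (5 * (.load 24 * .load 24) + .pid) test)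
  (.seq (.fill (.load 24) 4 (entry 4 rowExpr colExpr + entry 5 rowExpr colExpr))
  (.set 3 (.load 3 + 1)))

/-- Fill the array `d` with the outcomes of a test. -/
def voteTable (C : ℕ) (test : Test) (d : ℕ) : Prog :=
  .seq (.fill (.load 24) 4 0)
  (.seq (.set 3 0)
  (.seq (.noisy (.load 24 * .load 24) 1 test (forLog C (voteRound test)))
  (.fill (.load 24) d (.less (.load 3) (2 * entry 4 rowExpr colExpr)))))

/-- The duration of the computation of a table. -/
def voteSpan (N : ℕ) : ℕ := 5 * N + 6

/-- The evaluations of processor `i` for a table whose computation starts at time `t`. -/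
def voteBlock (t N i : ℕ) : Finset (ℕ × ℕ) := evaluations (fun l => t + 5 + 5 * l) i N

theorem card_voteBlock (t N i : ℕ) : (voteBlock t N i).card = N :=
  card_evaluations (fun a b h => by
    have h : t + 5 + 5 * a = t + 5 + 5 * b := h
    omega) _ _

-- Each processor is devoted to one test. It evaluates the same primitive in all rounds because, by
-- `hq`, the test does not depend on what the vote modifies: the cells below `20` and the arrays `4`
-- and `5`. The rounds are counted in cell `3`, which provides the threshold of the majority.
open Classical in
theorem Machine.Roomy.voteTable {M : Machine} {V z B : ℕ} (hM : M.Roomy V z) (hB : B ≤ V)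
    {ctx : ℕ → Set Query} {C n N m d : ℕ} {test : Test} {s : State} (hs : Bdd V s.mem)
    (hz : 22 * C + 1000 ≤ z) (hm : 5 ≤ m) (hmB : m * m ≤ B) (hw : test.width ≤ z)
    (hN : N = (n ^ C).size) (hV : 2 ^ (N + 2) ≤ V) (hn : s.mem 20 = n) (h24 : s.mem 24 = m)
    (hd : 1 ≤ d ∧ d ≠ 4 ∧ d ≠ 5 ∧ d ≤ 9) (hcells : ∀ b < 10 * (m * m), b ∈ M.cells)
    {q : ℕ → Query}
    (hq : ∀ mem : ℕ → ℕ, (∀ b, 20 ≤ b → b / (m * m) ≠ 4 → b / (m * m) ≠ 5 → mem b = s.mem b) →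
      ∀ i < m * m, test.ideal mem i 0 = q i)
    (hgood : ∀ i < m * m, ¬ BadBlock (voteBlock s.span N i) M.err) :
    M.Reaches B ctx (_root_.voteTable C test d) s (voteSpan N) (m * m) (fun mem => Bdd V mem ∧
      (∀ x < m, ∀ y < m, arr m mem d x y = if (q (x * m + y)).Holds M.pts then 1 else 0) ∧
      ∀ b, 20 ≤ b → b / (m * m) ≠ 4 → b / (m * m) ≠ 5 → b / (m * m) ≠ d →
        mem b = s.mem b) := by
  have hpow : 2 ^ (N + 2) = 4 * 2 ^ N := by ring
  have hN2 : N < 2 ^ N := Nat.lt_two_pow_self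
  have hnN : n ^ C < 2 ^ N := by rw [hN]; exact Nat.lt_size_self _
  have hm25 : 25 ≤ m * m := by nlinarith
  have hB1 : 1 ≤ B := by omega
  have hcells' : ∀ a < 20, a ∈ M.cells := fun a ha => hcells a (by omega)
  refine Machine.Reaches.of_eq (k := 1 + (1 + ((1 + (N * (3 + 2) + 2)) + 1))) (o := m * m) ?_
    (by unfold voteSpan; ring) rfl
  refine (hM.fill hB hs (m := m) (by simp [h24]) hmB ⟨by simp, by norm_num, by omega, by simp⟩
    (fun b hb => hcells b (by nlinarith)) (by simp)).then fun s₁ e₁ ⟨b₁, a₁, f₁⟩ => ?_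
  refine (hM.assign hB hB1 b₁ (by simp; omega) (hcells' 3 (by norm_num)) (by simp)).then
    fun s₂ e₂ ⟨b₂, u₂⟩ => ?_
  have f₂ : ∀ b, 20 ≤ b → b / (m * m) ≠ 4 → s₂.mem b = s.mem b := fun b hb h4 => by
    rw [u₂, Function.update_of_ne (by omega), f₁ b h4]
  have hdiv : ∀ b < 25, b / (m * m) = 0 := fun b hb => Nat.div_eq_of_lt (by omega)
  have g24 : s₂.mem 24 = m := by
    rw [f₂ 24 (by norm_num) (by rw [hdiv 24 (by norm_num)]; norm_num), h24]
  have g20 : s₂.mem 20 = n := by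
    rw [f₂ 20 (by norm_num) (by rw [hdiv 20 (by norm_num)]; norm_num), hn]
  have c₂ : ∀ x < m, ∀ y < m, arr m s₂.mem 4 x y = 0 := by
    intro x hx y hy
    have h20 : 4 * (m * m) + (x * m + y) ≠ 3 := by omega
    have := a₁ x hx y hy
    unfold arr at this ⊢
    rw [u₂, Function.update_of_ne h20, this]; simp
  -- Clearing, an assignment, the opening of the operations and two steps of loop control precede
  -- the first evaluation. A round has three steps and two of loop control.
  set τ : ℕ → ℕ := fun l => s.span + 5 + 5 * l with hτ
  set I : ℕ → (ℕ → ℕ) → Prop := fun i mem => Bdd V mem ∧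
    (∀ b, 20 ≤ b → b / (m * m) ≠ 4 → b / (m * m) ≠ 5 → mem b = s.mem b) ∧ mem 3 = i ∧
    ∀ x < m, ∀ y < m, arr m mem 4 x y =
      ∑ l ∈ Finset.range i, M.answer (τ l) (x * m + y) (q (x * m + y)) with hI
  have hnoisy : M.Reaches B ctx (.noisy (.load 24 * .load 24) 1 test
      (_root_.forLog C (voteRound test))) s₂ (1 + (N * (3 + 2) + 2)) (m * m) (I N) := by
    have hq₂ := hq s₂.mem fun b hb h4 _ => f₂ b hb h4
    refine hM.noisy hB b₂ (l := 1) ⟨by simp; omega, by simp; omega, hw⟩ (by simp [g24])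
      hmB (fun i _ => by simp) (by have := hM.two_le; omega) ?_ ?_
    · intro i hi j j' hj hj' hh
      obtain rfl : j = j' := by omega
      exact hh
    · intro s₃ ctx' u₃ e₃ hctx
      have hctx' : ∀ i < m * m, q i ∈ ctx' i := fun i hi => by
        rw [← hq₂ i hi]; exact hctx i hi 0 (by norm_num)
      have := hM.forLog hB hB1 (ctx := ctx') (C := C) (n := n) (k := 3)
        (body := voteRound test) (s := s₃) (by omega) (by rw [u₃, g20]) (by omega)
        (hcells' 1 (by norm_num)) I (fun _ _ h => h.1)
        (fun i mem u hu hIm => by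
          obtain ⟨i1, i2, i3, i4⟩ := hIm
          refine ⟨i1.update _ hu, fun b hb h4 h5 => ?_, ?_, fun x hx y hy => ?_⟩
          · rw [Function.update_of_ne (by omega)]; exact i2 b hb h4 h5
          · rw [Function.update_of_ne (by norm_num)]; exact i3
          · have h20 : 4 * (m * m) + (x * m + y) ≠ 1 := by omega
            have := i4 x hx y hy
            unfold arr at this ⊢
            rw [Function.update_of_ne h20]; exact this)
        ?_ ?_
      · rw [← hN] at this
        exact this
      · intro i hi s₄ e₄ ⟨i1, i2, i3, i4⟩
        rw [← hN] at hi
        have k24 : s₄.mem 24 = m := by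
          rw [i2 24 (by norm_num) (by rw [hdiv 24 (by norm_num)]; norm_num)
            (by rw [hdiv 24 (by norm_num)]; norm_num), h24]
        have hspan : s₄.span = τ i := by rw [e₄, e₃, e₂, e₁, hτ]; ring
        have hqi := hq s₄.mem i2
        have haddr : ∀ i, (5 * (Expr.load 24 * .load 24) + .pid).ideal s₄.mem i 0 =
            5 * (m * m) + i := fun i => by simp [k24]
        refine Machine.Reaches.of_eq (k := 1 + (1 + 1)) (o := 0) ?_ rfl rfl
        refine Machine.Reaches.then (k := 1) (Q := fun mem => Bdd V mem ∧
          (∀ x < m, ∀ y < m, arr m mem 5 x y = M.answer (τ i) (x * m + y) (q (x * m + y))) ∧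
          ∀ b, b / (m * m) ≠ 5 → mem b = s₄.mem b) ?_ fun s₅ _ ⟨b₅, a₅, f₅⟩ => ?_
        · refine hM.call hB i1 (by simp; omega) (n := m * m) (by simp [k24]) hmB ?_ ?_ ?_ ?_
          · intro i hi; rw [hqi i hi]; exact hctx' i hi
          · intro i hi; rw [haddr]; exact hcells _ (by omega)
          · intro i _ k _ h; rw [haddr, haddr] at h; omega
          · intro mem' hb h1 h2
            refine ⟨hb, fun x hx y hy => ?_, fun b hb => h2 b fun i hi => ?_⟩
            · have hlt := mul_add_lt_sq hx hy
              have := h1 _ hlt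
              rw [haddr, hqi _ hlt, hspan] at this
              exact this
            · rw [haddr]
              rintro rfl
              exact hb (div_mod_of_lt hi).1
        · have l24 : s₅.mem 24 = m := by
            rw [f₅ 24 (by rw [hdiv 24 (by norm_num)]; norm_num), k24]
          have hv5 : ∀ x < m, ∀ y < m, (entry 4 rowExpr colExpr + entry 5 rowExpr colExpr).ideal
              s₅.mem (x * m + y) 0 = ∑ l ∈ Finset.range (i + 1),
                M.answer (τ l) (x * m + y) (q (x * m + y)) := by
            intro x hx y hy
            rw [Expr.ideal_add, entry_ideal l24, entry_ideal l24, rowExpr_ideal l24 hy,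
              colExpr_ideal l24 hy, a₅ x hx y hy, arr_frame f₅ (by norm_num) hx hy, i4 x hx y hy,
              Finset.sum_range_succ]
          refine (hM.fill hB b₅ (m := m) (by simp [l24]) hmB
            ⟨by simp, by norm_num, by omega, by simp [entry_width]; omega⟩
            (fun b hb => hcells b (by nlinarith)) (fun x hx y hy => by
              rw [hv5 x hx y hy]
              exact (M.sum_answer_le τ _ _ _).trans (by omega))).then
            fun s₆ _ ⟨b₆, a₆, f₆⟩ => ?_
          have k3 : s₆.mem 3 = i := by
            rw [f₆ 3 (by rw [hdiv 3 (by norm_num)]; norm_num),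
              f₅ 3 (by rw [hdiv 3 (by norm_num)]; norm_num), i3]
          have hval : (Expr.load 3 + 1).ideal s₆.mem 0 0 = i + 1 := by simp [k3]
          refine hM.set hB hB1 b₆ (by simp; omega) (hcells' 3 (by norm_num))
            (by rw [hval]; omega) fun b₇ => ?_
          rw [hval] at b₇ ⊢
          refine ⟨⟨b₇, fun b hb h4 h5 => ?_, by simp, fun x hx y hy => ?_⟩, ?_⟩
          · rw [Function.update_of_ne (by omega), f₆ b h4, f₅ b h5, i2 b hb h4 h5]
          · have h20 : 4 * (m * m) + (x * m + y) ≠ 3 := by omega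
            have := a₆ x hx y hy
            rw [hv5 x hx y hy] at this
            unfold arr at this ⊢
            rw [Function.update_of_ne h20, this]
          · rw [Function.update_of_ne (by norm_num),
              f₆ 1 (by rw [hdiv 1 (by norm_num)]; norm_num),
              f₅ 1 (by rw [hdiv 1 (by norm_num)]; norm_num)]
      · rw [u₃]
        refine ⟨b₂, fun b hb h4 _ => f₂ b hb h4, by rw [u₂]; simp, fun x hx y hy => ?_⟩
        rw [c₂ x hx y hy]; simp
  refine (hnoisy.seq (o' := 0) (k' := 1) fun s₃ _ ⟨i1, i2, i3, i4⟩ => ?_).of_eq rfl rfl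
  have k24 : s₃.mem 24 = m := by
    rw [i2 24 (by norm_num) (by rw [hdiv 24 (by norm_num)]; norm_num)
      (by rw [hdiv 24 (by norm_num)]; norm_num), h24]
  have hval : ∀ x < m, ∀ y < m, (Expr.less (.load 3) (2 * entry 4 rowExpr colExpr)).ideal s₃.mem
      (x * m + y) 0 = if (q (x * m + y)).Holds M.pts then 1 else 0 := by
    intro x hx y hy
    rw [Expr.ideal_less, Expr.ideal_mul, entry_ideal k24, rowExpr_ideal k24 hy,
      colExpr_ideal k24 hy, i4 x hx y hy, Expr.ideal_load, Expr.ideal_ofNat, Expr.ideal_ofNat]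
    have := M.majority_iff (τ := τ) (fun a b h => by simp only [hτ] at h; omega)
      (hgood _ (mul_add_lt_sq hx hy)) (q (x * m + y))
    simp only [i3, this]
  refine (hM.fill hB i1 (m := m) (by simp [k24]) hmB
    ⟨by simp, by omega, by omega, by simp [entry_width]; omega⟩
    (fun b hb => hcells b (by nlinarith)) (fun x hx y hy => by
      rw [hval x hx y hy]; have := hM.two_le; split_ifs <;> omega)).mono
    fun mem' ⟨b₄, a₄, f₄⟩ => ⟨b₄, fun x hx y hy => ?_, fun b hb h4 h5 hd' => ?_⟩
  · rw [a₄ x hx y hy, hval x hx y hy]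
  · rw [f₄ b hd', i2 b hb h4 h5]

/-! ### Merge sort of all rows -/

/-- The row of the triple that processor `pid` works on. -/
def tripleRow : Expr := .pid / .load 24 / .load 24

/-- The item of the triple that processor `pid` works on. -/
def tripleItem : Expr := .pid / .load 24 % .load 24

/-- The position of the triple that processor `pid` works on. -/
def triplePos : Expr := .pid % .load 24

/-- The block merged with the block of the item, where the length of blocks is in cell `2`. -/
def siblingExpr : Expr :=
  .ite (tripleItem / .load 2 % 2) (tripleItem / .load 2 - 1) (tripleItem / .load 2 + 1)

/-- Whether the position holds the last predecessor of the item in the sibling block. -/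
def writerExpr (less : Expr → Expr → Expr → Expr) : Expr :=
  .same (triplePos / .load 2) siblingExpr *
    less tripleRow (entry 8 tripleRow triplePos) tripleItem *
    (1 - .less (triplePos + 1) (.load 24) *
      .same ((triplePos + 1) / .load 2) (triplePos / .load 2) *
      less tripleRow (entry 8 tripleRow (triplePos + 1)) tripleItem)

/-- Merge pairs of sorted blocks in all rows: the array `7` holds the ranks of the items in their
blocks, and the array `8` the sorted blocks. -/
def mergeRound (less : Expr → Expr → Expr → Expr) : Prog :=
  .seq (.write (.load 24 * (.load 24 * .load 24)) (writerExpr less)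
    (7 * (.load 24 * .load 24) + .pid / .load 24)
    (entry 7 tripleRow tripleItem + (triplePos + 1 - triplePos / .load 2 * .load 2)))
  (.seq (.set 2 (2 * .load 2))
  (.write (.load 24 * .load 24) 1
    (8 * (.load 24 * .load 24) +
      (rowExpr * .load 24 + (colExpr / .load 2 * .load 2 + entry 7 rowExpr colExpr))) colExpr))

/-- Sort all rows. -/
def sortRows (C : ℕ) (less : Expr → Expr → Expr → Expr) : Prog :=
  .seq (.fill (.load 24) 7 0)
  (.seq (.fill (.load 24) 8 colExpr)
  (.seq (.set 2 1) (forLog C (mergeRound less))))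

theorem triple_div_mod {m s e j : ℕ} (he : e < m) (hj : j < m) :
    ((s * m + e) * m + j) / m / m = s ∧ ((s * m + e) * m + j) / m % m = e ∧
      ((s * m + e) * m + j) % m = j := by
  rw [(div_mod_of_lt hj).1]
  exact ⟨(div_mod_of_lt he).1, (div_mod_of_lt he).2, (div_mod_of_lt hj).2⟩

theorem triple_lt {m s e j : ℕ} (hs : s < m) (he : e < m) (hj : j < m) :
    (s * m + e) * m + j < m * (m * m) := by
  have h : s * m + e + 1 ≤ m * m := mul_add_lt_sq hs he
  have := Nat.mul_le_mul_right m h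
  rw [add_mul, one_mul] at this
  calc _ < (s * m + e) * m + m := by omega
    _ ≤ m * m * m := this
    _ = _ := by ring

theorem exists_triple {m i : ℕ} (hi : i < m * (m * m)) :
    ∃ s < m, ∃ e < m, ∃ j < m, i = (s * m + e) * m + j := by
  have hm : 0 < m := by
    rcases Nat.eq_zero_or_pos m with rfl | h
    · simp at hi
    · exact h
  have h1 : i / m < m * m := Nat.div_lt_of_lt_mul hi
  refine ⟨i / m / m, Nat.div_lt_of_lt_mul h1, i / m % m, Nat.mod_lt _ hm, i % m,
    Nat.mod_lt _ hm, ?_⟩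
  rw [mul_comm (i / m / m) m, Nat.div_add_mod, mul_comm (i / m) m, Nat.div_add_mod]

/-- The ranks and positions of all items for blocks of length `w`. -/
structure BlocksSorted (lt : ℕ → ℕ → ℕ → Prop) (m w : ℕ) (mem : ℕ → ℕ) : Prop where
  rank : ∀ s < m, ∀ e < m, arr m mem 7 s e = blockRank (lt s) m w e
  pos : ∀ s < m, ∀ e < m, arr m mem 8 s (blockPos (lt s) m w e) = e

/-- The expression `less` computes the orders `lt` of the rows on the memory `mem`. -/
def ComputesOrder (less : Expr → Expr → Expr → Expr) (lt : ℕ → ℕ → ℕ → Prop) (m : ℕ)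
    (mem : ℕ → ℕ) : Prop :=
  ∀ (i : ℕ) (a b c : Expr), a.ideal mem i 0 < m → b.ideal mem i 0 < m → c.ideal mem i 0 < m →
    ((less a b c).ideal mem i 0 = 0 ∧ ¬ lt (a.ideal mem i 0) (b.ideal mem i 0) (c.ideal mem i 0) ∨
     (less a b c).ideal mem i 0 = 1 ∧ lt (a.ideal mem i 0) (b.ideal mem i 0) (c.ideal mem i 0))

/-- Products and `1 - x` express conjunction and negation of values `0` and `1`. For `j + 1 = m` the
entry after position `j` is outside of the row, but its factor is then multiplied by zero. -/
theorem writerExpr_ideal {less : Expr → Expr → Expr → Expr} {lt : ℕ → ℕ → ℕ → Prop} {m w : ℕ}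
    {mem : ℕ → ℕ} (hlt : ComputesOrder less lt m mem) (h24 : mem 24 = m) (h2 : mem 2 = w)
    (hA : ∀ s < m, ∀ j < m, arr m mem 8 s j < m) {s e j : ℕ} (hs : s < m) (he : e < m)
    (hj : j < m) :
    (writerExpr less).ideal mem ((s * m + e) * m + j) 0 ≠ 0 ↔
      IsRowOrder.IsWriter m w (lt s) (arr m mem 8 s) e j := by
  obtain ⟨d1, d2, d3⟩ := triple_div_mod (s := s) he hj
  set i := (s * m + e) * m + j with hi
  have r1 : tripleRow.ideal mem i 0 = s := by simp [tripleRow, h24, d1]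
  have r2 : tripleItem.ideal mem i 0 = e := by simp [tripleItem, h24, d2]
  have r3 : triplePos.ideal mem i 0 = j := by simp [triplePos, h24, d3]
  have r4 : siblingExpr.ideal mem i 0 = sibling (e / w) := by
    simp only [siblingExpr, Expr.ideal_ite, Expr.ideal_mod, Expr.ideal_div, r2, Expr.ideal_load,
      Expr.ideal_ofNat, h2, Expr.ideal_sub, Expr.ideal_add, sibling]
    by_cases h : e / w % 2 = 0 <;> simp [h]
  have r5 : ∀ x : Expr, (entry 8 tripleRow x).ideal mem i 0 = arr m mem 8 s (x.ideal mem i 0) :=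
    fun x => by rw [entry_ideal h24, r1]
  have l1 := hlt i tripleRow (entry 8 tripleRow triplePos) tripleItem (by rw [r1]; exact hs)
    (by rw [r5, r3]; exact hA s hs j hj) (by rw [r2]; exact he)
  rw [r1, r2, r5, r3] at l1
  have l2 := hlt i tripleRow (entry 8 tripleRow (triplePos + 1)) tripleItem (by rw [r1]; exact hs)
  rw [r1, r2, r5, Expr.ideal_add, r3, Expr.ideal_ofNat] at l2
  simp only [writerExpr, Expr.ideal_mul, Expr.ideal_sub, Expr.ideal_same, Expr.ideal_less, r4, r3,
    Expr.ideal_div, Expr.ideal_add, Expr.ideal_ofNat, Expr.ideal_load, h2, h24,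
    IsRowOrder.IsWriter]
  by_cases c1 : j / w = sibling (e / w)
  · by_cases c2 : j + 1 < m
    · have l2 := l2 (hA s hs _ c2) he
      rcases l1 with ⟨l1, l1'⟩ | ⟨l1, l1'⟩ <;> rcases l2 with ⟨l2, l2'⟩ | ⟨l2, l2'⟩ <;>
        by_cases c3 : (j + 1) / w = j / w <;>
        simp [l1, l1', l2, l2', ← c1, c2, c3]
    · rcases l1 with ⟨l1, l1'⟩ | ⟨l1, l1'⟩ <;> simp [l1, l1', c1, c2]
  · simp [c1]

/-- Processors are triples of a row, an item and a position. The unique writer of an item adds the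
count in the sibling to its rank, and an item without a writer keeps its rank, which is still
correct. The subsequent write to the new positions is exclusive because `blockPos` is injective. -/
theorem Machine.Roomy.mergeRound {M : Machine} {V z B : ℕ} (hM : M.Roomy V z) (hB : B ≤ V)
    {ctx : ℕ → Set Query} {m w : ℕ} {less : Expr → Expr → Expr → Expr}
    {lt : ℕ → ℕ → ℕ → Prop} {s : State} (hs : Bdd V s.mem)
    (hz : 1000 ≤ z) (hm : 5 ≤ m) (hmB : m * (m * m) ≤ B) (hwidth : (writerExpr less).width ≤ z)
    (hw : 0 < w) (hwV : 2 * w ≤ V) (h24 : s.mem 24 = m) (h2 : s.mem 2 = w)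
    (hcells : ∀ b < 10 * (m * m), b ∈ M.cells)
    (hlt : ComputesOrder less lt m s.mem) (hord : ∀ s < m, IsRowOrder m (lt s))
    (hsort : BlocksSorted lt m w s.mem) :
    M.Reaches B ctx (_root_.mergeRound less) s 3 0 (fun mem => Bdd V mem ∧ mem 2 = 2 * w ∧
      BlocksSorted lt m (2 * w) mem ∧
      ∀ b, b ≠ 2 → b / (m * m) ≠ 7 → b / (m * m) ≠ 8 → mem b = s.mem b) := by
  have hm25 : 25 ≤ m * m := by nlinarith
  have hmm : m * m ≤ m * (m * m) := Nat.le_mul_of_pos_left _ (by omega)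
  have hB1 : 1 ≤ B := by omega
  have hmV : m ≤ V := by nlinarith
  have hA : ∀ r < m, ∀ j < m, arr m s.mem 8 r j < m := by
    intro r hr j hj
    obtain ⟨e, he, rfl⟩ := (hord r hr).exists_blockPos hw hj
    rw [hsort.pos r hr e he]; exact he
  have haddr : ∀ r e j, j < m →
      (7 * (Expr.load 24 * .load 24) + .pid / .load 24).ideal s.mem ((r * m + e) * m + j) 0 =
      7 * (m * m) + (r * m + e) := by
    intro r e j hj
    simp [h24, (div_mod_of_lt (x := r * m + e) hj).1]
  have hdiv0 : ∀ b < 25, b / (m * m) = 0 := fun b hb => Nat.div_eq_of_lt (by omega)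
  have hcount : ∀ r < m, ∀ e < m, ∀ j < m,
      IsRowOrder.IsWriter m w (lt r) (arr m s.mem 8 r) e j →
      j + 1 - j / w * w = countIn (lt r) m w (sibling (e / w)) e := by
    intro r hr e he j hj hW
    have := IsRowOrder.IsWriter.eq (hord r hr) hw (hsort.pos r hr) he hj hW
    rw [hW.1, this]; omega
  have hval : ∀ r < m, ∀ e < m, ∀ j < m,
      IsRowOrder.IsWriter m w (lt r) (arr m s.mem 8 r) e j →
      (entry 7 tripleRow tripleItem + (triplePos + 1 - triplePos / .load 2 * .load 2)).ideal
        s.mem ((r * m + e) * m + j) 0 = blockRank (lt r) m (2 * w) e := by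
    intro r hr e he j hj hW
    obtain ⟨d1, d2, d3⟩ := triple_div_mod (s := r) he hj
    rw [IsRowOrder.blockRank_two_mul, ← hcount r hr e he j hj hW, ← hsort.rank r hr e he]
    simp [entry_ideal h24, tripleRow, tripleItem, triplePos, h24, h2, d1, d2, d3]
  have hrank : ∀ r < m, ∀ e < m, blockRank (lt r) m (2 * w) e ≤ V := fun r hr e he => by
    have := ((hord r hr).blockRank_lt (w := 2 * w) (by omega) he).2
    omega
  refine Machine.Reaches.of_eq (k := 1 + (1 + 1)) (o := 0) ?_ rfl rfl
  refine Machine.Reaches.then (k := 1) (Q := fun mem => Bdd V mem ∧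
    (∀ r < m, ∀ e < m, arr m mem 7 r e = blockRank (lt r) m (2 * w) e) ∧
    ∀ b, b / (m * m) ≠ 7 → mem b = s.mem b) ?_ fun s₁ _ ⟨b₁, a₁, f₁⟩ => ?_
  · refine hM.write hB hs (n := m * (m * m)) ⟨by simp; omega, hwidth, by simp; omega,
      by simp [entry_width, tripleRow, tripleItem, triplePos]; omega⟩ (by simp [h24]) hmB ?_ ?_ ?_ ?_
    · intro i hi _
      obtain ⟨r, hr, e, he, j, hj, rfl⟩ := exists_triple hi
      rw [haddr r e j hj]
      have := mul_add_lt_sq hr he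
      exact hcells _ (by omega)
    · intro i hi k hk hgi hgk heq
      obtain ⟨r, hr, e, he, j, hj, rfl⟩ := exists_triple hi
      obtain ⟨r', hr', e', he', j', hj', rfl⟩ := exists_triple hk
      rw [haddr r e j hj, haddr r' e' j' hj'] at heq
      have heq : r * m + e = r' * m + e' := by omega
      obtain rfl : r = r' := by
        rw [← (div_mod_of_lt (x := r) he).1, heq, (div_mod_of_lt he').1]
      obtain rfl : e = e' := by omega
      rw [writerExpr_ideal hlt h24 h2 hA hr he hj] at hgi
      rw [writerExpr_ideal hlt h24 h2 hA hr he hj'] at hgk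
      have h1 := IsRowOrder.IsWriter.eq (hord r hr) hw (hsort.pos r hr) he hj hgi
      have h2 := IsRowOrder.IsWriter.eq (hord r hr) hw (hsort.pos r hr) he hj' hgk
      omega
    · intro i hi hg
      obtain ⟨r, hr, e, he, j, hj, rfl⟩ := exists_triple hi
      rw [writerExpr_ideal hlt h24 h2 hA hr he hj] at hg
      rw [hval r hr e he j hj hg]
      exact hrank r hr e he
    · intro mem' hb h1 h2'
      refine ⟨hb, fun r hr e he => ?_, fun b hb => h2' b fun i hi _ => ?_⟩
      · by_cases hc : countIn (lt r) m w (sibling (e / w)) e = 0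
        · have : mem' (7 * (m * m) + (r * m + e)) = s.mem (7 * (m * m) + (r * m + e)) := by
            refine h2' _ fun i hi hg heq => ?_
            obtain ⟨r', hr', e', he', j, hj, rfl⟩ := exists_triple hi
            rw [haddr r' e' j hj] at heq
            have heq : r' * m + e' = r * m + e := by omega
            obtain rfl : r' = r := by
              rw [← (div_mod_of_lt (x := r') he').1, heq, (div_mod_of_lt he).1]
            obtain rfl : e' = e := by omega
            rw [writerExpr_ideal hlt h24 h2 hA hr he hj] at hg
            have h3 := IsRowOrder.IsWriter.eq (hord r' hr) hw (hsort.pos r' hr) he hj hg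
            have h4 := Nat.div_mul_le_self j w
            rw [hg.1] at h4
            omega
          unfold arr
          rw [this, IsRowOrder.blockRank_two_mul, hc, add_zero]
          exact hsort.rank r hr e he
        · obtain ⟨j, hj, hW⟩ := IsRowOrder.exists_isWriter (hord r hr) hw (hsort.pos r hr) he hc
          have := h1 _ (triple_lt hr he hj) ((writerExpr_ideal hlt h24 h2 hA hr he hj).2 hW)
          rw [haddr r e j hj, hval r hr e he j hj hW] at this
          exact this
      · obtain ⟨r, hr, e, he, j, hj, rfl⟩ := exists_triple hi
        rw [haddr r e j hj]
        rintro rfl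
        exact hb (arr_div hr he)
  have g2 : s₁.mem 2 = w := by rw [f₁ 2 (by rw [hdiv0 2 (by norm_num)]; norm_num), h2]
  have hv2 : (2 * Expr.load 2).ideal s₁.mem 0 0 = 2 * w := by simp [g2]
  refine (hM.assign hB hB1 b₁ (by simp; omega) (hcells 2 (by omega)) (by rw [hv2]; exact hwV)).then
    fun s₂ _ ⟨b₂, u₂⟩ => ?_
  rw [hv2] at u₂
  have f₂ : ∀ b, b ≠ 2 → b / (m * m) ≠ 7 → s₂.mem b = s.mem b := fun b hb h7 => by
    rw [u₂, Function.update_of_ne hb, f₁ b h7]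
  have k2 : s₂.mem 2 = 2 * w := by rw [u₂]; simp
  have k24 : s₂.mem 24 = m := by
    rw [f₂ 24 (by norm_num) (by rw [hdiv0 24 (by norm_num)]; norm_num), h24]
  have a₂ : ∀ r < m, ∀ e < m, arr m s₂.mem 7 r e = blockRank (lt r) m (2 * w) e := by
    intro r hr e he
    have h2 : 7 * (m * m) + (r * m + e) ≠ 2 := by omega
    have := a₁ r hr e he
    unfold arr at this ⊢
    rw [u₂, Function.update_of_ne h2, this]
  have haddr₂ : ∀ r < m, ∀ e < m, (8 * (Expr.load 24 * .load 24) + (rowExpr * .load 24 +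
      (colExpr / .load 2 * .load 2 + entry 7 rowExpr colExpr))).ideal s₂.mem (r * m + e) 0 =
      8 * (m * m) + (r * m + blockPos (lt r) m (2 * w) e) := by
    intro r hr e he
    simp only [Expr.ideal_add, Expr.ideal_mul, Expr.ideal_div, Expr.ideal_ofNat, Expr.ideal_load,
      k24, k2, rowExpr_ideal k24 he, colExpr_ideal k24 he, entry_ideal k24, a₂ r hr e he, blockPos]
  have hpair : ∀ {i}, i < m * m → ∃ r < m, ∃ e < m, i = r * m + e := fun {i} hi =>
    ⟨i / m, Nat.div_lt_of_lt_mul hi, i % m, Nat.mod_lt _ (by omega), by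
      rw [mul_comm, Nat.div_add_mod]⟩
  have hpos : ∀ r < m, ∀ e < m, blockPos (lt r) m (2 * w) e < m := fun r hr e he =>
    ((hord r hr).blockRank_lt (by omega) he).1
  refine hM.write hB b₂ (n := m * m) (by simp [entry_width]; omega) (by simp [k24]) (by omega)
    ?_ ?_ ?_ ?_
  · intro i hi _
    obtain ⟨r, hr, e, he, rfl⟩ := hpair hi
    rw [haddr₂ r hr e he]
    have := mul_add_lt_sq hr (hpos r hr e he)
    exact hcells _ (by omega)
  · intro i hi k hk _ _ heq
    obtain ⟨r, hr, e, he, rfl⟩ := hpair hi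
    obtain ⟨r', hr', e', he', rfl⟩ := hpair hk
    rw [haddr₂ r hr e he, haddr₂ r' hr' e' he'] at heq
    have heq : r * m + blockPos (lt r) m (2 * w) e = r' * m + blockPos (lt r') m (2 * w) e' := by
      omega
    obtain rfl : r = r' := by
      rw [← (div_mod_of_lt (x := r) (hpos r hr e he)).1, heq,
        (div_mod_of_lt (hpos r' hr' e' he')).1]
    rw [(hord r hr).blockPos_injective (w := 2 * w) (by omega) he he' (by omega)]
  · intro i hi _
    obtain ⟨r, hr, e, he, rfl⟩ := hpair hi
    rw [colExpr_ideal k24 he]; omega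
  · intro mem' hb h1 h2'
    have hf : ∀ b, b / (m * m) ≠ 8 → mem' b = s₂.mem b := fun b hb8 => h2' b fun i hi _ => by
      obtain ⟨r, hr, e, he, rfl⟩ := hpair hi
      rw [haddr₂ r hr e he]
      rintro rfl
      exact hb8 (arr_div hr (hpos r hr e he))
    refine ⟨hb, by rw [hf 2 (by rw [hdiv0 2 (by norm_num)]; norm_num), k2],
      ⟨fun r hr e he => ?_, fun r hr e he => ?_⟩, fun b hb2 h7 h8 => by rw [hf b h8, f₂ b hb2 h7]⟩
    · rw [arr_frame hf (by norm_num) hr he, a₂ r hr e he]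
    · have := h1 _ (mul_add_lt_sq hr he) (by simp)
      rw [haddr₂ r hr e he, colExpr_ideal k24 he] at this
      exact this

/-- The duration of sorting. -/
def sortSpan (N : ℕ) : ℕ := 5 * N + 5

/-- Blocks of length one, with all ranks zero and items in their natural places, are doubled `N`
times until a block contains a whole row. The comparison is evaluated again in every round, so `hlt`
allows for all changes of the arrays `7` and `8`. -/
theorem Machine.Roomy.sortRows {M : Machine} {V z B : ℕ} (hM : M.Roomy V z) (hB : B ≤ V)
    {ctx : ℕ → Set Query} {C n N m : ℕ} {less : Expr → Expr → Expr → Expr}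
    {lt : ℕ → ℕ → ℕ → Prop} {s : State} (hs : Bdd V s.mem)
    (hz : 22 * C + 1000 ≤ z) (hm : 5 ≤ m) (hmB : m * (m * m) ≤ B)
    (hwidth : (writerExpr less).width ≤ z)
    (hN : N = (n ^ C).size) (hV : 2 ^ (N + 2) ≤ V) (hmN : m ≤ 2 ^ N)
    (hn : s.mem 20 = n) (h24 : s.mem 24 = m) (hcells : ∀ b < 10 * (m * m), b ∈ M.cells)
    (hlt : ∀ mem : ℕ → ℕ,
      (∀ b, 20 ≤ b → b / (m * m) ≠ 7 → b / (m * m) ≠ 8 → mem b = s.mem b) →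
      ComputesOrder less lt m mem)
    (hord : ∀ s < m, IsRowOrder m (lt s)) :
    M.Reaches B ctx (_root_.sortRows C less) s (sortSpan N) 0 (fun mem => Bdd V mem ∧
      (∀ b, 20 ≤ b → b / (m * m) ≠ 7 → b / (m * m) ≠ 8 → mem b = s.mem b) ∧
      ∀ r < m, (∀ j < m, arr m mem 8 r j < m) ∧ (∀ e < m, ∃ j < m, arr m mem 8 r j = e) ∧
        ∀ j < m, ∀ j' < m, lt r (arr m mem 8 r j) (arr m mem 8 r j') ↔ j < j') := by
  have hpow : 2 ^ (N + 2) = 4 * 2 ^ N := by ring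
  have hnN : n ^ C < 2 ^ N := by rw [hN]; exact Nat.lt_size_self _
  have hm25 : 25 ≤ m * m := by nlinarith
  have hmm : m * m ≤ m * (m * m) := Nat.le_mul_of_pos_left _ (by omega)
  have hB1 : 1 ≤ B := by omega
  have hdiv0 : ∀ b < 25, b / (m * m) = 0 := fun b hb => Nat.div_eq_of_lt (by omega)
  refine Machine.Reaches.of_eq (k := 1 + (1 + (1 + (N * (3 + 2) + 2)))) (o := 0) ?_
    (by unfold sortSpan; ring) rfl
  refine (hM.fill hB hs (m := m) (by simp [h24]) (by omega)
    ⟨by simp, by norm_num, by omega, by simp⟩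
    (fun b hb => hcells b (by nlinarith)) (by simp)).then fun s₁ _ ⟨b₁, a₁, f₁⟩ => ?_
  have k24 : s₁.mem 24 = m := by rw [f₁ 24 (by rw [hdiv0 24 (by norm_num)]; norm_num), h24]
  refine (hM.fill hB b₁ (m := m) (by simp [k24]) (by omega)
    ⟨by simp, by norm_num, by omega, by simp; omega⟩ (fun b hb => hcells b (by nlinarith))
    (fun x hx y hy => by rw [colExpr_ideal k24 hy]; omega)).then fun s₂ _ ⟨b₂, a₂, f₂⟩ => ?_
  refine (hM.assign hB hB1 b₂ (by simp; omega) (hcells 2 (by omega))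
    (by simpa using hM.two_le.trans' (by norm_num))).then fun s₃ _ ⟨b₃, u₃⟩ => ?_
  rw [Expr.ideal_ofNat] at u₃
  have f₃ : ∀ b, 20 ≤ b → b / (m * m) ≠ 7 → b / (m * m) ≠ 8 → s₃.mem b = s.mem b :=
    fun b hb h7 h8 => by rw [u₃, Function.update_of_ne (by omega), f₂ b h8, f₁ b h7]
  have small : ∀ {mem : ℕ → ℕ},
      (∀ b, 20 ≤ b → b / (m * m) ≠ 7 → b / (m * m) ≠ 8 → mem b = s.mem b) →
      mem 24 = m := fun h => by
    rw [h 24 (by norm_num) (by rw [hdiv0 24 (by norm_num)]; norm_num)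
      (by rw [hdiv0 24 (by norm_num)]; norm_num), h24]
  have upd : ∀ {mem : ℕ → ℕ} (a v c x y : ℕ), a < 25 → 1 ≤ c →
      arr m (Function.update mem a v) c x y = arr m mem c x y := fun a v c x y ha hc => by
    unfold arr
    rw [Function.update_of_ne]
    have : m * m ≤ c * (m * m) := Nat.le_mul_of_pos_left _ hc
    omega
  set I : ℕ → (ℕ → ℕ) → Prop := fun i mem => Bdd V mem ∧
    (∀ b, 20 ≤ b → b / (m * m) ≠ 7 → b / (m * m) ≠ 8 → mem b = s.mem b) ∧ mem 2 = 2 ^ i ∧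
    BlocksSorted lt m (2 ^ i) mem with hI
  have := hM.forLog hB hB1 (ctx := ctx) (C := C) (n := n) (k := 3)
    (body := _root_.mergeRound less) (s := s₃) (by omega)
    (by rw [f₃ 20 (by norm_num) (by rw [hdiv0 20 (by norm_num)]; norm_num)
      (by rw [hdiv0 20 (by norm_num)]; norm_num), hn]) (by omega) (hcells 1 (by omega)) I
    (fun _ _ h => h.1)
    (fun i mem v hv ⟨i1, i2, i3, i4, i5⟩ => ⟨i1.update _ hv,
      fun b hb h7 h8 => by rw [Function.update_of_ne (by omega)]; exact i2 b hb h7 h8,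
      by rw [Function.update_of_ne (by norm_num)]; exact i3,
      fun r hr e he => by rw [upd _ _ _ _ _ (by norm_num) (by norm_num)]; exact i4 r hr e he,
      fun r hr e he => by rw [upd _ _ _ _ _ (by norm_num) (by norm_num)]; exact i5 r hr e he⟩)
    ?_ ?_
  · rw [← hN] at this
    refine this.mono fun mem ⟨i1, i2, i3, i4⟩ => ⟨i1, i2, fun r hr => ?_⟩
    exact (hord r hr).sorted_of_le hmN (i4.pos r hr)
  · intro i hi s₄ _ ⟨i1, i2, i3, i4⟩
    rw [← hN] at hi
    have hi2 : 2 * 2 ^ i ≤ 2 ^ N := by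
      rw [← pow_succ']; exact Nat.pow_le_pow_right (by norm_num) hi
    refine (hM.mergeRound hB i1 (w := 2 ^ i) (by omega) hm hmB hwidth (by positivity) (by omega)
      (small i2) i3 hcells (hlt _ i2) hord i4).mono fun mem ⟨j1, j2, j3, j4⟩ =>
      ⟨⟨j1, fun b hb h7 h8 => ?_, by rw [j2, pow_succ'], by rw [pow_succ']; exact j3⟩, ?_⟩
    · rw [j4 b (by omega) h7 h8, i2 b hb h7 h8]
    · exact j4 1 (by norm_num) (by rw [hdiv0 1 (by norm_num)]; norm_num)
        (by rw [hdiv0 1 (by norm_num)]; norm_num)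
  · have hrank : ∀ r < m, ∀ e < m, blockRank (lt r) m (2 ^ 0) e = 0 := fun r hr e he => by
      have := ((hord r hr).blockRank_lt (w := 2 ^ 0) (by norm_num) he).2
      omega
    refine ⟨b₃, f₃, by rw [u₃]; simp, fun r hr e he => ?_, fun r hr e he => ?_⟩
    · rw [u₃, upd _ _ _ _ _ (by norm_num) (by norm_num), arr_frame f₂ (by norm_num) hr he,
        a₁ r hr e he, hrank r hr e he]
      simp
    · rw [blockPos, hrank r hr e he, u₃, upd _ _ _ _ _ (by norm_num) (by norm_num)]
      simp only [pow_zero, Nat.div_one, mul_one, add_zero]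
      rw [a₂ r hr e he, colExpr_ideal k24 he]

/-! ### The construction algorithm -/

/-- The side of the arrays, computed from the input. -/
def sideExpr : Expr := .load 1 + .load 2 + .load 3 + 20

/-- Copy the records of the edges to the array `1`, and write the header. -/
def setup : Prog :=
  .seq (.fill sideExpr 1 (.load (5 + (4 * (.pid / sideExpr) + .pid % sideExpr))))
  (.seq (.set 24 sideExpr)
  (.seq (.set 20 (.load 0))
  (.seq (.set 21 (.load 1))
  (.seq (.set 22 (.load 2)) (.set 23 (.load 4))))))

/-- The left endpoint, the right endpoint and the upper face of an edge. -/
def endpointExpr : Expr :=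
  .ite (entry 2 (entry 1 rowExpr 0) (entry 1 rowExpr 1)) (entry 1 rowExpr colExpr)
    (.ite (.less colExpr 2) (entry 1 rowExpr (1 - colExpr)) (entry 1 rowExpr 3))

/-- The choice between three alternatives in the comparison of two edges. -/
def belowCase (x y z : Expr) : Expr :=
  .ite (.same (entry 9 rowExpr 0) (entry 9 colExpr 0)) x
    (.ite (entry 2 (entry 9 colExpr 0) (entry 9 rowExpr 0)) y z)

/-- The comparison of two edges. -/
def belowTest : Test :=
  .ccw (belowCase (entry 9 rowExpr 0) (entry 9 colExpr 1) (entry 9 rowExpr 0))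
    (belowCase (entry 9 rowExpr 1) (entry 9 colExpr 0) (entry 9 rowExpr 1))
    (belowCase (entry 9 colExpr 1) (entry 9 rowExpr 0) (entry 9 colExpr 0))

/-- Whether an item belongs to a row. -/
def inRowExpr : Expr :=
  .ite (.same rowExpr (.load 24 - 1)) (.less colExpr (.load 21))
    (.less colExpr (.load 22) * entry 2 (entry 9 colExpr 0) rowExpr *
      (1 - entry 2 (entry 9 colExpr 1) rowExpr))

/-- The comparison of two items of a row. -/
def rowLess (s x y : Expr) : Expr :=
  .ite (entry 6 s x)
    (.ite (entry 6 s y)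
      (.ite (.same s (.load 24 - 1))
        (.ite (entry 2 x y) 1 (.ite (entry 2 y x) 0 (.less x y)))
        (entry 3 x y))
      1)
    (.ite (entry 6 s y) 0 (.less x y))

/-- The construction algorithm. -/
def buildProg (C : ℕ) : Prog :=
  .seq setup
  (.seq (voteTable C (.xLess rowExpr colExpr) 2)
  (.seq (.fill (.load 24) 9 endpointExpr)
  (.seq (voteTable C belowTest 3)
  (.seq (.fill (.load 24) 6 inRowExpr)
  (sortRows C rowLess)))))

/-- The duration of the construction. -/
def buildSpan (N : ℕ) : ℕ := 8 + 2 * voteSpan N + sortSpan N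

theorem arr_keep {m : ℕ} (hm : 5 ≤ m) {mem mem' : ℕ → ℕ} {c x y : ℕ} (hc : 1 ≤ c)
    (h : ∀ b, 20 ≤ b → b / (m * m) = c → mem' b = mem b) (hx : x < m) (hy : y < m) :
    arr m mem' c x y = arr m mem c x y :=
  h _ (by nlinarith) (arr_div hx hy)

namespace PlanarSubdivision

variable {S : PlanarSubdivision}

theorem input_le {n : ℕ} (h : S.size ≤ n) (a : ℕ) : S.input n a ≤ n := by
  have hsz : S.size = S.nv + S.ne + S.nf := rfl
  unfold input
  split
  · exact le_rfl
  · omega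
  · omega
  · omega
  · have := S.outer.2; omega
  · split_ifs with hb
    · split
      · have := (S.src ⟨_, hb⟩).2; omega
      · have := (S.dst ⟨_, hb⟩).2; omega
      · have := (S.leftFace ⟨_, hb⟩).2; omega
      · have := (S.rightFace ⟨_, hb⟩).2; omega
    · exact Nat.zero_le _

/-- The copy into the array `1` also reads words that are not part of the record of its row. They
are nevertheless below the side of the arrays, so they are valid indices. -/
theorem input_lt (n a : ℕ) : S.input n (5 + a) < S.size + 20 := by
  have hsz : S.size = S.nv + S.ne + S.nf := rfl
  rw [add_comm]
  simp only [input]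
  split_ifs with hb
  · split
    · have := (S.src ⟨_, hb⟩).2; omega
    · have := (S.dst ⟨_, hb⟩).2; omega
    · have := (S.leftFace ⟨_, hb⟩).2; omega
    · have := (S.rightFace ⟨_, hb⟩).2; omega
  · omega

theorem input_edge (n : ℕ) (e : Fin S.ne) :
    S.input n (5 + (4 * e + 0)) = S.src e ∧ S.input n (5 + (4 * e + 1)) = S.dst e ∧
      S.input n (5 + (4 * e + 2)) = S.leftFace e ∧
      S.input n (5 + (4 * e + 3)) = S.rightFace e := by
  have hd : ∀ y < 4, (4 * (e : ℕ) + y) / 4 = e := fun y hy => by omega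
  have hr : ∀ y < 4, (4 * (e : ℕ) + y) % 4 = y := fun y hy => by omega
  have he : ∀ y < 4, ∀ h, (⟨(4 * (e : ℕ) + y) / 4, h⟩ : Fin S.ne) = e :=
    fun y hy h => Fin.ext (hd y hy)
  refine ⟨?_, ?_, ?_, ?_⟩
  · rw [add_comm, input, dif_pos (by have := e.2; omega)]
    have h : 4 * (e : ℕ) / 4 = e ∧ 4 * (e : ℕ) % 4 = 0 := by omega
    simp only [h.1, h.2, Fin.eta]
  · rw [add_comm, input, dif_pos (by rw [hd 1 (by norm_num)]; exact e.2)]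
    simp only [he 1 (by norm_num), hr 1 (by norm_num)]
  · rw [add_comm, input, dif_pos (by rw [hd 2 (by norm_num)]; exact e.2)]
    simp only [he 2 (by norm_num), hr 2 (by norm_num)]
  · rw [add_comm, input, dif_pos (by rw [hd 3 (by norm_num)]; exact e.2)]
    simp only [he 3 (by norm_num), hr 3 (by norm_num)]

/-- The header of the data structure. -/
structure Header (S : PlanarSubdivision) (n m : ℕ) (mem : ℕ → ℕ) : Prop where
  size : mem 20 = n
  nv : mem 21 = S.nv
  ne : mem 22 = S.ne
  outer : mem 23 = S.outer
  side : mem 24 = m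

theorem Header.congr {n m : ℕ} (hm : 5 ≤ m) {mem mem' : ℕ → ℕ} (h : S.Header n m mem)
    (hf : ∀ b, 20 ≤ b → b / (m * m) = 0 → mem' b = mem b) : S.Header n m mem' := by
  have hd : ∀ b < 25, b / (m * m) = 0 := fun b hb => Nat.div_eq_of_lt (by nlinarith)
  exact ⟨by rw [hf 20 (by norm_num) (hd _ (by norm_num)), h.size],
    by rw [hf 21 (by norm_num) (hd _ (by norm_num)), h.nv],
    by rw [hf 22 (by norm_num) (hd _ (by norm_num)), h.ne],
    by rw [hf 23 (by norm_num) (hd _ (by norm_num)), h.outer],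
    by rw [hf 24 (by norm_num) (hd _ (by norm_num)), h.side]⟩

/-- The records of the edges are in the array `1`. -/
structure Records (S : PlanarSubdivision) (m : ℕ) (mem : ℕ → ℕ) : Prop where
  lt : ∀ x < m, ∀ y < m, arr m mem 1 x y < m
  src : ∀ e : Fin S.ne, arr m mem 1 e 0 = S.src e
  dst : ∀ e : Fin S.ne, arr m mem 1 e 1 = S.dst e
  leftFace : ∀ e : Fin S.ne, arr m mem 1 e 2 = S.leftFace e
  rightFace : ∀ e : Fin S.ne, arr m mem 1 e 3 = S.rightFace e

/-- The endpoints and upper faces of the edges are in the array `9`. -/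
structure Endpoints (S : PlanarSubdivision) (m : ℕ) (mem : ℕ → ℕ) : Prop where
  lt : ∀ x < m, ∀ y < m, arr m mem 9 x y < m
  left : ∀ e : Fin S.ne, arr m mem 9 e 0 = S.left e
  right : ∀ e : Fin S.ne, arr m mem 9 e 1 = S.right e
  upper : ∀ e : Fin S.ne, arr m mem 9 e 2 = S.upper e

theorem Endpoints.congr {m : ℕ} (hm : S.size + 20 = m) {mem mem' : ℕ → ℕ}
    (h : S.Endpoints m mem) (hf : ∀ b, 20 ≤ b → b / (m * m) = 9 → mem' b = mem b) :
    S.Endpoints m mem' := by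
  have hsz : S.size = S.nv + S.ne + S.nf := rfl
  have key : ∀ x < m, ∀ y < m, arr m mem' 9 x y = arr m mem 9 x y := fun x hx y hy =>
    arr_keep (by omega) (by norm_num) hf hx hy
  exact ⟨fun x hx y hy => by rw [key x hx y hy]; exact h.lt x hx y hy,
    fun e => by rw [key e (by omega) 0 (by omega), h.left],
    fun e => by rw [key e (by omega) 1 (by omega), h.right],
    fun e => by rw [key e (by omega) 2 (by omega), h.upper]⟩

/-- Values are read from the memory before the step, so the parallel copy cannot disturb its own
source. The header overwrites the input cells `20` to `24` only after the records have been copied.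
-/
theorem setup_reaches {M : Machine} {V z B n m : ℕ} (hM : M.Roomy V z) (hB : B ≤ V)
    {ctx : ℕ → Set Query} (hz : 1000 ≤ z) (hm : S.size + 20 = m) (hmB : m * m ≤ B)
    (hn : S.size ≤ n) (hnV : n ≤ V) (hcells : ∀ b < 10 * (m * m), b ∈ M.cells) {s : State}
    (hs : s.mem = S.input n) :
    M.Reaches B ctx setup s 6 0 (fun mem => Bdd V mem ∧ S.Header n m mem ∧ S.Records m mem) := by
  have hsz : S.size = S.nv + S.ne + S.nf := rfl
  have hm25 : 25 ≤ m * m := by nlinarith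
  have hmV : m ≤ V := by nlinarith
  have hB1 : 1 ≤ B := by omega
  have hbd : Bdd V s.mem := fun a => by rw [hs]; exact (input_le hn a).trans hnV
  have hside : ∀ i, sideExpr.ideal s.mem i 0 = m := fun i => by
    simp [sideExpr, hs, input]; omega
  have hsw : sideExpr.width = 32 := by simp [sideExpr]
  refine Machine.Reaches.of_eq (k := 1 + (1 + (1 + (1 + (1 + 1))))) (o := 0) ?_ rfl rfl
  refine (hM.fill hB hbd (m := m) hside hmB
    ⟨by omega, by norm_num, by omega, by simp [hsw]; omega⟩
    (fun b hb => hcells b (by nlinarith)) (fun x hx y hy => by rw [Expr.ideal_load]; exact hbd _)).then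
    fun s₁ _ ⟨b₁, a₁, f₁⟩ => ?_
  have g₁ : ∀ b < 25, s₁.mem b = S.input n b := fun b hb => by
    rw [f₁ b (by rw [Nat.div_eq_of_lt (by omega)]; norm_num), hs]
  have hv₁ : sideExpr.ideal s₁.mem 0 0 = m := by
    simp [sideExpr, g₁ 1 (by norm_num), g₁ 2 (by norm_num), g₁ 3 (by norm_num), input]; omega
  refine (hM.assign hB hB1 b₁ (by omega) (hcells 24 (by omega)) (by omega)).then
    fun s₂ _ ⟨b₂, u₂⟩ => ?_
  rw [hv₁] at u₂
  refine (hM.assign hB hB1 b₂ (by simp; omega) (hcells 20 (by omega)) (by rw [Expr.ideal_load]; exact b₂ _)).then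
    fun s₃ _ ⟨b₃, u₃⟩ => ?_
  refine (hM.assign hB hB1 b₃ (by simp; omega) (hcells 21 (by omega)) (by rw [Expr.ideal_load]; exact b₃ _)).then
    fun s₄ _ ⟨b₄, u₄⟩ => ?_
  refine (hM.assign hB hB1 b₄ (by simp; omega) (hcells 22 (by omega)) (by rw [Expr.ideal_load]; exact b₄ _)).then
    fun s₅ _ ⟨b₅, u₅⟩ => ?_
  refine (hM.assign hB hB1 b₅ (by simp; omega) (hcells 23 (by omega)) (by rw [Expr.ideal_load]; exact b₅ _)).mono
    fun mem ⟨b₆, u₆⟩ => ?_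
  have hcell : ∀ b, mem b = if b = 23 then S.input n 4 else if b = 22 then S.input n 2 else
      if b = 21 then S.input n 1 else if b = 20 then S.input n 0 else if b = 24 then m else
      s₁.mem b := by
    intro b
    simp [u₆, u₅, u₄, u₃, u₂, Function.update_apply, g₁]
  have harr : ∀ x < m, ∀ y < m, arr m mem 1 x y = S.input n (5 + (4 * x + y)) := by
    intro x hx y hy
    have h1 : arr m mem 1 x y = arr m s₁.mem 1 x y := by
      unfold arr
      rw [hcell]
      have : 25 ≤ 1 * (m * m) + (x * m + y) := by omega
      rw [if_neg (by omega), if_neg (by omega), if_neg (by omega), if_neg (by omega),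
        if_neg (by omega)]
    rw [h1, a₁ x hx y hy]
    rw [Expr.ideal_load, hs]
    simp only [Expr.ideal_add, Expr.ideal_mul, Expr.ideal_div, Expr.ideal_mod, Expr.ideal_pid,
      Expr.ideal_ofNat, ← hs, hside, div_mod_of_lt hy]
  refine ⟨b₆, ⟨by simp [hcell, input], by simp [hcell, input], by simp [hcell, input],
    by simp [hcell, input], by simp [hcell]⟩, fun x hx y hy => ?_, fun e => ?_, fun e => ?_,
    fun e => ?_, fun e => ?_⟩
  · rw [harr x hx y hy, ← hm]; exact input_lt _ _
  · rw [harr e (by omega) 0 (by omega)]; exact (input_edge n e).1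
  · rw [harr e (by omega) 1 (by omega)]; exact (input_edge n e).2.1
  · rw [harr e (by omega) 2 (by omega)]; exact (input_edge n e).2.2.1
  · rw [harr e (by omega) 3 (by omega)]; exact (input_edge n e).2.2.2

open Classical in
/-- The comparisons of all pairs of vertices are in the array `2`. -/
def XTable (S : PlanarSubdivision) (m : ℕ) (mem : ℕ → ℕ) : Prop :=
  ∀ x < m, ∀ y < m, arr m mem 2 x y = if S.XLess x y then 1 else 0

open Classical in
/-- The comparisons of all pairs of edges are in the array `3`. -/
def BelowTable (S : PlanarSubdivision) (m : ℕ) (mem : ℕ → ℕ) : Prop :=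
  ∀ e e' : Fin S.ne, arr m mem 3 e e' = if S.Below e e' then 1 else 0

open Classical in
/-- The items of all rows are in the array `6`. -/
def RowTable (S : PlanarSubdivision) (m : ℕ) (mem : ℕ → ℕ) : Prop :=
  ∀ s < m, ∀ x < m, arr m mem 6 s x = if S.InRow m s x then 1 else 0

theorem XTable.congr {m : ℕ} (hm : 5 ≤ m) {mem mem' : ℕ → ℕ}
    (h : S.XTable m mem) (hf : ∀ b, 20 ≤ b → b / (m * m) = 2 → mem' b = mem b) :
    S.XTable m mem' := fun x hx y hy => by
  rw [arr_keep hm (by norm_num) hf hx hy]; exact h x hx y hy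

/-- For an edge that is not directed to the right, the column index `1 - y` swaps the endpoints, and
the upper face is the right face, in column `3` of the record. -/
theorem endpointExpr_ideal {m : ℕ} (hm : S.size + 20 = m) {mem : ℕ → ℕ} (h24 : mem 24 = m)
    (hR : S.Records m mem) (hX : S.XTable m mem) :
    (∀ x < m, ∀ y < m, endpointExpr.ideal mem (x * m + y) 0 < m) ∧
    ∀ e : Fin S.ne, endpointExpr.ideal mem (e * m + 0) 0 = S.left e ∧
      endpointExpr.ideal mem (e * m + 1) 0 = S.right e ∧
      endpointExpr.ideal mem (e * m + 2) 0 = S.upper e := by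
  have hsz : S.size = S.nv + S.ne + S.nf := rfl
  have key : ∀ x, ∀ y < m, endpointExpr.ideal mem (x * m + y) 0 =
      if arr m mem 2 (arr m mem 1 x 0) (arr m mem 1 x 1) ≠ 0 then arr m mem 1 x y
      else if y < 2 then arr m mem 1 x (1 - y) else arr m mem 1 x 3 := by
    intro x y hy
    rw [endpointExpr, Expr.ideal_ite, Expr.ideal_ite_less]
    simp only [entry_ideal h24, rowExpr_ideal h24 hy, colExpr_ideal h24 hy, Expr.ideal_sub,
      Expr.ideal_ofNat]
  refine ⟨fun x hx y hy => ?_, fun e => ?_⟩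
  · rw [key x y hy]
    split_ifs
    · exact hR.lt x hx y hy
    · exact hR.lt x hx _ (by omega)
    · exact hR.lt x hx 3 (by omega)
  · have hc : arr m mem 2 (arr m mem 1 e 0) (arr m mem 1 e 1) ≠ 0 ↔
        (S.vtx (S.src e)).1 < (S.vtx (S.dst e)).1 := by
      rw [hR.src, hR.dst, hX _ (by omega) _ (by omega), xLess_iff]
      simp
    simp only [key _ 0 (by omega), key _ 1 (by omega), key _ 2 (by omega), hc, left, right, upper]
    by_cases hlt : (S.vtx (S.src e)).1 < (S.vtx (S.dst e)).1
    · simp only [hlt, if_true]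
      exact ⟨hR.src e, hR.dst e, hR.leftFace e⟩
    · simp only [hlt, if_false]
      exact ⟨hR.dst e, hR.src e, hR.rightFace e⟩

/-- The primitive that compares two edges, given their endpoints. -/
noncomputable def belowQuery (m : ℕ) (mem : ℕ → ℕ) (x y : ℕ) : Query :=
  if arr m mem 9 x 0 = arr m mem 9 y 0 then
    .ccw (arr m mem 9 x 0) (arr m mem 9 x 1) (arr m mem 9 y 1)
  else if arr m mem 2 (arr m mem 9 y 0) (arr m mem 9 x 0) ≠ 0 then
    .ccw (arr m mem 9 y 1) (arr m mem 9 y 0) (arr m mem 9 x 0)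
  else .ccw (arr m mem 9 x 0) (arr m mem 9 x 1) (arr m mem 9 y 0)

theorem belowTest_ideal {m : ℕ} {mem : ℕ → ℕ} (h24 : mem 24 = m) {x y : ℕ} (hy : y < m) :
    belowTest.ideal mem (x * m + y) 0 = belowQuery m mem x y := by
  simp only [belowTest, Test.ideal, belowCase, Expr.ideal_ite, Expr.ideal_same, entry_ideal h24,
    rowExpr_ideal h24 hy, colExpr_ideal h24 hy, Expr.ideal_ofNat, belowQuery]
  split_ifs <;> simp_all

/-- The query depends on the arrays `2` and `9` only, so it remains fixed during the vote on it. -/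
theorem belowQuery_congr {m : ℕ} (hm : 5 ≤ m) {mem mem' : ℕ → ℕ} (hE : S.Endpoints m mem)
    (hf : ∀ b, 20 ≤ b → b / (m * m) ≠ 4 → b / (m * m) ≠ 5 → mem' b = mem b) {x y : ℕ}
    (hx : x < m) (hy : y < m) : belowQuery m mem' x y = belowQuery m mem x y := by
  have h9 : ∀ x < m, ∀ y < m, arr m mem' 9 x y = arr m mem 9 x y := fun x hx y hy =>
    arr_keep hm (by norm_num) (fun b hb h => hf b hb (by omega) (by omega)) hx hy
  have h2 : ∀ x < m, ∀ y < m, arr m mem' 2 x y = arr m mem 2 x y := fun x hx y hy =>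
    arr_keep hm (by norm_num) (fun b hb h => hf b hb (by omega) (by omega)) hx hy
  unfold belowQuery
  rw [h9 x hx 0 (by omega), h9 y hy 0 (by omega), h9 x hx 1 (by omega), h9 y hy 1 (by omega),
    h2 _ (hE.lt y hy 0 (by omega)) _ (hE.lt x hx 0 (by omega))]

theorem holds_belowQuery {m : ℕ} (hm : S.size + 20 = m) {mem : ℕ → ℕ} (hE : S.Endpoints m mem)
    (hX : S.XTable m mem) (e e' : Fin S.ne) :
    (belowQuery m mem e e').Holds S.sites ↔ S.Below e e' := by
  have hsz : S.size = S.nv + S.ne + S.nf := rfl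
  have hc : arr m mem 2 (S.left e') (S.left e) ≠ 0 ↔
      (S.vtx (S.left e')).1 < (S.vtx (S.left e)).1 := by
    rw [hX _ (by omega) _ (by omega), xLess_iff]
    simp
  have hv : ∀ v : Fin S.nv, S.sites v = some (S.vtx v) := fun v => sites_of_lt v.2
  unfold belowQuery Below
  rw [hE.left, hE.left, hE.right, hE.right]
  simp only [hc, Fin.val_inj]
  split_ifs <;> simp [Query.Holds, hv]

/-- The weak inequality for the right endpoint is the negation of an entry of the table. If `s` is
not a vertex and not the last row, the entry for the left endpoint vanishes and the row is empty. -/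
theorem inRowExpr_ideal {n m : ℕ} (hm : S.size + 20 = m) {mem : ℕ → ℕ} (hH : S.Header n m mem)
    (hE : S.Endpoints m mem) (hX : S.XTable m mem) {s x : ℕ} (hs : s < m) (hx : x < m) :
    open Classical in
    inRowExpr.ideal mem (s * m + x) 0 = if S.InRow m s x then 1 else 0 := by
  classical
  have hsz : S.size = S.nv + S.ne + S.nf := rfl
  have h24 := hH.side
  simp only [inRowExpr, Expr.ideal_ite, Expr.ideal_same, entry_ideal h24, Expr.ideal_less,
    Expr.ideal_mul, Expr.ideal_sub, Expr.ideal_load,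
    rowExpr_ideal h24 hx, colExpr_ideal h24 hx, Expr.ideal_ofNat, h24, hH.nv, hH.ne]
  by_cases hsm : s = m - 1
  · subst hsm
    simp [inRow_last]
  · rw [if_neg (by simp [hsm])]
    simp only [inRow_of_ne hsm]
    by_cases hxe : x < S.ne
    · have h0 := hE.left ⟨x, hxe⟩
      have h1 := hE.right ⟨x, hxe⟩
      simp only at h0 h1
      rw [h0, h1, hX _ (by omega) _ hs, hX _ (by omega) _ hs]
      simp only [xLess_iff, Fin.is_lt, exists_true_left, Fin.eta, hxe, Spans]
      by_cases hsv : s < S.nv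
      · simp only [hsv, exists_true_left, ← not_lt]
        by_cases c1 : (S.vtx (S.left ⟨x, hxe⟩)).1 < (S.vtx ⟨s, hsv⟩).1 <;>
          by_cases c2 : (S.vtx (S.right ⟨x, hxe⟩)).1 < (S.vtx ⟨s, hsv⟩).1 <;> simp [c1, c2]
      · simp [hsv]
    · simp [hxe]

theorem computesOrder_rowLess {n m : ℕ} {mem : ℕ → ℕ} (hH : S.Header n m mem)
    (hX : S.XTable m mem) (hB : S.BelowTable m mem) (hR : S.RowTable m mem) :
    ComputesOrder rowLess (S.RowLt m) m mem := by
  classical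
  intro i a b c ha hb hc
  have h24 := hH.side
  simp only [rowLess, Expr.ideal_ite, Expr.ideal_same, entry_ideal h24, Expr.ideal_less,
    Expr.ideal_sub, Expr.ideal_load, Expr.ideal_ofNat, h24]
  generalize a.ideal mem i 0 = s at *
  generalize b.ideal mem i 0 = x at *
  generalize c.ideal mem i 0 = y at *
  rw [hR s ha x hb, hR s ha y hc, hX x hb y hc, hX y hc x hb]
  unfold RowLt
  by_cases hx : S.InRow m s x <;> by_cases hy : S.InRow m s y
  · by_cases hs : s = m - 1
    · by_cases c1 : S.XLess x y <;> by_cases c2 : S.XLess y x <;> by_cases c3 : x < y <;>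
        simp [hx, hy, RowCmp, ← hs, c1, c2, c3]
    · obtain ⟨hx', _⟩ := (inRow_of_ne hs).1 hx
      obtain ⟨hy', _⟩ := (inRow_of_ne hs).1 hy
      have := hB ⟨x, hx'⟩ ⟨y, hy'⟩
      simp only at this
      by_cases c1 : S.Below ⟨x, hx'⟩ ⟨y, hy'⟩ <;> simp [hx, hy, RowCmp, hs, this, c1, hx', hy']
  · simp [hx, hy]
  · simp [hx, hy]
  · by_cases c3 : x < y <;> simp [hx, hy, c3]

/-- Given two correct tables of votes, everything else is an exact computation. The second vote uses
the outcome of the first to choose its tests, but its noise bits are fixed: the votes start at the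
times `6` and `7 + voteSpan N`. -/
theorem build_reaches {M : Machine} {V z B n m C N : ℕ} (hM : M.Roomy V z) (hB : B ≤ V)
    (hz : 22 * C + 10000 ≤ z) (hm : S.size + 20 = m) (hmB : m * (m * m) ≤ B)
    (hn : S.size ≤ n) (hnV : n ≤ V) (hN : N = (n ^ C).size) (hV : 2 ^ (N + 2) ≤ V)
    (hmN : m ≤ 2 ^ N) (hpts : M.pts = S.sites) (hcells : ∀ b < 10 * (m * m), b ∈ M.cells)
    (hgood₁ : ∀ i < m * m, ¬ BadBlock (voteBlock 6 N i) M.err)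
    (hgood₂ : ∀ i < m * m, ¬ BadBlock (voteBlock (7 + voteSpan N) N i) M.err) :
    M.Reaches B (fun _ => ∅) (buildProg C) ⟨S.input n, 0, 0, 0⟩ (buildSpan N)
      (m * m + m * m) (S.Built n m V) := by
  classical
  have hsz : S.size = S.nv + S.ne + S.nf := rfl
  have hm5 : 5 ≤ m := by omega
  have hmm : m * m ≤ m * (m * m) := Nat.le_mul_of_pos_left _ (by omega)
  have hmm' : m ≤ m * m := Nat.le_mul_of_pos_left _ (by omega)
  have hpair : ∀ {i}, i < m * m → ∃ r < m, ∃ e < m, i = r * m + e := fun {i} hi =>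
    ⟨i / m, Nat.div_lt_of_lt_mul hi, i % m, Nat.mod_lt _ (by omega), by
      rw [mul_comm, Nat.div_add_mod]⟩
  refine Machine.Reaches.of_eq
    (k := 6 + (voteSpan N + (1 + (voteSpan N + (1 + sortSpan N)))))
    (o := m * m + (m * m + 0)) ?_ (by unfold buildSpan; ring) rfl
  refine (setup_reaches hM hB (by omega) hm (by omega) hn hnV hcells rfl).then
    fun s₁ e₁ ⟨b₁, H₁, R₁⟩ => ?_
  refine (hM.voteTable hB b₁ (by omega) hm5 (by omega) (by simp [Test.width]; omega) hN hV H₁.size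
    H₁.side (by norm_num) hcells (q := fun i => .xLess (i / m) (i % m)) ?_ ?_).seq
    fun s₂ e₂ ⟨b₂, a₂, f₂⟩ => ?_
  · intro mem hf i hi
    obtain ⟨x, hx, y, hy, rfl⟩ := hpair hi
    have h24 := (H₁.congr hm5 fun b hb h => hf b hb (by omega) (by omega)).side
    simp only [Test.ideal, rowExpr_ideal h24 hy, colExpr_ideal h24 hy, div_mod_of_lt hy]
  · rw [e₁]; simpa using hgood₁
  have H₂ := H₁.congr hm5 fun b hb h => f₂ b hb (by omega) (by omega) (by omega)
  have X₂ : S.XTable m s₂.mem := fun x hx y hy => by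
    rw [a₂ x hx y hy, (div_mod_of_lt hy).1, (div_mod_of_lt hy).2, hpts]
    rfl
  have R₂ : S.Records m s₂.mem := by
    have key : ∀ x < m, ∀ y < m, arr m s₂.mem 1 x y = arr m s₁.mem 1 x y := fun x hx y hy =>
      arr_keep hm5 (by norm_num) (fun b hb h => f₂ b hb (by omega) (by omega) (by omega)) hx hy
    exact ⟨fun x hx y hy => by rw [key x hx y hy]; exact R₁.lt x hx y hy,
      fun e => by rw [key e (by omega) 0 (by omega), R₁.src],
      fun e => by rw [key e (by omega) 1 (by omega), R₁.dst],
      fun e => by rw [key e (by omega) 2 (by omega), R₁.leftFace],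
      fun e => by rw [key e (by omega) 3 (by omega), R₁.rightFace]⟩
  obtain ⟨v₃, w₃⟩ := endpointExpr_ideal hm H₂.side R₂ X₂
  refine (hM.fill hB b₂ (m := m) (by simp [H₂.side]) (by omega)
    ⟨by simp, by norm_num, by omega, by simp [endpointExpr, entry_width]; omega⟩
    (fun b hb => hcells b (by nlinarith))
    (fun x hx y hy => by have := v₃ x hx y hy; omega)).then fun s₃ e₃ ⟨b₃, a₃, f₃⟩ => ?_
  have H₃ := H₂.congr hm5 fun b hb h => f₃ b (by omega)
  have X₃ := X₂.congr hm5 fun b hb h => f₃ b (by omega)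
  have E₃ : S.Endpoints m s₃.mem :=
    ⟨fun x hx y hy => by rw [a₃ x hx y hy]; exact v₃ x hx y hy,
      fun e => by rw [a₃ e (by omega) 0 (by omega), (w₃ e).1],
      fun e => by rw [a₃ e (by omega) 1 (by omega), (w₃ e).2.1],
      fun e => by rw [a₃ e (by omega) 2 (by omega), (w₃ e).2.2]⟩
  refine (hM.voteTable hB b₃ (by omega) hm5 (by omega)
    (by simp [Test.width, belowTest, belowCase, entry_width]; omega) hN hV H₃.size
    H₃.side (by norm_num) hcells (q := fun i => belowQuery m s₃.mem (i / m) (i % m)) ?_ ?_).seq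
    fun s₄ e₄ ⟨b₄, a₄, f₄⟩ => ?_
  · intro mem hf i hi
    obtain ⟨x, hx, y, hy, rfl⟩ := hpair hi
    have h24 := (H₃.congr hm5 fun b hb h => hf b hb (by omega) (by omega)).side
    rw [belowTest_ideal h24 hy, belowQuery_congr hm5 E₃ hf hx hy, (div_mod_of_lt hy).1,
      (div_mod_of_lt hy).2]
  · have : s₃.span = 7 + voteSpan N := by rw [e₃, e₂, e₁]; ring
    rw [this]; exact hgood₂
  have H₄ := H₃.congr hm5 fun b hb h => f₄ b hb (by omega) (by omega) (by omega)
  have X₄ := X₃.congr hm5 fun b hb h => f₄ b hb (by omega) (by omega) (by omega)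
  have E₄ := E₃.congr hm fun b hb h => f₄ b hb (by omega) (by omega) (by omega)
  have B₄ : S.BelowTable m s₄.mem := fun e e' => by
    rw [a₄ e (by omega) e' (by omega), (div_mod_of_lt (by omega)).1,
      (div_mod_of_lt (by omega)).2, hpts]
    simp only [holds_belowQuery hm E₃ X₃]
  have v₅ := fun s (hs : s < m) x (hx : x < m) => inRowExpr_ideal hm H₄ E₄ X₄ hs hx
  refine (hM.fill hB b₄ (m := m) (by simp [H₄.side]) (by omega)
    ⟨by simp, by norm_num, by omega, by simp [inRowExpr, entry_width]; omega⟩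
    (fun b hb => hcells b (by nlinarith)) (fun x hx y hy => by
      rw [v₅ x hx y hy]; have := hM.two_le; split_ifs <;> omega)).then fun s₅ _ ⟨b₅, a₅, f₅⟩ => ?_
  have H₅ := H₄.congr hm5 fun b hb h => f₅ b (by omega)
  have X₅ := X₄.congr hm5 fun b hb h => f₅ b (by omega)
  have E₅ := E₄.congr hm fun b hb h => f₅ b (by omega)
  have B₅ : ∀ mem : ℕ → ℕ, (∀ b, 20 ≤ b → b / (m * m) = 3 → mem b = s₅.mem b) →
      S.BelowTable m mem := fun mem hf e e' => by
    rw [arr_keep hm5 (by norm_num) hf (by omega) (by omega), arr_frame f₅ (by norm_num) (by omega)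
      (by omega), B₄ e e']
  have R₅ : S.RowTable m s₅.mem := fun s hs x hx => by rw [a₅ s hs x hx, v₅ s hs x hx]
  have R₆ : ∀ mem : ℕ → ℕ, (∀ b, 20 ≤ b → b / (m * m) = 6 → mem b = s₅.mem b) →
      S.RowTable m mem := fun mem hf s hs x hx => by
    rw [arr_keep hm5 (by norm_num) hf hs hx, R₅ s hs x hx]
  refine (hM.sortRows hB b₅ (by omega) hm5 hmB
    (by simp [writerExpr, rowLess, entry_width, tripleRow, tripleItem, triplePos, siblingExpr]
        omega) hN hV hmN H₅.size H₅.side hcells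
    (lt := S.RowLt m) (fun mem hf => computesOrder_rowLess
      (H₅.congr hm5 fun b hb h => hf b hb (by omega) (by omega))
      (X₅.congr hm5 fun b hb h => hf b hb (by omega) (by omega))
      (B₅ mem fun b hb h => hf b hb (by omega) (by omega))
      (R₆ mem fun b hb h => hf b hb (by omega) (by omega)))
    (fun s _ => S.isRowOrder_rowLt m s)).mono fun mem ⟨b₆, f₆, a₆⟩ => ?_
  have H₆ := H₅.congr hm5 fun b hb h => f₆ b hb (by omega) (by omega)
  have E₆ := E₅.congr hm fun b hb h => f₆ b hb (by omega) (by omega)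
  exact ⟨b₆, H₆.size, H₆.nv, H₆.outer, H₆.side, E₆.left, E₆.right, E₆.upper,
    fun s hs x hx => by
      rw [R₆ mem (fun b hb h => f₆ b hb (by omega) (by omega)) s hs x hx]; simp,
    fun s hs => a₆ s hs⟩

end PlanarSubdivision

/-! ### Choice of the constants -/

theorem exists_pow_le {ρ ε : ℝ≥0∞} (hρ : ρ < 1) (hε : 0 < ε) : ∃ k : ℕ, ρ ^ k ≤ ε := by
  obtain ⟨k, hk⟩ := ((ENNReal.tendsto_pow_atTop_nhds_zero_of_lt_one hρ).eventually
    (gt_mem_nhds hε)).exists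
  exact ⟨k, hk.le⟩

theorem size_pow_le (n : ℕ) {C : ℕ} (hC : C ≠ 0) : (n ^ C).size ≤ C * (Nat.log 2 n + 1) := by
  rw [Nat.size_le]
  calc n ^ C < (2 ^ (Nat.log 2 n + 1)) ^ C :=
        Nat.pow_lt_pow_left (Nat.lt_pow_succ_log_self (by norm_num) n) hC
    _ = 2 ^ (C * (Nat.log 2 n + 1)) := by rw [← pow_mul, mul_comm]

/-- With `L = Nat.log 2 n` the exponent of `V` is at most `(C + 2) * (L + 1)`, so `V ^ z` is a power
of two with exponent at most `(C + 2) * z * (L + 1)`. The additional `1` makes the inequality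
strict. -/
theorem roomy_wordCount (n : ℕ) {C : ℕ} (hC : C ≠ 0) (z : ℕ) (cells : Set ℕ) (pts : ℕ → Option (ℝ × ℝ)) (err : Noise) :
    (Machine.mk (wordCount ((C + 2) * z + 1) n) cells pts err).Roomy
      (2 ^ ((n ^ C).size + 2)) z := by
  refine ⟨?_, ?_⟩
  · calc 2 = 2 ^ 1 := rfl
      _ ≤ _ := Nat.pow_le_pow_right (by norm_num) (by omega)
  · change _ < 2 ^ _
    rw [← pow_mul]
    refine Nat.pow_lt_pow_right (by norm_num) ?_
    have h := size_pow_le n hC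
    generalize Nat.log 2 n = L at h ⊢
    calc ((n ^ C).size + 2) * z ≤ (C * (L + 1) + 2 * (L + 1)) * z :=
          Nat.mul_le_mul_right _ (by omega)
      _ < ((C + 2) * z + 1) * (L + 1) := by nlinarith

/-- Durations are affine in a binary length, whereas the bounds are in terms of the natural
logarithm. Additive constants are absorbed because `Real.log 2 ≥ 1 / 2` and `n ≥ 2`. -/
theorem log_bounds {n C : ℕ} (hn : 2 ≤ n) (hC : C ≠ 0) :
    1 ≤ 2 * Real.log n ∧ ((n ^ C).size : ℝ) ≤ 4 * C * Real.log n := by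
  have hlog2 : (1 : ℝ) / 2 ≤ Real.log 2 := by have := Real.log_two_gt_d9; linarith
  have hn' : (2 : ℝ) ≤ n := by exact_mod_cast hn
  have h1 : Real.log 2 ≤ Real.log n := Real.log_le_log (by norm_num) hn'
  have h2 : (Nat.log 2 n : ℝ) * Real.log 2 ≤ Real.log n := by
    rw [← Real.log_pow]
    refine Real.log_le_log (by positivity) ?_
    exact_mod_cast Nat.pow_log_le_self 2 (by omega)
  have h3 : ((n ^ C).size : ℝ) ≤ C * (Nat.log 2 n + 1) := by exact_mod_cast size_pow_le n hC
  have h4 : (Nat.log 2 n : ℝ) ≤ 2 * Real.log n := by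
    have : (0 : ℝ) ≤ Nat.log 2 n := Nat.cast_nonneg _
    nlinarith
  refine ⟨by linarith, h3.trans ?_⟩
  have : (0 : ℝ) ≤ C := Nat.cast_nonneg _
  nlinarith

theorem linear_le_log {n C : ℕ} (hn : 2 ≤ n) (hC : C ≠ 0) (a b : ℕ) :
    ((a * (n ^ C).size + b : ℕ) : ℝ) ≤ (4 * C * a + 2 * b : ℕ) * Real.log n := by
  obtain ⟨h1, h2⟩ := log_bounds hn hC
  have ha : (0 : ℝ) ≤ a := Nat.cast_nonneg _
  have hb : (0 : ℝ) ≤ b := Nat.cast_nonneg _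
  push_cast
  nlinarith [mul_le_mul_of_nonneg_left h2 ha, mul_le_mul_of_nonneg_left h1 hb]

theorem inv_two_pow_size_le (n C : ℕ) : (2⁻¹ : ℝ≥0∞) ^ (n ^ C).size ≤ ((n : ℝ≥0∞) ^ C)⁻¹ := by
  rw [← ENNReal.inv_pow, ENNReal.inv_le_inv]
  exact_mod_cast (Nat.lt_size_self (n ^ C)).le

/-- Compare `C₀`-th powers: with `N` the length of `n ^ (C₁ * C₀)`, `(ρ ^ C₀) ^ N ≤ 2⁻¹ ^ N ≤ (n ^
(C₁ * C₀))⁻¹`. A rate close to `1` is thus compensated by a factor `C₀` in the number of votes. -/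
theorem rate_pow_size_le {ρ : ℝ≥0∞} {C₀ : ℕ} (hC₀ : C₀ ≠ 0) (hρ : ρ ^ C₀ ≤ 2⁻¹) (n C₁ : ℕ) :
    ρ ^ (n ^ (C₁ * C₀)).size ≤ ((n : ℝ≥0∞) ^ C₁)⁻¹ := by
  by_contra h
  have h := ENNReal.pow_lt_pow_left hC₀ (not_le.1 h)
  refine absurd h (not_lt.2 ?_)
  calc (ρ ^ (n ^ (C₁ * C₀)).size) ^ C₀ = (ρ ^ C₀) ^ (n ^ (C₁ * C₀)).size := pow_right_comm _ _ _
    _ ≤ 2⁻¹ ^ (n ^ (C₁ * C₀)).size := pow_le_pow_left' hρ _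
    _ ≤ ((n : ℝ≥0∞) ^ (C₁ * C₀))⁻¹ := inv_two_pow_size_le _ _
    _ = _ := by rw [pow_mul, ← ENNReal.inv_pow]

theorem mul_inv_pow_le {n a k c d : ℕ} (hn : n ≠ 0) (ha : a ≤ n ^ k) (hd : c + k ≤ d)
    {x : ℝ≥0∞} (hx : x ≤ ((n : ℝ≥0∞) ^ d)⁻¹) : a * x ≤ ((n : ℝ≥0∞) ^ c)⁻¹ := by
  have h0 : (n : ℝ≥0∞) ≠ 0 := by exact_mod_cast hn
  have ht : (n : ℝ≥0∞) ≠ ⊤ := ENNReal.natCast_ne_top n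
  have h1 : (1 : ℝ≥0∞) ≤ n := by exact_mod_cast Nat.one_le_iff_ne_zero.2 hn
  calc a * x ≤ (n : ℝ≥0∞) ^ k * ((n : ℝ≥0∞) ^ (c + k))⁻¹ := by
        refine mul_le_mul' (by exact_mod_cast ha) (hx.trans ?_)
        rw [ENNReal.inv_le_inv]
        exact pow_le_pow_right₀ h1 hd
    _ = _ := by
        rw [pow_add, ENNReal.mul_inv (Or.inr (ENNReal.pow_ne_top ht))
          (Or.inl (ENNReal.pow_ne_top ht)), mul_comm, mul_assoc,
          ENNReal.inv_mul_cancel (pow_ne_zero _ h0) (ENNReal.pow_ne_top ht), mul_one]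

/-! ### Failure probabilities and resource bounds. -/

namespace PlanarSubdivision

variable {S : PlanarSubdivision}

theorem one_le_size (S : PlanarSubdivision) : 1 ≤ S.size := by
  have := S.outer.2
  unfold size
  omega

theorem side_le {n : ℕ} (hn : 2 ≤ n) (hr : S.size ≤ n) :
    S.size + 20 ≤ n ^ 6 ∧ 2 * (S.size + 20 + 1) ≤ n ^ 7 := by
  have h1 := S.one_le_size
  have h5 : 2 ^ 5 ≤ n ^ 5 := Nat.pow_le_pow_left hn 5
  have h6 : 2 ^ 6 ≤ n ^ 6 := Nat.pow_le_pow_left hn 6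
  refine ⟨?_, ?_⟩
  · calc S.size + 20 ≤ 2 ^ 5 * n := by omega
      _ ≤ n ^ 5 * n := Nat.mul_le_mul_right _ h5
      _ = n ^ 6 := by ring
  · calc 2 * (S.size + 20 + 1) ≤ 2 ^ 6 * n := by omega
      _ ≤ n ^ 6 * n := Nat.mul_le_mul_right _ h6
      _ = n ^ 7 := by ring

/-- The side is at most `n ^ 6`, so `C ≥ 18` lets the number of processors fit into a word. Moreover
`2 * (m + 1) ≤ n ^ 7` and `n ^ 14 < 2 ^ N`, so half of the `N` bits suffice for the second bound. -/
theorem side_le_two_pow {n C : ℕ} (hn : 2 ≤ n) (hr : S.size ≤ n) (hC : 18 ≤ C) :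
    (S.size + 20) * ((S.size + 20) * (S.size + 20)) ≤ 2 ^ (n ^ C).size ∧
      2 * (S.size + 20 + 1) ≤ 2 ^ ((n ^ C).size - (n ^ C).size / 2) := by
  obtain ⟨h6, h7⟩ := side_le hn hr
  have hN : n ^ C < 2 ^ (n ^ C).size := Nat.lt_size_self _
  refine ⟨?_, h7.trans ?_⟩
  · calc _ ≤ n ^ 6 * (n ^ 6 * n ^ 6) := Nat.mul_le_mul h6 (Nat.mul_le_mul h6 h6)
      _ = n ^ 18 := by ring
      _ ≤ n ^ C := Nat.pow_le_pow_right (by omega) hC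
      _ ≤ _ := hN.le
  · generalize (n ^ C).size = N at hN ⊢
    by_contra h
    have h := Nat.pow_lt_pow_left (not_le.1 h) (n := 2) (by norm_num)
    rw [← pow_mul, ← pow_mul] at h
    have h1 : 2 ^ N ≤ 2 ^ ((N - N / 2) * 2) := Nat.pow_le_pow_right (by norm_num) (by omega)
    have h2 : n ^ (7 * 2) ≤ n ^ C := Nat.pow_le_pow_right (by omega) (by omega)
    omega

/-- A query fails only if one of its two searches meets more than `N / 4` bad blocks. The factor `2`
for the two searches is at most `n` and costs one in the exponent. -/
theorem Built.supports {p : ℝ} {c n C R z K : ℕ} {D : ℕ → ℕ} {ρ : ℝ≥0∞}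
    (hD : S.Built n (S.size + 20) (2 ^ ((n ^ C).size + 2)) D)
    (hρ : ∀ μ : Measure Noise, IsNoiseLaw p μ → ∀ F : Finset (ℕ × ℕ),
      μ {ω | BadBlock F ω} ≤ ρ ^ F.card)
    (hR : ρ ^ R ≤ 2⁻¹ ^ 16) (hn : 2 ≤ n) (hr : S.size ≤ n) (hC : 18 ≤ C) (hRC : R ≤ C)
    (hcC : c + 1 ≤ C) (hz : 22 * C + R + 3000 ≤ z)
    (hK : 21 * (8 * C * (6 * R + 19) + 46) ≤ K) :
    S.Supports p c ((C + 2) * z + 1) 20 K n (queryProg C R) D := by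
  intro q mem hmem μ hμ
  have := hμ.prob
  set N := (n ^ C).size with hN
  have hpow : 2 ^ (N + 2) = 4 * 2 ^ N := by ring
  have hnN : n ^ C < 2 ^ N := Nat.lt_size_self _
  have hCn : 2 ^ C ≤ n ^ C := Nat.pow_le_pow_left hn C
  have h18 : 2 ^ 18 ≤ 2 ^ C := Nat.pow_le_pow_right (by norm_num) hC
  have hR2 : R < 2 ^ C := hRC.trans_lt Nat.lt_two_pow_self
  set F₁ := searchBlocks (1 + 3 * N + 9) R with hF₁
  set F₂ := searchBlocks (2 + searchSpan N R + 3 * N + 9) R with hF₂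
  have hbound : ∀ F : ℕ → Finset (ℕ × ℕ), (∀ b, (F b).card = R) →
      (Pairwise fun a b => Disjoint (F a) (F b)) →
      μ {ω | N < 4 * badCount F ω (3 * N)} ≤ 2⁻¹ ^ N := fun F h1 h2 =>
    measure_badCount_le (hρ μ hμ) hR h1 h2
  refine (measure_mono (t := {ω | N < 4 * badCount F₁ ω (3 * N)} ∪
    {ω | N < 4 * badCount F₂ ω (3 * N)}) fun err herr => ?_).trans ?_
  · by_contra hgood
    simp only [mem_union, mem_ofPred_eq, not_or, not_lt] at hgood
    obtain ⟨s', h1, _, h3, h4, h5⟩ := hD.query (q := q) (err := err) rfl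
      (roomy_wordCount n (by omega) z _ _ _) hz (by omega) hN le_rfl (by omega)
      (side_le_two_pow hn hr hC).2 hmem hgood.1 hgood.2
    refine herr ⟨s', h1, ?_, by simpa using h4, h5⟩
    -- Each of the `3 + 2 * searchSpan N R` steps costs at most `21`: twenty processors and the
    -- control.
    have hw : s'.work ≤ (42 * (6 * R + 19)) * N + 483 := by
      refine h3.trans (le_of_eq ?_)
      simp only [searchSpan]; ring
    calc (s'.work : ℝ) ≤ ((42 * (6 * R + 19) * N + 483 : ℕ) : ℝ) := by exact_mod_cast hw
      _ ≤ _ := linear_le_log hn (by omega) _ _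
      _ ≤ K * Real.log n := by
        refine mul_le_mul_of_nonneg_right ?_ (Real.log_natCast_nonneg n)
        refine Nat.cast_le.2 (le_trans (le_of_eq ?_) hK)
        ring
  · calc _ ≤ (2⁻¹ : ℝ≥0∞) ^ N + 2⁻¹ ^ N := (measure_union_le _ _).trans (add_le_add
          (hbound _ (card_searchBlocks _ _) (disjoint_searchBlocks _ _))
          (hbound _ (card_searchBlocks _ _) (disjoint_searchBlocks _ _)))
      _ = (2 : ℕ) * 2⁻¹ ^ N := by push_cast; ring
      _ ≤ _ := mul_inv_pow_le (k := 1) (by omega) (by simpa using hn) hcC (inv_two_pow_size_le n C)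

/-- A union bound over `2 * m ^ 2 ≤ n ^ 13` votes, where `m ≤ n ^ 6`. -/
theorem measure_exists_badBlock_le {c n C₀ C₁ : ℕ} {ρ : ℝ≥0∞} {μ : Measure Noise}
    (hρ : ∀ F : Finset (ℕ × ℕ), μ {ω | BadBlock F ω} ≤ ρ ^ F.card) (hC₀ : C₀ ≠ 0)
    (hρC : ρ ^ C₀ ≤ 2⁻¹) (hn : 2 ≤ n) (hr : S.size ≤ n) (hC₁ : c + 13 ≤ C₁) (t₁ t₂ : ℕ) :
    μ {ω | ∃ i < (S.size + 20) * (S.size + 20),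
      BadBlock (voteBlock t₁ (n ^ (C₁ * C₀)).size i) ω ∨
      BadBlock (voteBlock t₂ (n ^ (C₁ * C₀)).size i) ω} ≤ ((n : ℝ≥0∞) ^ c)⁻¹ := by
  set N := (n ^ (C₁ * C₀)).size with hN
  set m := S.size + 20 with hm
  have hsub : {ω | ∃ i < m * m, BadBlock (voteBlock t₁ N i) ω ∨ BadBlock (voteBlock t₂ N i) ω} ⊆
      ⋃ i ∈ Finset.range (m * m), ({ω | BadBlock (voteBlock t₁ N i) ω} ∪
        {ω | BadBlock (voteBlock t₂ N i) ω}) := by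
    rintro ω ⟨i, hi, h⟩
    simp only [mem_iUnion]
    exact ⟨i, Finset.mem_range.2 hi, h⟩
  have hone : ∀ t i, μ {ω | BadBlock (voteBlock t N i) ω} ≤ ρ ^ N := fun t i =>
    (hρ _).trans_eq (by rw [card_voteBlock])
  calc _ ≤ ∑ i ∈ Finset.range (m * m), μ ({ω | BadBlock (voteBlock t₁ N i) ω} ∪
        {ω | BadBlock (voteBlock t₂ N i) ω}) :=
        (measure_mono hsub).trans (measure_biUnion_finset_le _ _)
    _ ≤ ∑ i ∈ Finset.range (m * m), (ρ ^ N + ρ ^ N) := Finset.sum_le_sum fun i _ =>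
        (measure_union_le _ _).trans (add_le_add (hone _ _) (hone _ _))
    _ = (m * m * 2 : ℕ) * ρ ^ N := by
        rw [Finset.sum_const, Finset.card_range, nsmul_eq_mul]; push_cast; ring
    _ ≤ _ := by
        refine mul_inv_pow_le (k := 13) (by omega) ?_ hC₁ (rate_pow_size_le hC₀ hρC n C₁)
        obtain ⟨h6, _⟩ := side_le hn hr
        calc m * m * 2 ≤ n ^ 6 * n ^ 6 * n := Nat.mul_le_mul (Nat.mul_le_mul h6 h6) hn
          _ = n ^ 13 := by ring

theorem exists_build_run {n C z K : ℕ} {err : Noise} (hn : 2 ≤ n) (hr : S.size ≤ n)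
    (hC : 18 ≤ C) (hz : 22 * C + 10000 ≤ z) (hK : 9262 * (60 * C + 50) ≤ K)
    (hgood : ∀ i < (S.size + 20) * (S.size + 20),
      ¬ BadBlock (voteBlock 6 (n ^ C).size i) err ∧
      ¬ BadBlock (voteBlock (7 + voteSpan (n ^ C).size) (n ^ C).size i) err) :
    ∃ s' : State,
      (Machine.mk (wordCount ((C + 2) * z + 1) n) {a | a < K * S.size ^ 2} S.sites err).Run
        (buildProg C) (S.input n) s' ∧
      (s'.span : ℝ) ≤ K * Real.log n ∧ (s'.work : ℝ) ≤ K * S.size ^ 3 * Real.log n ∧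
      s'.ops ≤ K * S.size ^ 3 ∧
      S.Built n (S.size + 20) (2 ^ ((n ^ C).size + 2)) s'.mem := by
  have hr1 := S.one_le_size
  have hside := (S.side_le_two_pow hn hr hC).1
  have hroom := roomy_wordCount n (C := C) (by omega) z {a | a < K * S.size ^ 2} S.sites err
  have hlin := linear_le_log hn (C := C) (by omega) 15 25
  have hnN : n ^ C < 2 ^ (n ^ C).size := Nat.lt_size_self _
  have hnC : n ≤ n ^ C := Nat.le_self_pow (by omega) n
  obtain ⟨m, hm⟩ : ∃ m, S.size + 20 = m := ⟨_, rfl⟩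
  obtain ⟨N, hN⟩ : ∃ N, (n ^ C).size = N := ⟨_, rfl⟩
  rw [hm] at hgood hside ⊢
  rw [hN] at hgood hside hroom hlin hnN ⊢
  have hpow : 2 ^ (N + 2) = 4 * 2 ^ N := by ring
  -- There is at least one face, so the size is positive. The constants `441` and `9261` are the
  -- square and the cube of `21`.
  have hm21 : m ≤ 21 * S.size := by omega
  have hmm : m * m ≤ 441 * S.size ^ 2 := by
    calc m * m ≤ 21 * S.size * (21 * S.size) := Nat.mul_le_mul hm21 hm21
      _ = _ := by ring
  have hmmm : m * (m * m) ≤ 9261 * S.size ^ 3 := by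
    calc m * (m * m) ≤ 21 * S.size * (441 * S.size ^ 2) := Nat.mul_le_mul hm21 hmm
      _ = _ := by ring
  have hcell : 4410 * S.size ^ 2 ≤ K * S.size ^ 2 := Nat.mul_le_mul_right _ (by omega)
  obtain ⟨s', h1, h2, h3, h4, h5⟩ := S.build_reaches (B := m * (m * m)) hroom (by omega) hz hm
    le_rfl hr (by omega) hN.symm le_rfl
    ((Nat.le_mul_of_pos_right _ (Nat.mul_pos (by omega) (by omega))).trans hside) rfl
    (fun b hb => by
      change b < K * S.size ^ 2
      omega)
    (fun i hi => (hgood i hi).1) (fun i hi => (hgood i hi).2)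
  have hlog := Real.log_natCast_nonneg n
  have hspan : buildSpan N = 15 * N + 25 := by unfold buildSpan voteSpan sortSpan; ring
  have hconst : 4 * C * 15 + 2 * 25 = 60 * C + 50 := by ring
  rw [← hspan, hconst] at hlin
  simp only [zero_add] at h2 h3 h4
  refine ⟨s', h1, ?_, ?_, ?_, h5⟩
  · rw [h2]
    refine hlin.trans (mul_le_mul_of_nonneg_right ?_ hlog)
    exact Nat.cast_le.2 (by omega)
  · have hr3 : 1 ≤ S.size ^ 3 := Nat.one_le_pow _ _ hr1
    have hw : s'.work ≤ buildSpan N * (9262 * S.size ^ 3) :=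
      h3.trans (Nat.mul_le_mul_left _ (by omega))
    calc (s'.work : ℝ) ≤ (buildSpan N : ℝ) * (9262 * S.size ^ 3) := by exact_mod_cast hw
      _ ≤ (60 * C + 50 : ℕ) * Real.log n * (9262 * S.size ^ 3) :=
        mul_le_mul_of_nonneg_right hlin (by positivity)
      _ = (9262 * (60 * C + 50) : ℕ) * S.size ^ 3 * Real.log n := by push_cast; ring
      _ ≤ K * S.size ^ 3 * Real.log n :=
        mul_le_mul_of_nonneg_right
          (mul_le_mul_of_nonneg_right (Nat.cast_le.2 hK) (by positivity)) hlog
  · have : S.size ^ 2 ≤ S.size ^ 3 := Nat.pow_le_pow_right hr1 (by norm_num)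
    calc s'.ops ≤ 882 * S.size ^ 3 := by omega
      _ ≤ K * S.size ^ 3 := Nat.mul_le_mul_right _ (by omega)

end PlanarSubdivision

/-! ### Assembly of the constants and of the two algorithms. -/

theorem mainTheorem9 (p : ℝ) (hp : p < 1 / 2) (c : ℕ) :
    ∃ (build query : Prog) (κ k K : ℕ), ∀ (S : PlanarSubdivision) (n r : ℕ),
      S.size = r → r ≤ n → ∀ μ : Measure Noise, IsNoiseLaw p μ →
        μ {err | ¬ ∃ s' : State,
          (Machine.mk (wordCount κ n) {a | a < K * r ^ 2} S.sites err).Run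
            build (S.input n) s' ∧
          (s'.span : ℝ) ≤ K * Real.log n ∧
          (s'.work : ℝ) ≤ K * r ^ 3 * Real.log n ∧
          s'.ops ≤ K * r ^ 3 ∧
          S.Supports p c κ k K n query s'.mem} ≤ ((n : ℝ≥0∞) ^ c)⁻¹ := by
  obtain ⟨ρ, hρ1, hρ⟩ := exists_rate hp
  obtain ⟨R, hR⟩ := exists_pow_le hρ1 (ε := 2⁻¹ ^ 16) (ENNReal.pow_pos (by simp) _)
  obtain ⟨C₂, hC₂⟩ := exists_pow_le hρ1 (ε := 2⁻¹) (by simp)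
  obtain ⟨C₀, hC₀, hρC⟩ : ∃ C₀ : ℕ, C₀ ≠ 0 ∧ ρ ^ C₀ ≤ 2⁻¹ :=
    ⟨C₂ + 1, by omega, (pow_le_pow_right_of_le_one' hρ1.le (Nat.le_succ _)).trans hC₂⟩
  -- Large enough for the union bound (`c + 13`), for the bounds on the side (`18`) and for counts
  -- of `R` votes to fit into words (`R`).
  obtain ⟨C₁, hC₁⟩ : ∃ C₁, C₁ = c + R + 18 := ⟨_, rfl⟩
  obtain ⟨C, hC⟩ : ∃ C, C = C₁ * C₀ := ⟨_, rfl⟩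
  have hCC₁ : C₁ ≤ C := hC ▸ Nat.le_mul_of_pos_right _ (by omega)
  obtain ⟨z, hz⟩ : ∃ z, z = 22 * C + R + 10000 := ⟨_, rfl⟩
  obtain ⟨K, hK₁, hK₂⟩ : ∃ K, 9262 * (60 * C + 50) ≤ K ∧
      21 * (8 * C * (6 * R + 19) + 46) ≤ K := ⟨_, le_max_left _ _, le_max_right _ _⟩
  refine ⟨buildProg C, queryProg C R, (C + 2) * z + 1, 20, K, ?_⟩
  rintro S n r rfl hr μ hμ
  have := hμ.prob
  have hr1 := S.one_le_size
  -- The size is positive, so the small case is `n = 1`, where the bound on the probability is `1`.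
  rcases Nat.lt_or_ge n 2 with hn | hn
  · obtain rfl : n = 1 := by omega
    simpa using prob_le_one
  have hbad := S.measure_exists_badBlock_le (c := c) (hρ μ hμ) hC₀ hρC hn hr (C₁ := C₁) (by omega) 6
    (7 + voteSpan (n ^ C).size)
  rw [← hC] at hbad
  refine (measure_mono fun err herr => ?_).trans hbad
  by_contra hgood
  simp only [mem_ofPred_eq, not_exists, not_and, not_or] at hgood
  obtain ⟨s', h1, h2, h3, h4, h5⟩ := S.exists_build_run hn hr (C := C) (z := z) (by omega)
    (by omega) hK₁ hgood
  exact herr ⟨s', h1, h2, h3, h4,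
    h5.supports hρ hR hn hr (by omega) (by omega) (by omega) (by omega) hK₂⟩
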